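/- **Conventions.** A metric measure space $(X,d,m)$ is a complete separable metric space with a boundedly finite Borel measure. The slope of $f:X\to\mathbb R$ is $\operatorname{lip}f(x)=\limsup_{y\to x}|f(y)-f(x)|/d(y,x)$ ($0$ at isolated points). The Sobolev space $H^{1,2}(X)$ consists of the $f\in L^2(m)$ that are $L^2$-limits of boundedly supported Lipschitz functions $f_n$ with $\sup_n\int\operatorname{lip}(f_n)^2\,dm<\infty$, normed by $\|f\|^2=\int |f|^2\,dm+\inf_{(f_n)}\liminf_n\int\operatorname{lip}(f_n)^2\,dm$, the infimum being over all sequences of boundedly supported Lipschitz functions converging to $f$ in $L^2(m)$. The space is infinitesimally Hilbertian if this norm comes from an inner product, and infinitesimally non-Hilbertian otherwise. It is $m$-rectifiable if, up to an $m$-null set, it is partitioned into countably many Borel sets $U_i$ with $m|_{U_i}\ll\mathcal H^{n_i}$, each biLipschitz equivalent to a subset of $\mathbb R^{n_i}$. It is $2$-Ahlfors regular if for some $\alpha\ge1$ one has $\alpha^{-1}r^2\le m(B_r(x))\le\alpha r^2$ for all $x$ and all $0<r<\operatorname{diam}X$. It is a PI space if it is doubling and supports a weak $(1,2)$-Poincaré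 inequality (for boundedly supported Lipschitz functions and their slopes). The tangent cone $\operatorname{Tan}_p(X,d,m)$ is the set of pointed metric measure spaces $(Y,d_Y,m_Y,q)$ (with $q\in\operatorname{spt}m_Y$) that are pointed measured Gromov–Hausdorff limits of $(X,d/r_k,m/m(B_{r_k}(p)),p)$ for some $r_k\searrow0$; here $p\in\operatorname{spt}m$. Hausdorff measure $\mathcal H^2$ is normalised to equal Lebesgue measure on the Euclidean plane. For $\rho:\mathbb R^2\to[1,2]$, $d_\rho(a,b)$ is the infimum of $\int_0^1\rho(\gamma_t)|\dot\gamma_t|\,dt$ over Lipschitz curves $\gamma:[0,1]\to\mathbb R^2$ from $a$ to $b$. **Weights.** Let $\mathcal W$ be the family of open dyadic squares $(i2^k,(i+1)2^k)\times(j2^k,(j+1)2^k)$, $k\in\mathbb Z$, with $(i,j)\in\{-2,-1,0,1\}^2\setminus\{-1,0\}^2$ (the Whitney decomposition of $\mathbb R^2\setminus\{0\}$). Let $\mathcal S$ be obtained from $\mathcal W$ by keeping the squares of side $2^k$ with $k\ge0$ and replacing those with $k<0$ by their dyadic subsquares of side $4^k$. Put $R=\mathbb R^2\setminus\bigcup_{Q\in\mathcal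 S}Q$ and $N_k=[-2^{-k},2^{-k}]^2$. Let $\theta_Q$ be the dilation followed by a translation that maps the unit square onto $\bar Q$. A profile sequence is a sequence of smooth functions $\psi_n:(-1,2)^2\to[1,2]$, nondecreasing in $n\in\mathbb N$, with $\psi_n=1$ near $\partial([0,1]^2)$ and $\psi_n=2$ on $[2^{-(n+2)},1-2^{-(n+2)}]^2$. **Theorem.** There exist a profile sequence $(\psi_n)_{n\in\mathbb N}$ and a strictly increasing $n:\mathbb N\to\mathbb N$ such that the function $$\rho=\chi_R+\sum_{Q\in\mathcal S}\chi_Q\,\psi_{m(Q)}\circ\theta_Q^{-1},\qquad m(Q)=\begin{cases}n(k)&\text{if }Q\subset N_k,\ Q\not\subset N_{k+1},\ k\in\mathbb N,\\0&\text{if }Q\not\subset N_0,\end{cases}$$ takes values in $[1,2]$, is smooth on $\mathbb R^2\setminus\{0\}$, and, with $m=\mathcal H^2_{d_\rho}$ the $2$-dimensional Hausdorff measure of $(\mathbb R^2,d_\rho)$, the following hold. 1. $d_\rho$ is a distance inducing the usual topology, and $(\mathbb R^2,d_\rho,m)$ is an infinitesimally Hilbertian, $m$-rectifiable, $2$-Ahlfors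 regular PI space. 2. $(\mathbb R^2\setminus\{0\},d_\rho,m)$ is a smooth Riemannian manifold: $g_x(v,w)=\rho(x)^2\langle v,w\rangle$ is a smooth Riemannian metric on $\mathbb R^2\setminus\{0\}$ whose Riemannian distance is the restriction of $d_\rho$ and whose volume measure is the restriction of $m$. 3. For all $k\ge2$ and $a,b\in N_k$, $\big|d_\rho(a,b)-\|a-b\|_1\big|\le4^{-k}$. 4. There is a boundedly finite Borel measure $\mu$ on $\mathbb R^2$ with $0\in\operatorname{spt}\mu$ such that $(\mathbb R^2,\|\cdot\|_1,\mu,0)\in\operatorname{Tan}_0(\mathbb R^2,d_\rho,m)$, and $(\mathbb R^2,\|\cdot\|_1,\mu)$ is infinitesimally non-Hilbertian. -/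

import Mathlib

open MeasureTheory Filter Topology Set Metric
open scoped ENNReal NNReal ContDiff Manifold BoundedContinuousFunction Bundle

noncomputable section

/-! ### Metric measure spaces -/

/-- A metric measure space: a complete separable metric space with a boundedly finite Borel
measure. -/
structure IsMetricMeasureSpace {X : Type*} [MetricSpace X] [MeasurableSpace X] [BorelSpace X]
    (m : Measure X) : Prop where
  complete : CompleteSpace X
  separable : TopologicalSpace.SeparableSpace X
  boundedly_finite : ∀ s : Set X, Bornology.IsBounded s → m s < ⊤

/-- A pointed metric measure space: the reference point lies in the support of the measure. -/
structure IsPointedMetricMeasureSpace {X : Type*} [MetricSpace X] [MeasurableSpace X]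
    [BorelSpace X] (m : Measure X) (p : X) : Prop extends IsMetricMeasureSpace m where
  mem_support : p ∈ m.support

/-- The slope `lip f x = limsup_{y → x, y ≠ x} |f y - f x| / d(y, x)`; it is `0` at isolated
points, since the limsup along the trivial filter is the bottom element of `[0, ∞]`. -/
def lipSlope {X : Type*} [MetricSpace X] (f : X → ℝ) (x : X) : ℝ≥0∞ :=
  limsup (fun y => edist (f y) (f x) / edist y x) (𝓝[≠] x)

/-- Boundedly supported Lipschitz functions. -/
def IsBddSuppLipschitz {X : Type*} [MetricSpace X] (f : X → ℝ) : Prop :=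
  (∃ K : ℝ≥0, LipschitzWith K f) ∧ Bornology.IsBounded (Function.support f)

/-- `u` is a sequence of boundedly supported Lipschitz functions converging to `f` in `L²(m)`. -/
def IsLipApprox {X : Type*} [MetricSpace X] [MeasurableSpace X] (m : Measure X)
    (u : ℕ → X → ℝ) (f : Lp ℝ 2 m) : Prop :=
  (∀ n, IsBddSuppLipschitz (u n)) ∧
    Tendsto (fun n => eLpNorm (fun x => u n x - f x) 2 m) atTop (𝓝 0)

/-- The Sobolev space `H^{1,2}(X)` in the sense of Cheeger. -/
def sobolevSpace {X : Type*} [MetricSpace X] [MeasurableSpace X] (m : Measure X) :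
    Set (Lp ℝ 2 m) :=
  {f | ∃ u : ℕ → X → ℝ, IsLipApprox m u f ∧
    ∃ C : ℝ≥0, ∀ n, ∫⁻ x, lipSlope (u n) x ^ 2 ∂m ≤ C}

/-- The relaxed energy: the infimum of `liminf ∫ lip(u_n)² dm` over all approximating sequences. -/
def relaxedEnergy {X : Type*} [MetricSpace X] [MeasurableSpace X] (m : Measure X)
    (f : Lp ℝ 2 m) : ℝ≥0∞ :=
  ⨅ (u : ℕ → X → ℝ) (_ : IsLipApprox m u f),
    liminf (fun n => ∫⁻ x, lipSlope (u n) x ^ 2 ∂m) atTop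

/-- The Sobolev norm (the relaxed energy is finite on `sobolevSpace m`). -/
def sobolevNorm {X : Type*} [MetricSpace X] [MeasurableSpace X] (m : Measure X)
    (f : Lp ℝ 2 m) : ℝ :=
  Real.sqrt ((∫ x, |f x| ^ 2 ∂m) + (relaxedEnergy m f).toReal)

/-- Infinitesimal Hilbertianity: the norm of `H^{1,2}(X)` is induced by an inner product, i.e. by
a symmetric bilinear form `B` on `H^{1,2}(X)`. (Only the values of `B` on `H^{1,2}(X)` matter;
`H^{1,2}(X)` is complete on every metric measure space.) -/
def InfinitesimallyHilbertian {X : Type*} [MetricSpace X] [MeasurableSpace X]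
    (m : Measure X) : Prop :=
  ∃ B : Lp ℝ 2 m → Lp ℝ 2 m → ℝ,
    (∀ f ∈ sobolevSpace m, ∀ g ∈ sobolevSpace m, B f g = B g f) ∧
    (∀ f ∈ sobolevSpace m, ∀ g ∈ sobolevSpace m, ∀ h ∈ sobolevSpace m,
      B (f + g) h = B f h + B g h) ∧
    (∀ c : ℝ, ∀ f ∈ sobolevSpace m, ∀ g ∈ sobolevSpace m, B (c • f) g = c * B f g) ∧
    (∀ f ∈ sobolevSpace m, B f f = sobolevNorm m f ^ 2)

/-- The doubling condition. -/
def IsDoublingMeasureSpace {X : Type*} [MetricSpace X] [MeasurableSpace X]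
    (m : Measure X) : Prop :=
  ∃ C : ℝ≥0, 1 ≤ C ∧ ∀ (x : X) (r : ℝ), 0 < r → m (ball x (2 * r)) ≤ C * m (ball x r)

/-- `k`-Ahlfors regularity. -/
def IsAhlforsRegular {X : Type*} [MetricSpace X] [MeasurableSpace X] (k : ℝ)
    (m : Measure X) : Prop :=
  ∃ α : ℝ, 1 ≤ α ∧ ∀ (x : X) (r : ℝ), 0 < r → ENNReal.ofReal r < ediam (univ : Set X) →
    ENNReal.ofReal (α⁻¹ * r ^ k) ≤ m (ball x r) ∧ m (ball x r) ≤ ENNReal.ofReal (α * r ^ k)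

/-- The weak `(1,2)`-Poincaré inequality. -/
def SupportsWeakPoincare {X : Type*} [MetricSpace X] [MeasurableSpace X]
    (m : Measure X) : Prop :=
  ∃ C : ℝ, 0 < C ∧ ∃ l : ℝ, 1 ≤ l ∧ ∀ f : X → ℝ, IsBddSuppLipschitz f →
    ∀ (x : X) (r : ℝ), 0 < r →
      ENNReal.ofReal (⨍ y in ball x r, |f y - ⨍ z in ball x r, f z ∂m| ∂m) ≤
        ENNReal.ofReal (C * r) * (⨍⁻ y in ball x (l * r), lipSlope f y ^ 2 ∂m) ^ (1 / 2 : ℝ)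

/-- PI spaces: doubling spaces supporting a weak `(1,2)`-Poincaré inequality. -/
def IsPISpace {X : Type*} [MetricSpace X] [MeasurableSpace X] (m : Measure X) : Prop :=
  IsDoublingMeasureSpace m ∧ SupportsWeakPoincare m

/-- `(U, φ)` is an `n`-chart: `U` is Borel, `m|_U ≪ H^n`, and `φ : U → ℝⁿ` is biLipschitz with its
image (the values of `φ` off `U` play no role). -/
def IsRectifiableChart {X : Type*} [MetricSpace X] [MeasurableSpace X] [BorelSpace X]
    (m : Measure X) (n : ℕ) (U : Set X) (φ : X → EuclideanSpace ℝ (Fin n)) : Prop :=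
  MeasurableSet U ∧ (m.restrict U) ≪ (μH[n] : Measure X) ∧
    ∃ K L : ℝ≥0, LipschitzOnWith K φ U ∧ AntilipschitzWith L (U.domRestrict φ)

/-- `m`-rectifiability: there is a countable family of charts whose domains partition the space up
to an `m`-null set; the dimensions may vary. -/
def IsMRectifiable {X : Type*} [MetricSpace X] [MeasurableSpace X] [BorelSpace X]
    (m : Measure X) : Prop :=
  ∃ (n : ℕ → ℕ) (U : ℕ → Set X) (φ : ∀ i, X → EuclideanSpace ℝ (Fin (n i))),
    (∀ i, IsRectifiableChart m (n i) (U i) (φ i)) ∧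
    Pairwise (fun i j => Disjoint (U i) (U j)) ∧ m (⋃ i, U i)ᶜ = 0

/-! ### Tangent cones -/

/-- `(Y, d_Y, mY, q)` belongs to the pmGH-tangent cone `Tan_p(X, d, m)`. A Borel map defined on a
ball is represented by a Borel map on the whole space, of which only the restriction to the ball is
used. -/
structure IsPmGHTangent {X Y : Type*} [MetricSpace X] [MeasurableSpace X] [BorelSpace X]
    [MetricSpace Y] [MeasurableSpace Y] [BorelSpace Y]
    (m : Measure X) (p : X) (mY : Measure Y) (q : Y) : Prop where
  source : IsPointedMetricMeasureSpace m p
  target : IsPointedMetricMeasureSpace mY q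
  blowUp : ∃ r : ℕ → ℝ, StrictAnti r ∧ (∀ k, 0 < r k) ∧ Tendsto r atTop (𝓝 0) ∧
    ∀ ε ∈ Ioo (0 : ℝ) 1, ∀ᵐ R : ℝ, 1 < R → ∃ (k₀ : ℕ) (ψ : ℕ → X → Y),
      (∀ k ≥ k₀, Measurable (ψ k) ∧ ψ k p = q ∧
        (∀ x ∈ ball p (R * r k), ∀ y ∈ ball p (R * r k),
          |dist x y - r k * dist (ψ k x) (ψ k y)| ≤ ε * r k) ∧
        ball q (R - ε) ⊆ thickening ε (ψ k '' ball p (R * r k))) ∧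
      ∀ f : Y →ᵇ ℝ, Bornology.IsBounded (Function.support f) →
        Tendsto (fun k => (m (ball p (r k))).toReal⁻¹ *
            ∫ y, f y ∂((m.restrict (ball p (R * r k))).map (ψ k)))
          atTop (𝓝 (∫ y in ball q R, f y ∂mY))

/-! ### The plane with a conformal length distance -/

/-- The Euclidean plane. -/
abbrev Plane : Type := EuclideanSpace ℝ (Fin 2)

/-- The plane with the `ℓ¹`-norm and its distance. -/
abbrev PlaneL1 : Type := PiLp 1 (fun _ : Fin 2 => ℝ)

/-- The length `∫₀¹ ρ(γ_t) |γ'_t| dt` of a curve. -/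
def weightedLength (ρ : Plane → ℝ) (γ : ℝ → Plane) : ℝ≥0∞ :=
  ∫⁻ t in Icc (0 : ℝ) 1, ENNReal.ofReal (ρ (γ t)) * ‖deriv γ t‖ₑ

/-- The length distance `d_ρ` induced by `(x, v) ↦ ρ(x)|v|`: the infimum of the lengths of the
Lipschitz curves `γ : [0,1] → ℝ²` from `a` to `b`. -/
def weightedEDist (ρ : Plane → ℝ) (a b : Plane) : ℝ≥0∞ :=
  ⨅ (γ : ℝ → Plane) (_ : (∃ K : ℝ≥0, LipschitzOnWith K γ (Icc 0 1)) ∧ γ 0 = a ∧ γ 1 = b),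
    weightedLength ρ γ

/-- The `ℓ¹`-norm on the plane. -/
def l1Norm (v : Plane) : ℝ := |v 0| + |v 1|

/-! ### Weights built on the Whitney decomposition of the punctured plane -/

/-- The index of the dyadic square `(i 2^k, (i+1) 2^k) × (j 2^k, (j+1) 2^k)`. -/
structure DyadicSquare where
  k : ℤ
  i : ℤ
  j : ℤ

/-- The open square in the plane. -/
def DyadicSquare.toSet (Q : DyadicSquare) : Set Plane :=
  {x | x 0 ∈ Ioo ((Q.i : ℝ) * 2 ^ Q.k) ((Q.i + 1 : ℝ) * 2 ^ Q.k) ∧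
    x 1 ∈ Ioo ((Q.j : ℝ) * 2 ^ Q.k) ((Q.j + 1 : ℝ) * 2 ^ Q.k)}

/-- The inverse of the map `θ_Q` (dilation followed by translation) from the unit square onto
`Q`. -/
def DyadicSquare.unitCoord (Q : DyadicSquare) (x : Plane) : Plane :=
  !₂[(x 0 - Q.i * 2 ^ Q.k) / 2 ^ Q.k, (x 1 - Q.j * 2 ^ Q.k) / 2 ^ Q.k]

/-- The positions of the twelve Whitney squares of each scale. -/
def whitneyPositions : Finset (ℤ × ℤ) :=
  {(1, 0), (1, 1), (0, 1), (-1, 1), (-2, 1), (-2, 0),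
    (-2, -1), (-2, -2), (-1, -2), (0, -2), (1, -2), (1, -1)}

/-- The Whitney decomposition `W` of the punctured plane. -/
def whitneySquares : Set DyadicSquare := {Q | (Q.i, Q.j) ∈ whitneyPositions}

/-- The family `S`: a Whitney square of side `2^k` is kept if `k ≥ 0`, and is subdivided into dyadic
squares of side `4^k` if `k < 0`. -/
def subdividedSquares : Set DyadicSquare :=
  {Q' | ∃ Q ∈ whitneySquares, Q'.toSet ⊆ Q.toSet ∧ Q'.k = Q.k + min Q.k 0}

/-- The square `N_k = [-2^{-k}, 2^{-k}]²`. -/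
def centralSquare (k : ℕ) : Set Plane :=
  {x | |x 0| ≤ (1 / 2 : ℝ) ^ k ∧ |x 1| ≤ (1 / 2 : ℝ) ^ k}

/-- The profiles `ψ_n : (-1,2)² → [1,2]`: smooth, equal to `1` near the boundary of the unit square,
equal to `2` on `[2^{-(n+2)}, 1 - 2^{-(n+2)}]²`, and nondecreasing in `n`. -/
structure IsProfileSequence (ψ : ℕ → Plane → ℝ) : Prop where
  smooth : ∀ n, ContDiffOn ℝ ∞ (ψ n) {x | ∀ i, x i ∈ Ioo (-1 : ℝ) 2}
  mem_Icc : ∀ n x, (∀ i, x i ∈ Ioo (-1 : ℝ) 2) → ψ n x ∈ Icc (1 : ℝ) 2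
  eq_one : ∀ n, ∀ᶠ x in 𝓝ˢ (frontier {x : Plane | ∀ i, x i ∈ Icc (0 : ℝ) 1}), ψ n x = 1
  eq_two : ∀ n x, (∀ i, x i ∈ Icc ((1 / 2 : ℝ) ^ (n + 2)) (1 - (1 / 2 : ℝ) ^ (n + 2))) →
    ψ n x = 2
  mono : ∀ n x, (∀ i, x i ∈ Ioo (-1 : ℝ) 2) → ψ n x ≤ ψ (n + 1) x

/-- `ρ` is the weight `χ_R + ∑_{Q ∈ S} χ_Q ψ_{m(Q)} ∘ θ_Q⁻¹`, where `R` is the complement of the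
(pairwise disjoint) squares of `S`, and where `m(Q) = n(k)` if `Q ⊆ N_k` but `Q ⊄ N_{k+1}`, while
`m(Q) = 0` if `Q ⊄ N_0`. -/
structure IsWhitneyWeight (ψ : ℕ → Plane → ℝ) (n : ℕ → ℕ) (ρ : Plane → ℝ) : Prop where
  on_grid : ∀ x, (∀ Q ∈ subdividedSquares, x ∉ Q.toSet) → ρ x = 1
  on_inner : ∀ Q ∈ subdividedSquares, ∀ k : ℕ, Q.toSet ⊆ centralSquare k →
    ¬ Q.toSet ⊆ centralSquare (k + 1) → ∀ x ∈ Q.toSet, ρ x = ψ (n k) (Q.unitCoord x)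
  on_outer : ∀ Q ∈ subdividedSquares, ¬ Q.toSet ⊆ centralSquare 0 →
    ∀ x ∈ Q.toSet, ρ x = ψ 0 (Q.unitCoord x)

/-! ### Riemannian metrics on the punctured plane -/

/-- The smooth manifold `ℝ² \ {0}`. -/
def puncturedPlane : TopologicalSpace.Opens Plane := ⟨{0}ᶜ, isOpen_compl_singleton⟩

/-- Smooth Riemannian metrics on `ℝ² \ {0}`. -/
abbrev PuncturedPlaneMetric : Type :=
  Bundle.ContMDiffRiemannianMetric 𝓘(ℝ, Plane) ∞ Plane
    (fun x : puncturedPlane => TangentSpace 𝓘(ℝ, Plane) x)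

/-- The value `g_x(v, w)`, tangent vectors being written in the standard coordinates. -/
def PuncturedPlaneMetric.form (g : PuncturedPlaneMetric) (x : puncturedPlane) (v w : Plane) : ℝ :=
  g.inner x (show TangentSpace 𝓘(ℝ, Plane) x from v) (show TangentSpace 𝓘(ℝ, Plane) x from w)

/-- The Riemannian distance of `(ℝ² \ {0}, g)`. -/
def PuncturedPlaneMetric.riemEDist (g : PuncturedPlaneMetric) (x y : puncturedPlane) : ℝ≥0∞ :=
  letI : Bundle.RiemannianBundle (fun x : puncturedPlane => TangentSpace 𝓘(ℝ, Plane) x) :=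
    ⟨g.toRiemannianMetric⟩
  Manifold.riemannianEDist 𝓘(ℝ, Plane) x y

/-- The Riemannian volume measure of `(ℝ² \ {0}, g)`: density `√det(g(e_i, e_j))` with respect to
Lebesgue measure in the standard coordinates. -/
def PuncturedPlaneMetric.riemVolume (g : PuncturedPlaneMetric) : Measure puncturedPlane :=
  ((volume : Measure Plane).comap Subtype.val).withDensity fun x =>
    ENNReal.ofReal (Real.sqrt (Matrix.det (Matrix.of fun i j : Fin 2 =>
      g.form x (EuclideanSpace.single i 1) (EuclideanSpace.single j 1))))

end

/-! General weights. If `1 ≤ ρ ≤ 2` and `ρ` is continuous off the origin, then `|a - b| ≤ d_ρ(a, b)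
≤ 2|a - b|`, so rectifiability, Ahlfors regularity, doubling and the Poincaré inequality are
inherited from the Euclidean plane with worse constants. At `x ≠ 0` the distance is infinitesimally
`ρ(x)|·|` (`weightedEDist_local`). Hence the Hausdorff measure has density `ρ²`
(`WeightedPlane.map_euclideanHausdorffMeasure`), the slope of a Lipschitz function is `|∇f|/ρ`
almost everywhere (`WeightedPlane.lipSlope_eq`), and in dimension two the factors cancel: the energy
is the Euclidean Dirichlet integral. It satisfies the parallelogram law on Lipschitz functions, and
the law survives relaxation (`infinitesimallyHilbertian_of_parallelogram`). The origin is a null set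
and can be bypassed at arbitrarily small cost, so `d_ρ` is also the Riemannian distance of the
punctured plane.

Lower bounds for `d_ρ` come from calibrations: a function whose pointwise Lipschitz constant is at
most `ρ` everywhere is `1`-Lipschitz for `d_ρ` (`ofReal_abs_sub_le_weightedEDist`).

The ℓ¹ geometry. The weight is `1` on a grid of lines and `2` outside thin neighbourhoods of them.
Travelling along grid lines costs the ℓ¹-distance, and inside `N_k` a grid line is within
`4^{-(k+1)}` of every point; this is the upper bound. For the lower bound let `F(t)` measure the
part of `(-∞, t]` that lies in `[-2^{-k}, 2^{-k}]` and off the projected grid neighbourhoods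
(`stripFun`). Then `±F(x₀) ± F(x₁)` is a calibration: it uses both coordinates only where `ρ = 2`,
and elsewhere at least one of the two terms is locally constant. The discarded neighbourhoods have
total length at most `4^{-k}/2` in each coordinate. The error `4^{-k}` is of second order in the
scale `2^{-k}`, so blowing up along `2^{-k}` gives the ℓ¹-plane. A Borel–Cantelli argument shows
that the rescaled weights are eventually `2` almost everywhere, so the rescaled measures converge to
a multiple of Lebesgue measure.

The limit is not Hilbertian. The norm dual to ℓ¹ is the maximum norm. Take two waves of amplitude
`δ` and derivative of order one, in the two coordinate directions, both multiplied by a fixed cone.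
The cutoff contributes only `O(δ)` to the gradients, and the energies of the sum and the difference
miss the parallelogram law by an amount that does not tend to `0` with `δ`. The energies of single
waves are bounded below by duality (`ofReal_integral_le_relaxedEnergy`), so no minimal slope has to
be identified. -/

/-! ### Pointwise Lipschitz constants along Lipschitz curves -/

/-- `f` has pointwise Lipschitz constant at most `c` at `x`. -/
def HasSlopeLE {X : Type*} [PseudoMetricSpace X] (f : X → ℝ) (x : X) (c : ℝ) : Prop :=
  ∀ c' > c, ∀ᶠ y in 𝓝 x, |f y - f x| ≤ c' * dist y x

theorem HasSlopeLE.continuousAt {X : Type*} [PseudoMetricSpace X] {f : X → ℝ} {x : X} {c : ℝ}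
    (h : HasSlopeLE f x c) : ContinuousAt f x := by
  rw [ContinuousAt, tendsto_iff_dist_tendsto_zero]
  have h1 : Tendsto (fun y => (c + 1) * dist y x) (𝓝 x) (𝓝 0) := by
    have : Continuous fun y => (c + 1) * dist y x := by fun_prop
    simpa using this.tendsto x
  refine squeeze_zero' (Eventually.of_forall fun _ => dist_nonneg) ?_ h1
  filter_upwards [h (c + 1) (by linarith)] with y hy
  rwa [Real.dist_eq]

theorem HasSlopeLE.mono {X : Type*} [PseudoMetricSpace X] {f : X → ℝ} {x : X} {c d : ℝ}
    (h : HasSlopeLE f x c) (hcd : c ≤ d) : HasSlopeLE f x d :=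
  fun c' hc' => h c' (hcd.trans_lt hc')

theorem HasSlopeLE.of_eventually {X : Type*} [PseudoMetricSpace X] {f : X → ℝ} {x : X} {c : ℝ}
    (h : ∀ᶠ y in 𝓝 x, |f y - f x| ≤ c * dist y x) : HasSlopeLE f x c := by
  intro c' hc'
  filter_upwards [h] with y hy
  exact hy.trans (mul_le_mul_of_nonneg_right hc'.le dist_nonneg)

theorem HasSlopeLE.neg {X : Type*} [PseudoMetricSpace X] {f : X → ℝ} {x : X} {c : ℝ}
    (h : HasSlopeLE f x c) : HasSlopeLE (fun y => -f y) x c := by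
  intro c' hc'
  filter_upwards [h c' hc'] with y hy
  rwa [neg_sub_neg, abs_sub_comm]

section curves

variable {E : Type*} [NormedAddCommGroup E]

/-- A mean value inequality: the right difference quotients of `f ∘ γ` are eventually below every `r
> M K`, so the line of slope `M K` is a barrier. Neither `f` nor `γ` needs to be differentiable. -/
theorem sub_le_of_hasSlopeLE_curve {f : E → ℝ} {γ : ℝ → E} {s t M : ℝ} {K : ℝ≥0}
    (hst : s ≤ t) (hγ : LipschitzOnWith K γ (Icc s t)) (hM : 0 ≤ M)
    (hf : ∀ r ∈ Icc s t, HasSlopeLE f (γ r) M) : f (γ t) - f (γ s) ≤ M * K * (t - s) := by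
  have hcont : ContinuousOn (fun r => f (γ r) - f (γ s)) (Icc s t) := by
    intro r hr
    exact ((hf r hr).continuousAt.comp_continuousWithinAt (hγ.continuousOn r hr)).sub
      continuousWithinAt_const
  have key := image_le_of_liminf_slope_right_le_deriv_boundary
    (f := fun r => f (γ r) - f (γ s)) (B := fun r => M * K * (r - s)) (B' := fun _ => M * K)
    hcont (by simp) (by fun_prop)
    (fun x _ => by
      simpa using (((hasDerivAt_id x).sub_const s).const_mul (M * K)).hasDerivWithinAt)
    (fun x hx r hr => by
      -- Dividing by `K + 1` instead of `K` also covers `K = 0`.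
      have hη : ∃ η > 0, (M + η) * K < r := by
        refine ⟨(r - M * K) / (K + 1) , by have := sub_pos.2 hr; positivity, ?_⟩
        have h1 : (r - M * K) / (K + 1 : ℝ) * K < r - M * K := by
          rw [div_mul_eq_mul_div, div_lt_iff₀ (by positivity)]
          have := sub_pos.2 hr
          nlinarith
        linarith [add_mul M ((r - M * K) / (K + 1 : ℝ)) (K : ℝ)]
      obtain ⟨η, hη, hηr⟩ := hη
      have hxm : x ∈ Icc s t := ⟨hx.1, hx.2.le⟩
      have h1 : ∀ᶠ z in 𝓝[Icc s t] x, |f (γ z) - f (γ x)| ≤ (M + η) * dist (γ z) (γ x) :=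
        (hγ.continuousOn x hxm).eventually (hf x hxm (M + η) (by linarith))
      have h2 : 𝓝[>] x ≤ 𝓝[Icc s t] x := by
        refine nhdsWithin_le_of_mem ?_
        exact mem_of_superset (Ioo_mem_nhdsGT hx.2) fun z hz => ⟨hx.1.trans hz.1.le, hz.2.le⟩
      have h3 : ∀ᶠ z in 𝓝[>] x, z ∈ Icc s t ∧ x < z :=
        Eventually.and (h2 self_mem_nhdsWithin) self_mem_nhdsWithin
      refine Eventually.frequently ?_
      filter_upwards [h2 h1, h3] with z hz hz'
      rw [slope_def_field, div_lt_iff₀ (sub_pos.2 hz'.2)]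
      have h4 : dist (γ z) (γ x) ≤ K * (z - x) := by
        have := hγ.dist_le_mul z hz'.1 x hxm
        rwa [Real.dist_eq, abs_of_pos (sub_pos.2 hz'.2)] at this
      calc f (γ z) - f (γ s) - (f (γ x) - f (γ s)) ≤ |f (γ z) - f (γ x)| := by
            rw [sub_sub_sub_cancel_right]; exact le_abs_self _
        _ ≤ (M + η) * (K * (z - x)) := hz.trans (by gcongr)
        _ = (M + η) * K * (z - x) := by ring
        _ < r * (z - x) := by exact mul_lt_mul_of_pos_right hηr (sub_pos.2 hz'.2))
  exact key ⟨hst, le_rfl⟩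

variable [NormedSpace ℝ E]

/-- Along a Lipschitz curve, a function is controlled by the integral of its pointwise Lipschitz
constants. -/
theorem abs_sub_le_lintegral_curve [FiniteDimensional ℝ E] {f g : E → ℝ} {γ : ℝ → E} {c d M : ℝ}
    {K : ℝ≥0}
    (hcd : c ≤ d) (hγ : LipschitzOnWith K γ (Icc c d))
    (hg : ∀ t ∈ Icc c d, g (γ t) ∈ Icc 0 M)
    (hf : ∀ t ∈ Icc c d, HasSlopeLE f (γ t) (g (γ t))) :
    ENNReal.ofReal |f (γ d) - f (γ c)| ≤
      ∫⁻ t in Icc c d, ENNReal.ofReal (g (γ t)) * ‖deriv γ t‖ₑ := by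
  have hM : 0 ≤ M := (hg c ⟨le_rfl, hcd⟩).1.trans (hg c ⟨le_rfl, hcd⟩).2
  -- The crude bound `M` only serves to make `f ∘ γ` Lipschitz, hence absolutely continuous. The
  -- sharp bound `g` enters through the derivative almost everywhere.
  have hlip : LipschitzOnWith (M.toNNReal * K) (fun t => f (γ t)) (uIcc c d) := by
    rw [uIcc_of_le hcd]
    have aux : ∀ s ∈ Icc c d, ∀ t ∈ Icc c d, s ≤ t →
        |f (γ t) - f (γ s)| ≤ M * K * (t - s) := by
      intro s hs t ht hst
      have hsub : Icc s t ⊆ Icc c d := Icc_subset_Icc hs.1 ht.2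
      have h1 := sub_le_of_hasSlopeLE_curve hst (hγ.mono hsub) hM
        fun r hr => (hf r (hsub hr)).mono (hg r (hsub hr)).2
      have h2 := sub_le_of_hasSlopeLE_curve hst (hγ.mono hsub) hM
        fun r hr => ((hf r (hsub hr)).mono (hg r (hsub hr)).2).neg
      rw [abs_le]; constructor <;> linarith
    refine LipschitzOnWith.of_dist_le_mul fun s hs t ht => ?_
    rw [NNReal.coe_mul, Real.coe_toNNReal _ hM, Real.dist_eq, Real.dist_eq]
    rcases le_total s t with h | h
    · rw [abs_sub_comm, abs_sub_comm s, abs_of_nonneg (sub_nonneg.2 h)]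
      exact aux s hs t ht h
    · rw [abs_of_nonneg (sub_nonneg.2 h)]
      exact aux t ht s hs h
  have hac := hlip.absolutelyContinuousOnInterval
  have hdiffγ : ∀ᵐ t : ℝ, t ∈ Icc c d → DifferentiableWithinAt ℝ γ (Icc c d) t :=
    hγ.ae_differentiableWithinAt_of_mem
  have hdiffh := hac.ae_differentiableAt
  have hae : ∀ᵐ t ∂(volume.restrict (Icc c d)), ‖deriv (fun t => f (γ t)) t‖ₑ ≤
      ENNReal.ofReal (g (γ t)) * ‖deriv γ t‖ₑ := by
    rw [ae_restrict_iff' measurableSet_Icc]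
    have hc : ∀ᵐ t : ℝ, t ≠ c := by simp [ae_iff, measure_singleton]
    have hd : ∀ᵐ t : ℝ, t ≠ d := by simp [ae_iff, measure_singleton]
    filter_upwards [hdiffγ, hdiffh, hc, hd] with t h1 h2 htc htd ht
    have hnhds : Icc c d ∈ 𝓝 t := Icc_mem_nhds (lt_of_le_of_ne ht.1 htc.symm)
      (lt_of_le_of_ne ht.2 htd)
    have h1' := ((h1 ht).differentiableAt hnhds).hasDerivAt
    have h2' := (h2 (by rwa [uIcc_of_le hcd])).hasDerivAt
    have hgt := hg t ht
    -- Difference quotients of `f ∘ γ` are compared with those of `γ`; no derivative of `f` at `γ t`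
    -- is involved, so `γ` may run inside a null set where `f` is not differentiable.
    have key : ‖deriv (fun t => f (γ t)) t‖ ≤ g (γ t) * ‖deriv γ t‖ := by
      have l1 := (hasDerivAt_iff_tendsto_slope.1 h2').norm
      have l2 := (hasDerivAt_iff_tendsto_slope.1 h1').norm
      have : ∀ η > 0, ‖deriv (fun t => f (γ t)) t‖ ≤ (g (γ t) + η) * ‖deriv γ t‖ := by
        intro η hη
        refine le_of_tendsto_of_tendsto l1 (l2.const_mul (g (γ t) + η)) ?_
        have h3 : ∀ᶠ s in 𝓝 t, |f (γ s) - f (γ t)| ≤ (g (γ t) + η) * dist (γ s) (γ t) :=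
          h1'.continuousAt.eventually (hf t ht (g (γ t) + η) (by linarith))
        filter_upwards [mem_nhdsWithin_of_mem_nhds h3] with s hs
        rw [slope_def_module, slope_def_module, norm_smul, norm_smul, mul_left_comm]
        refine mul_le_mul_of_nonneg_left ?_ (norm_nonneg _)
        rw [dist_eq_norm] at hs
        exact hs
      refine ge_of_tendsto (x := 𝓝[>] (0 : ℝ)) (b := ‖deriv (fun t => f (γ t)) t‖)
        (f := fun η => (g (γ t) + η) * ‖deriv γ t‖) ?_
        (by filter_upwards [self_mem_nhdsWithin] with η hη using this η hη)
      have : Continuous fun η : ℝ => (g (γ t) + η) * ‖deriv γ t‖ := by fun_prop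
      simpa using (this.tendsto 0).mono_left nhdsWithin_le_nhds
    rw [← ofReal_norm, ← ofReal_norm, ← ENNReal.ofReal_mul hgt.1]
    exact ENNReal.ofReal_le_ofReal key
  rw [← hac.integral_deriv_eq_sub, intervalIntegral.integral_of_le hcd, ← Real.norm_eq_abs,
    ofReal_norm]
  calc ‖∫ t in Ioc c d, deriv (fun t => f (γ t)) t‖ₑ
      ≤ ∫⁻ t in Ioc c d, ‖deriv (fun t => f (γ t)) t‖ₑ := enorm_integral_le_lintegral_enorm _
    _ ≤ ∫⁻ t in Icc c d, ‖deriv (fun t => f (γ t)) t‖ₑ :=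
        lintegral_mono_set Ioc_subset_Icc_self
    _ ≤ _ := lintegral_mono_ae hae

end curves

/-! ### The length distance of a weight -/

/-- Serves for rescaling the parameter interval and, with `α < 0`, for reversing a curve.
Differentiability is not needed, since the default value of `deriv` scales in the same way. -/
theorem lintegral_speed_comp_affine {E : Type*} [NormedAddCommGroup E] [NormedSpace ℝ E]
    (F : E → ℝ≥0∞) (γ : ℝ → E) {α : ℝ} (hα : α ≠ 0) (β : ℝ) {s : Set ℝ} (hs : MeasurableSet s) :
    ∫⁻ t in s, F (γ (α * t + β)) * ‖deriv (fun t => γ (α * t + β)) t‖ₑ =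
      ∫⁻ t in (fun t => α * t + β) '' s, F (γ t) * ‖deriv γ t‖ₑ := by
  have hd : ∀ t ∈ s, HasDerivWithinAt (fun t => α * t + β) α s t := fun t _ => by
    simpa using (((hasDerivAt_id t).const_mul α).add_const β).hasDerivWithinAt
  have hinj : InjOn (fun t => α * t + β) s := fun x _ y _ h => by
    simpa [hα] using h
  rw [lintegral_image_eq_lintegral_abs_deriv_mul hs hd hinj]
  refine lintegral_congr fun t => ?_
  have h1 : deriv (fun t => γ (α * t + β)) t = α • deriv γ (α * t + β) := by
    have := deriv_comp_mul_left α (fun u => γ (u + β)) t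
    rw [this, deriv_comp_add_const]
  rw [h1, enorm_smul, mul_left_comm, Real.enorm_eq_ofReal_abs]

theorem weightedEDist_le_of_curve (ρ : Plane → ℝ) {γ : ℝ → Plane} {c d : ℝ} {K : ℝ≥0}
    (hcd : c ≤ d) (hγ : LipschitzOnWith K γ (Icc c d)) :
    weightedEDist ρ (γ c) (γ d) ≤
      ∫⁻ t in Icc c d, ENNReal.ofReal (ρ (γ t)) * ‖deriv γ t‖ₑ := by
  rcases hcd.eq_or_lt with rfl | hlt
  · refine (iInf₂_le (fun _ => γ c) ⟨⟨0, LipschitzWith.lipschitzOnWith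
      (LipschitzWith.const _)⟩, rfl, rfl⟩).trans ?_
    simp [weightedLength]
  · have hα : d - c ≠ 0 := (sub_pos.2 hlt).ne'
    have himg : (fun t => (d - c) * t + c) '' Icc 0 1 = Icc c d := by
      rw [image_affine_Icc' (sub_pos.2 hlt)]; simp
    have hlip : LipschitzOnWith (K * ‖d - c‖₊) (fun t => γ ((d - c) * t + c)) (Icc 0 1) := by
      refine hγ.comp (g := γ) (f := fun t => (d - c) * t + c) ?_ ?_
      · refine LipschitzWith.lipschitzOnWith (LipschitzWith.of_dist_le_mul fun x y => ?_)
        rw [dist_add_right, dist_eq_norm, ← mul_sub, norm_mul, dist_eq_norm]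
        rfl
      · rw [← himg]; exact mapsTo_image _ _
    refine (iInf₂_le (fun t => γ ((d - c) * t + c)) ⟨⟨_, hlip⟩, by simp, by simp⟩).trans ?_
    rw [weightedLength, lintegral_speed_comp_affine (fun x => ENNReal.ofReal (ρ x)) γ hα c
      measurableSet_Icc, himg]

theorem weightedEDist_self (ρ : Plane → ℝ) (a : Plane) : weightedEDist ρ a a = 0 := by
  have := weightedEDist_le_of_curve ρ (γ := fun _ => a) (c := 0) (d := 0) (K := 0) le_rfl
    (LipschitzWith.lipschitzOnWith (LipschitzWith.const _))
  simpa using this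

theorem weightedEDist_comm_le (ρ : Plane → ℝ) (a b : Plane) :
    weightedEDist ρ b a ≤ weightedEDist ρ a b := by
  refine le_iInf₂ fun γ ⟨⟨K, hK⟩, h0, h1⟩ => ?_
  have himg : (fun t : ℝ => (-1) * t + 1) '' Icc 0 1 = Icc 0 1 := by
    have : (fun t : ℝ => (-1) * t + 1) = fun t => 1 - t := by ext; ring
    rw [this]; simp
  have hlip : LipschitzOnWith (K * 1) (fun t => γ ((-1) * t + 1)) (Icc 0 1) := by
    refine hK.comp (g := γ) (f := fun t => (-1) * t + 1) ?_ ?_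
    · refine LipschitzWith.lipschitzOnWith (LipschitzWith.of_dist_le_mul fun x y => ?_)
      simp
    · intro t ht; rw [← himg]; exact mem_image_of_mem _ ht
  refine (iInf₂_le (fun t => γ ((-1) * t + 1)) ⟨⟨_, hlip⟩, by simp [h1], by simp [h0]⟩).trans ?_
  rw [weightedLength, lintegral_speed_comp_affine (fun x => ENNReal.ofReal (ρ x)) γ
    (by norm_num) 1 measurableSet_Icc, himg, weightedLength]

theorem weightedEDist_comm (ρ : Plane → ℝ) (a b : Plane) :
    weightedEDist ρ a b = weightedEDist ρ b a :=
  le_antisymm (weightedEDist_comm_le ρ b a) (weightedEDist_comm_le ρ a b)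

theorem LipschitzOnWith.union_Icc {X : Type*} [PseudoMetricSpace X] {γ : ℝ → X} {a b c : ℝ}
    {K : ℝ≥0} (h1 : LipschitzOnWith K γ (Icc a b)) (h2 : LipschitzOnWith K γ (Icc b c)) :
    LipschitzOnWith K γ (Icc a c) := by
  have key : ∀ s ∈ Icc a c, ∀ t ∈ Icc a c, s ≤ t → dist (γ s) (γ t) ≤ K * dist s t := by
    intro s hs t ht hst
    rcases le_total t b with htb | htb
    · exact h1.dist_le_mul s ⟨hs.1, hst.trans htb⟩ t ⟨ht.1, htb⟩
    rcases le_total b s with hsb | hsb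
    · exact h2.dist_le_mul s ⟨hsb, hs.2⟩ t ⟨htb, ht.2⟩
    have e1 := h1.dist_le_mul s ⟨hs.1, hsb⟩ b ⟨hs.1.trans hsb, le_rfl⟩
    have e2 := h2.dist_le_mul b ⟨le_rfl, htb.trans ht.2⟩ t ⟨htb, ht.2⟩
    have e3 := dist_triangle (γ s) (γ b) (γ t)
    have e4 : dist s t = dist s b + dist b t := by
      rw [dist_comm s t, dist_comm s b, dist_comm b t, Real.dist_eq, Real.dist_eq, Real.dist_eq,
        abs_of_nonneg (sub_nonneg.2 hst), abs_of_nonneg (sub_nonneg.2 hsb),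
        abs_of_nonneg (sub_nonneg.2 htb)]
      ring
    rw [e4, mul_add]; linarith
  refine LipschitzOnWith.of_dist_le_mul fun s hs t ht => ?_
  rcases le_total s t with h | h
  · exact key s hs t ht h
  · rw [dist_comm, dist_comm s]; exact key t ht s hs h

theorem weightedEDist_triangle (ρ : Plane → ℝ) (a b c : Plane) :
    weightedEDist ρ a c ≤ weightedEDist ρ a b + weightedEDist ρ b c := by
  rw [weightedEDist, weightedEDist, ENNReal.iInf_add]
  refine le_iInf fun γ₁ => ?_
  rw [ENNReal.iInf_add]
  refine le_iInf fun ⟨⟨K₁, hK₁⟩, h10, h11⟩ => ?_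
  rw [weightedEDist, ENNReal.add_iInf]
  refine le_iInf fun γ₂ => ?_
  rw [ENNReal.add_iInf]
  refine le_iInf fun ⟨⟨K₂, hK₂⟩, h20, h21⟩ => ?_
  -- The concatenation lives on `[0, 2]`, so that each piece keeps its speed;
  -- `weightedEDist_le_of_curve` takes care of the reparametrization.
  set γ : ℝ → Plane := fun t => if t ≤ 1 then γ₁ t else γ₂ (1 * t + (-1)) with hγ
  have e1 : EqOn γ γ₁ (Icc 0 1) := fun t ht => by simp [hγ, ht.2]
  have e2 : EqOn γ (fun t => γ₂ (1 * t + (-1))) (Icc 1 2) := fun t ht => by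
    rcases ht.1.eq_or_lt with rfl | h
    · simp [hγ, h11, h20]
    · simp [hγ, not_le.2 h]
  have himg : (fun t : ℝ => 1 * t + (-1)) '' Icc 1 2 = Icc 0 1 := by
    rw [image_affine_Icc' one_pos]; norm_num
  have l1 : LipschitzOnWith (max K₁ K₂) γ (Icc 0 1) := by
    refine LipschitzOnWith.of_dist_le_mul fun s hs t ht => ?_
    rw [e1 hs, e1 ht]
    exact (hK₁.weaken (le_max_left _ _)).dist_le_mul s hs t ht
  have l2 : LipschitzOnWith (max K₁ K₂) γ (Icc 1 2) := by
    refine LipschitzOnWith.of_dist_le_mul fun s hs t ht => ?_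
    rw [e2 hs, e2 ht]
    refine ((hK₂.weaken (le_max_right K₁ K₂)).dist_le_mul _ ?_ _ ?_).trans ?_
    · rw [← himg]; exact mem_image_of_mem _ hs
    · rw [← himg]; exact mem_image_of_mem _ ht
    · simp
  have h := weightedEDist_le_of_curve ρ (by norm_num : (0 : ℝ) ≤ 2) (l1.union_Icc l2)
  have ha : γ 0 = a := by simp [hγ, h10]
  have hc : γ 2 = c := by simp only [hγ]; rw [if_neg (by norm_num)]; norm_num [h21]
  rw [ha, hc] at h
  refine h.trans ?_
  rw [← Icc_union_Icc_eq_Icc (by norm_num : (0:ℝ) ≤ 1) (by norm_num : (1:ℝ) ≤ 2)]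
  refine (lintegral_union_le _ _ _).trans (add_le_add ?_ ?_)
  -- Open intervals, because the derivatives of the pieces and of the concatenation may differ at
  -- the junction and at the endpoints.
  · rw [weightedLength, ← restrict_Ioo_eq_restrict_Icc]
    refine le_of_eq (setLIntegral_congr_fun measurableSet_Ioo fun t ht => ?_)
    have : γ =ᶠ[𝓝 t] γ₁ := by
      filter_upwards [Ioo_mem_nhds ht.1 ht.2] with s hs using e1 ⟨hs.1.le, hs.2.le⟩
    simp only [this.deriv_eq, this.eq_of_nhds]
  · rw [weightedLength, ← himg, ← lintegral_speed_comp_affine (fun x => ENNReal.ofReal (ρ x)) γ₂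
      (by norm_num) (-1) measurableSet_Icc, ← restrict_Ioo_eq_restrict_Icc]
    refine le_of_eq (setLIntegral_congr_fun measurableSet_Ioo fun t ht => ?_)
    have : γ =ᶠ[𝓝 t] (fun t => γ₂ (1 * t + (-1))) := by
      filter_upwards [Ioo_mem_nhds ht.1 ht.2] with s hs using e2 ⟨hs.1.le, hs.2.le⟩
    simp only [this.deriv_eq, this.eq_of_nhds]

/-- A bound of the weight on a segment bounds the distance of the endpoints. -/
theorem weightedEDist_le_of_segment {ρ : Plane → ℝ} {a b : Plane} {M : ℝ}
    (hM : ∀ x ∈ segment ℝ a b, ρ x ≤ M) :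
    weightedEDist ρ a b ≤ ENNReal.ofReal M * edist a b := by
  have hlip : LipschitzWith (nndist a b) (AffineMap.lineMap a b : ℝ → Plane) :=
    lipschitzWith_lineMap a b
  have h := weightedEDist_le_of_curve ρ (zero_le_one (α := ℝ)) (hlip.lipschitzOnWith (s := Icc 0 1))
  rw [AffineMap.lineMap_apply_zero, AffineMap.lineMap_apply_one] at h
  refine h.trans ?_
  have hd : ∀ t : ℝ, deriv (AffineMap.lineMap a b : ℝ → Plane) t = b - a := fun t =>
    (AffineMap.hasDerivAt_lineMap).deriv
  calc _ ≤ ∫⁻ _ in Icc (0 : ℝ) 1, ENNReal.ofReal M * edist a b := by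
        refine setLIntegral_mono measurable_const fun t ht => ?_
        rw [hd, edist_comm, edist_eq_enorm_sub]
        gcongr
        apply hM
        rw [segment_eq_image_lineMap]
        exact mem_image_of_mem _ ht
    _ = _ := by simp

/-- Functions with pointwise Lipschitz constant at most `ρ` are `1`-Lipschitz for `d_ρ`. -/
theorem ofReal_abs_sub_le_weightedEDist {ρ : Plane → ℝ} {M : ℝ} (hρ : ∀ x, ρ x ∈ Icc 0 M)
    {f : Plane → ℝ} (hf : ∀ x, HasSlopeLE f x (ρ x)) (a b : Plane) :
    ENNReal.ofReal |f b - f a| ≤ weightedEDist ρ a b := by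
  refine le_iInf₂ fun γ ⟨⟨K, hK⟩, h0, h1⟩ => ?_
  rw [← h0, ← h1]
  exact abs_sub_le_lintegral_curve zero_le_one hK (fun t _ => hρ _) (fun t _ => hf _)

/-! ### Admissible weights and the metric space they define -/

/-- Weights with values in `[1, 2]` that are continuous off the origin. -/
class AdmissibleWeight (ρ : Plane → ℝ) : Prop where
  mem_Icc : ∀ x, ρ x ∈ Icc (1 : ℝ) 2
  continuousOn : ContinuousOn ρ {0}ᶜ

section admissible

variable (ρ : Plane → ℝ) [hρ : AdmissibleWeight ρ]

theorem AdmissibleWeight.one_le (x : Plane) : 1 ≤ ρ x := (mem_Icc x).1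

theorem AdmissibleWeight.le_two (x : Plane) : ρ x ≤ 2 := (mem_Icc x).2

theorem AdmissibleWeight.pos (x : Plane) : 0 < ρ x := one_pos.trans_le (one_le ρ x)

theorem AdmissibleWeight.continuousAt {x : Plane} (hx : x ≠ 0) : ContinuousAt ρ x :=
  (continuousOn (ρ := ρ)).continuousAt (isOpen_compl_singleton.mem_nhds hx)

theorem AdmissibleWeight.measurable : Measurable ρ :=
  measurable_of_continuousOn_compl_singleton 0 continuousOn

theorem weightedEDist_le_two_mul (a b : Plane) : weightedEDist ρ a b ≤ 2 * edist a b := by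
  simpa using weightedEDist_le_of_segment (a := a) (b := b)
    fun x _ => AdmissibleWeight.le_two ρ x

/-- The distance from `a` is a calibration, because its slope is at most `1 ≤ ρ`. -/
theorem edist_le_weightedEDist (a b : Plane) : edist a b ≤ weightedEDist ρ a b := by
  have h := ofReal_abs_sub_le_weightedEDist (ρ := ρ) (M := 2) (f := fun x => dist x a)
    (fun x => ⟨(AdmissibleWeight.pos ρ x).le, AdmissibleWeight.le_two ρ x⟩)
    (fun x => (HasSlopeLE.of_eventually (c := 1) (Eventually.of_forall fun y => by
      rw [one_mul, dist_comm y a, dist_comm x a, dist_comm y x, abs_sub_comm]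
      have := abs_dist_sub_le x y a
      rwa [dist_comm x a, dist_comm y a] at this)).mono
      (AdmissibleWeight.one_le ρ x)) a b
  simpa [edist_dist, dist_comm] using h

/-- Near a point `x` other than the origin, `d_ρ` is close to `ρ(x)` times the Euclidean
distance. -/
theorem weightedEDist_local {x : Plane} (hx : x ≠ 0) {ε : ℝ} (hε : 0 < ε) :
    ∃ δ > 0, ∀ a ∈ ball x δ, ∀ b ∈ ball x δ,
      ENNReal.ofReal ((ρ x - ε) * dist a b) ≤ weightedEDist ρ a b ∧
      weightedEDist ρ a b ≤ ENNReal.ofReal ((ρ x + ε) * dist a b) := by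
  obtain ⟨r, hr, hball⟩ := Metric.continuousAt_iff.1 (AdmissibleWeight.continuousAt ρ hx) ε hε
  have hball' : ∀ y ∈ ball x r, ρ x - ε ≤ ρ y ∧ ρ y ≤ ρ x + ε := fun y hy => by
    have := hball hy
    rw [Real.dist_eq, abs_lt] at this
    constructor <;> linarith
  refine ⟨r / 4, by positivity, fun a ha b hb => ⟨?_, ?_⟩⟩
  · rcases le_or_gt (ρ x - ε) 0 with h0 | h0
    · rw [ENNReal.ofReal_of_nonpos (mul_nonpos_of_nonpos_of_nonneg h0 dist_nonneg)]
      exact zero_le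
    have hab : dist a b < r / 2 := by
      have := dist_triangle_right a b x
      rw [mem_ball] at ha hb
      linarith
    -- Truncating at `r / 2` makes `f` locally constant where `ρ` is not controlled: `a` is within
    -- `r / 4` of `x`, so points within `r / 2` of `a` stay in `ball x r`. The truncation is not
    -- felt at `b`.
    set f : Plane → ℝ := fun y => (ρ x - ε) * min (dist y a) (r / 2) with hf
    have h := ofReal_abs_sub_le_weightedEDist (ρ := ρ) (M := 2) (f := f)
      (fun x => ⟨(AdmissibleWeight.pos ρ x).le, AdmissibleWeight.le_two ρ x⟩)
      (fun y => by
        rcases le_or_gt (dist y a) (r / 2) with hy | hy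
        · refine (HasSlopeLE.of_eventually (c := ρ x - ε)
            (Eventually.of_forall fun z => ?_)).mono (hball' y ?_).1
          · simp only [hf]
            rw [← mul_sub, abs_mul, abs_of_pos h0]
            refine mul_le_mul_of_nonneg_left ?_ h0.le
            refine (abs_min_sub_min_le_max _ _ _ _).trans ?_
            simp only [sub_self, abs_zero]
            exact max_le (abs_dist_sub_le z y a) dist_nonneg
          · rw [mem_ball] at ha ⊢
            linarith [dist_triangle y a x]
        · refine (HasSlopeLE.of_eventually (c := 0) ?_).mono (AdmissibleWeight.pos ρ y).le
          have : ∀ᶠ z in 𝓝 y, r / 2 < dist z a :=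
            (continuous_id.dist continuous_const).continuousAt.eventually_const_lt hy
          filter_upwards [this] with z hz
          simp [hf, min_eq_right hz.le, min_eq_right hy.le]) a b
    have hfab : |f b - f a| = (ρ x - ε) * dist a b := by
      simp only [hf, dist_self]
      rw [min_eq_left (half_pos hr).le, mul_zero, sub_zero, dist_comm b a, min_eq_left hab.le,
        abs_of_nonneg (by positivity)]
    rwa [hfab] at h
  · refine (weightedEDist_le_of_segment (M := ρ x + ε) fun y hy => ?_).trans ?_
    · have h1 : y ∈ ball x (r / 4) := (convex_ball x (r / 4)).segment_subset ha hb hy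
      exact (hball' y (ball_subset_ball (by linarith) h1)).2
    · rw [edist_dist, ← ENNReal.ofReal_mul (by linarith [AdmissibleWeight.pos ρ x])]

end admissible

/-- The plane with the distance `d_ρ`. -/
def WeightedPlane (_ρ : Plane → ℝ) : Type := Plane

namespace WeightedPlane

variable (ρ : Plane → ℝ) [hρ : AdmissibleWeight ρ]

/-- The identity from the plane with the distance `d_ρ` to the Euclidean plane. -/
def toPlaneEquiv (ρ : Plane → ℝ) : WeightedPlane ρ ≃ Plane := Equiv.refl _

noncomputable instance : PseudoEMetricSpace (WeightedPlane ρ) where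
  edist a b := weightedEDist ρ (toPlaneEquiv ρ a) (toPlaneEquiv ρ b)
  edist_self a := weightedEDist_self ρ _
  edist_comm a b := weightedEDist_comm ρ _ _
  edist_triangle a b c := weightedEDist_triangle ρ _ _ _

variable {ρ}

theorem lipschitzWith_toPlaneEquiv : LipschitzWith 1 (toPlaneEquiv ρ) := fun _ _ => by
  rw [ENNReal.coe_one, one_mul]; exact edist_le_weightedEDist ρ _ _

theorem lipschitzWith_toPlaneEquiv_symm : LipschitzWith 2 (toPlaneEquiv ρ).symm := fun _ _ =>
  weightedEDist_le_two_mul ρ _ _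

variable (ρ)

noncomputable instance : EMetricSpace (WeightedPlane ρ) where
  eq_of_edist_eq_zero h := (toPlaneEquiv ρ).injective <|
    edist_eq_zero.1 (le_antisymm ((edist_le_weightedEDist ρ _ _).trans h.le) zero_le)

noncomputable instance : MetricSpace (WeightedPlane ρ) :=
  EMetricSpace.toMetricSpace fun a b => ((weightedEDist_le_two_mul ρ _ _).trans_lt
    (ENNReal.mul_lt_top (by simp) (edist_lt_top _ _))).ne

noncomputable instance : MeasurableSpace (WeightedPlane ρ) := borel _

instance : BorelSpace (WeightedPlane ρ) := ⟨rfl⟩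

/-- The identity from the plane with the distance `d_ρ` to the Euclidean plane, as a
homeomorphism. -/
noncomputable def toPlane : WeightedPlane ρ ≃ₜ Plane where
  toEquiv := toPlaneEquiv ρ
  continuous_toFun := lipschitzWith_toPlaneEquiv.continuous
  continuous_invFun := lipschitzWith_toPlaneEquiv_symm.continuous

variable {ρ}

theorem edist_eq (a b : WeightedPlane ρ) :
    edist a b = weightedEDist ρ (toPlane ρ a) (toPlane ρ b) := rfl

theorem lipschitzWith_toPlane : LipschitzWith 1 (toPlane ρ) := lipschitzWith_toPlaneEquiv

theorem lipschitzWith_toPlane_symm : LipschitzWith 2 (toPlane ρ).symm :=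
  lipschitzWith_toPlaneEquiv_symm

theorem dist_toPlane_le (a b : WeightedPlane ρ) : dist (toPlane ρ a) (toPlane ρ b) ≤ dist a b := by
  simpa using lipschitzWith_toPlane.dist_le_mul a b

theorem dist_toPlane_symm_le (a b : Plane) :
    dist ((toPlane ρ).symm a) ((toPlane ρ).symm b) ≤ 2 * dist a b :=
  (lipschitzWith_toPlane_symm (ρ := ρ)).dist_le_mul a b

theorem dist_le_two_mul (a b : WeightedPlane ρ) :
    dist a b ≤ 2 * dist (toPlane ρ a) (toPlane ρ b) :=
  dist_toPlane_symm_le (toPlane ρ a) (toPlane ρ b)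

theorem ofReal_dist_toPlane_symm (a b : Plane) :
    ENNReal.ofReal (dist ((toPlane ρ).symm a) ((toPlane ρ).symm b)) = weightedEDist ρ a b := by
  rw [← edist_dist]; rfl

instance : ProperSpace (WeightedPlane ρ) :=
  (lipschitzWith_toPlane.to_rightInverse (toPlane ρ).right_inv).properSpace
    (toPlane ρ).symm.continuous (toPlane ρ).symm.surjective

end WeightedPlane

/-! ### The Hausdorff measure of the length distance -/

theorem LipschitzOnWith.euclideanHausdorffMeasure_image_le {X Y : Type*} [EMetricSpace X]
    [MeasurableSpace X] [BorelSpace X] [EMetricSpace Y] [MeasurableSpace Y] [BorelSpace Y]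
    {K : ℝ≥0} {f : X → Y} {s : Set X} (h : LipschitzOnWith K f s) (d : ℕ) :
    (μHE[d] : Measure Y) (f '' s) ≤ (K : ℝ≥0∞) ^ d * (μHE[d] : Measure X) s := by
  rw [Measure.euclideanHausdorffMeasure_def, Measure.euclideanHausdorffMeasure_def,
    Measure.smul_apply, Measure.smul_apply, ENNReal.smul_def, ENNReal.smul_def, smul_eq_mul,
    smul_eq_mul, mul_left_comm]
  have := h.hausdorffMeasure_image_le (d := d) (Nat.cast_nonneg d)
  rw [ENNReal.rpow_natCast] at this
  gcongr

/-- Local comparison of measures implies global comparison. -/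
theorem measure_le_of_locally_le {Y : Type*} [TopologicalSpace Y] [SecondCountableTopology Y]
    [MeasurableSpace Y] [BorelSpace Y] {μ ν : Measure Y} {s : Set Y}
    (h : ∀ x ∈ s, ∃ t ∈ 𝓝 x, ∀ A ⊆ t, MeasurableSet A → μ A ≤ ν A) {A : Set Y} (hAs : A ⊆ s)
    (hA : MeasurableSet A) : μ A ≤ ν A := by
  choose! t ht hle using h
  obtain ⟨c, hcs, hc, hcover⟩ := TopologicalSpace.countable_cover_nhdsWithin (s := s)
    (f := fun x => interior (t x))
    (fun x hx => mem_nhdsWithin_of_mem_nhds (interior_mem_nhds.2 (ht x hx)))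
  rcases A.eq_empty_or_nonempty with rfl | hne
  · simp
  have hcne : c.Nonempty := by
    obtain ⟨x, hx⟩ := hne
    obtain ⟨y, hy, -⟩ := mem_iUnion₂.1 (hcover (hAs hx))
    exact ⟨y, hy⟩
  obtain ⟨u, rfl⟩ := hc.exists_eq_range hcne
  set D := disjointed fun n => interior (t (u n)) with hD
  have hDm : ∀ n, MeasurableSet (D n) :=
    MeasurableSet.disjointed fun n => isOpen_interior.measurableSet
  have hAU : A = ⋃ n, A ∩ D n := by
    rw [← inter_iUnion, hD, iUnion_disjointed, eq_comm, inter_eq_left]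
    refine (hAs.trans hcover).trans ?_
    rw [biUnion_range]
  have hdisj : Pairwise (Function.onFun Disjoint fun n => A ∩ D n) := fun i j hij =>
    ((disjoint_disjointed _) hij).mono inter_subset_right inter_subset_right
  rw [hAU, measure_iUnion hdisj fun n => hA.inter (hDm n),
    measure_iUnion hdisj fun n => hA.inter (hDm n)]
  refine ENNReal.tsum_le_tsum fun n => hle (u n) (hcs (mem_range_self n)) _ ?_ (hA.inter (hDm n))
  exact inter_subset_right.trans ((disjointed_subset _ n).trans interior_subset)

namespace WeightedPlane

variable (ρ : Plane → ℝ) [hρ : AdmissibleWeight ρ]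

/-- The measure with density `ρ²`. -/
noncomputable def density (ρ : Plane → ℝ) : Measure Plane :=
  (volume : Measure Plane).withDensity fun x => ENNReal.ofReal (ρ x ^ 2)

variable {ρ}

/-- Near `x` the identity has biLipschitz constants `ρ(x) ± ε`, and `ρ` itself lies between these
values. The two measures therefore differ at most by the factor `((ρ(x) + ε) / (ρ(x) - ε))²`, which
is below `c` for small `ε`. -/
theorem exists_nhds_measure_le {x : Plane} (hx : x ≠ 0) {c : ℝ} (hc : 1 < c) :
    ∃ t ∈ 𝓝 x, ∀ A ⊆ t, MeasurableSet A →
      (μHE[2] : Measure (WeightedPlane ρ)).map (toPlane ρ) A ≤ ENNReal.ofReal c * density ρ A ∧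
      density ρ A ≤ ENNReal.ofReal c * (μHE[2] : Measure (WeightedPlane ρ)).map (toPlane ρ) A := by
  have h1 := AdmissibleWeight.one_le ρ x
  obtain ⟨ε, hε, hερ, hεc⟩ : ∃ ε > 0, ε < ρ x ∧ (ρ x + ε) ^ 2 ≤ c * (ρ x - ε) ^ 2 := by
    have hcont : Continuous fun ε : ℝ => c * (ρ x - ε) ^ 2 - (ρ x + ε) ^ 2 := by fun_prop
    have h0 : ∀ᶠ ε in 𝓝 (0 : ℝ), 0 < c * (ρ x - ε) ^ 2 - (ρ x + ε) ^ 2 := by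
      refine hcont.continuousAt.eventually_const_lt ?_
      have : 0 < ρ x ^ 2 := by positivity
      simp only [sub_zero, add_zero]
      nlinarith
    have h2 : ∀ᶠ ε in 𝓝[>] (0 : ℝ), 0 < ε ∧ ε < ρ x ∧
        0 < c * (ρ x - ε) ^ 2 - (ρ x + ε) ^ 2 := by
      filter_upwards [mem_nhdsWithin_of_mem_nhds h0, self_mem_nhdsWithin,
        mem_nhdsWithin_of_mem_nhds (Iio_mem_nhds (by linarith : (0:ℝ) < ρ x))] with ε a b d
      exact ⟨b, d, a⟩
    obtain ⟨ε, a, b, d⟩ := h2.exists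
    exact ⟨ε, a, b, by linarith⟩
  have hm : 0 < ρ x - ε := sub_pos.2 hερ
  obtain ⟨δ, hδ, hloc⟩ := weightedEDist_local ρ hx hε
  obtain ⟨r, hr, hball⟩ := Metric.continuousAt_iff.1 (AdmissibleWeight.continuousAt ρ hx) ε hε
  refine ⟨ball x (min δ r), ball_mem_nhds _ (lt_min hδ hr), fun A hA hAm => ?_⟩
  have hAδ : ∀ a ∈ A, a ∈ ball x δ := fun a ha => ball_subset_ball (min_le_left _ _) (hA ha)
  have hAr : ∀ a ∈ A, ρ x - ε ≤ ρ a ∧ ρ a ≤ ρ x + ε := fun a ha => by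
    have := hball (ball_subset_ball (min_le_right _ _) (hA ha))
    rw [Real.dist_eq, abs_lt] at this
    constructor <;> linarith
  have hmap : (μHE[2] : Measure (WeightedPlane ρ)).map (toPlane ρ) A =
      μHE[2] ((toPlane ρ).symm '' A) := by
    rw [Measure.map_apply (toPlane ρ).measurable hAm, (toPlane ρ).image_symm]
  have hl1 : LipschitzOnWith (ρ x + ε).toNNReal (toPlane ρ).symm A := by
    intro a ha b hb
    have := (hloc a (hAδ a ha) b (hAδ b hb)).2
    rwa [ENNReal.ofReal_mul (by positivity), ← edist_dist] at this
  have hl2 : LipschitzOnWith (ρ x - ε)⁻¹.toNNReal (toPlane ρ) ((toPlane ρ).symm '' A) := by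
    rintro _ ⟨a, ha, rfl⟩ _ ⟨b, hb, rfl⟩
    have := (hloc a (hAδ a ha) b (hAδ b hb)).1
    rw [ENNReal.ofReal_mul hm.le, ← edist_dist] at this
    change edist a b ≤ ENNReal.ofReal (ρ x - ε)⁻¹ * weightedEDist ρ a b
    rw [ENNReal.ofReal_inv_of_pos hm]
    rwa [mul_comm, ← ENNReal.div_eq_inv_mul.trans (mul_comm _ _),
      ENNReal.le_div_iff_mul_le (by left; simpa using hερ) (by simp), mul_comm]
  have hup : μHE[2] ((toPlane ρ).symm '' A) ≤ ENNReal.ofReal ((ρ x + ε) ^ 2) * volume A := by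
    have := hl1.euclideanHausdorffMeasure_image_le 2
    rwa [EuclideanSpace.euclideanHausdorffMeasure_eq_volume,
      show (((ρ x + ε).toNNReal : ℝ≥0) : ℝ≥0∞) = ENNReal.ofReal (ρ x + ε) from rfl,
      ← ENNReal.ofReal_pow (by positivity)] at this
  have hlow : ENNReal.ofReal ((ρ x - ε) ^ 2) * volume A ≤ μHE[2] ((toPlane ρ).symm '' A) := by
    have := hl2.euclideanHausdorffMeasure_image_le 2
    rw [EuclideanSpace.euclideanHausdorffMeasure_eq_volume, image_image,
      show (((ρ x - ε)⁻¹.toNNReal : ℝ≥0) : ℝ≥0∞) = ENNReal.ofReal (ρ x - ε)⁻¹ from rfl,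
      ← ENNReal.ofReal_pow (by positivity), inv_pow] at this
    simp only [Homeomorph.apply_symm_apply, image_id'] at this
    rwa [ENNReal.ofReal_inv_of_pos (by positivity), mul_comm, ← ENNReal.div_eq_inv_mul.trans
      (mul_comm _ _), ENNReal.le_div_iff_mul_le (by left; simp; positivity) (by simp),
      mul_comm] at this
  have hd : density ρ A = ∫⁻ y in A, ENNReal.ofReal (ρ y ^ 2) := withDensity_apply _ hAm
  have hdup : density ρ A ≤ ENNReal.ofReal ((ρ x + ε) ^ 2) * volume A := by
    rw [hd, ← setLIntegral_const]
    refine setLIntegral_mono measurable_const fun y hy => ENNReal.ofReal_le_ofReal ?_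
    exact pow_le_pow_left₀ (AdmissibleWeight.pos ρ y).le (hAr y hy).2 2
  have hdlow : ENNReal.ofReal ((ρ x - ε) ^ 2) * volume A ≤ density ρ A := by
    rw [hd, ← setLIntegral_const]
    refine setLIntegral_mono' hAm fun y hy => ENNReal.ofReal_le_ofReal ?_
    exact pow_le_pow_left₀ hm.le (hAr y hy).1 2
  have hcc : ENNReal.ofReal ((ρ x + ε) ^ 2) * volume A ≤
      ENNReal.ofReal c * (ENNReal.ofReal ((ρ x - ε) ^ 2) * volume A) := by
    rw [← mul_assoc, ← ENNReal.ofReal_mul (by linarith)]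
    gcongr
  rw [hmap]
  exact ⟨hup.trans (hcc.trans (by gcongr)), hdup.trans (hcc.trans (by gcongr))⟩

theorem measure_singleton_eq_zero (x : WeightedPlane ρ) :
    (μHE[2] : Measure (WeightedPlane ρ)) {x} = 0 := by
  have := Measure.nullSingletonClass_hausdorff (WeightedPlane ρ) (d := (2 : ℕ)) (by norm_num)
  rw [Measure.euclideanHausdorffMeasure_def, Measure.smul_apply, measure_singleton, smul_zero]

/-- The two-dimensional Hausdorff measure of `d_ρ` has density `ρ²`. -/
theorem map_euclideanHausdorffMeasure :
    (μHE[2] : Measure (WeightedPlane ρ)).map (toPlane ρ) = density ρ := by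
  have h0 : (μHE[2] : Measure (WeightedPlane ρ)).map (toPlane ρ) {0} = 0 := by
    rw [Measure.map_apply (toPlane ρ).measurable (measurableSet_singleton 0),
      ← (toPlane ρ).image_symm, image_singleton, measure_singleton_eq_zero]
  have h0' : density ρ {0} = 0 := by
    rw [density, withDensity_apply _ (measurableSet_singleton 0)]; simp
  -- The origin is null for both measures, so local comparison with every factor `c > 1` off the
  -- origin suffices; then `c → 1`.
  have key : ∀ {μ ν : Measure Plane}, μ {0} = 0 →
      (∀ c : ℝ, 1 < c → ∀ x : Plane, x ≠ 0 →
        ∃ t ∈ 𝓝 x, ∀ A ⊆ t, MeasurableSet A → μ A ≤ (ENNReal.ofReal c • ν) A) → μ ≤ ν := by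
    intro μ ν hμ h
    refine Measure.le_intro fun A hA _ => ?_
    have e : μ A = μ (A \ {0}) := (measure_sdiff_null hμ).symm
    rw [e]
    refine le_trans ?_ (measure_mono (sdiff_subset : A \ {0} ⊆ A))
    have h1 : ∀ c : ℝ, 1 < c → μ (A \ {0}) ≤ ENNReal.ofReal c * ν (A \ {0}) := fun c hc =>
      measure_le_of_locally_le (s := {0}ᶜ) (fun x hx => h c hc x hx) (fun x hx => hx.2)
        (hA.diff (measurableSet_singleton 0))
    rcases eq_or_ne (ν (A \ {0})) ⊤ with htop | htop
    · rw [htop]; exact le_top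
    have hlim : Tendsto (fun c : ℝ => ENNReal.ofReal c * ν (A \ {0})) (𝓝[>] 1)
        (𝓝 (ENNReal.ofReal 1 * ν (A \ {0}))) :=
      ENNReal.Tendsto.mul_const
        ((ENNReal.continuous_ofReal.tendsto 1).mono_left nhdsWithin_le_nhds) (Or.inr htop)
    rw [ENNReal.ofReal_one, one_mul] at hlim
    exact ge_of_tendsto hlim (by filter_upwards [self_mem_nhdsWithin] with c hc using h1 c hc)
  refine le_antisymm (key h0 fun c hc x hx => ?_) (key h0' fun c hc x hx => ?_)
  · obtain ⟨t, ht, h⟩ := exists_nhds_measure_le (ρ := ρ) hx hc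
    exact ⟨t, ht, fun A hA hAm => (h A hA hAm).1⟩
  · obtain ⟨t, ht, h⟩ := exists_nhds_measure_le (ρ := ρ) hx hc
    exact ⟨t, ht, fun A hA hAm => (h A hA hAm).2⟩

theorem measurePreserving_toPlane :
    MeasurePreserving (toPlane ρ) (μHE[2] : Measure (WeightedPlane ρ)) (density ρ) :=
  ⟨(toPlane ρ).measurable, map_euclideanHausdorffMeasure⟩

theorem measurePreserving_toPlane_symm :
    MeasurePreserving (toPlane ρ).symm (density ρ) (μHE[2] : Measure (WeightedPlane ρ)) :=
  measurePreserving_toPlane.symm (toPlane ρ).toMeasurableEquiv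

variable (ρ)

theorem volume_le_density : (volume : Measure Plane) ≤ density ρ := by
  refine Measure.le_intro fun A hA _ => ?_
  rw [density, withDensity_apply _ hA, ← setLIntegral_one]
  refine setLIntegral_mono' hA fun x _ => ?_
  rw [← ENNReal.ofReal_one]
  exact ENNReal.ofReal_le_ofReal (one_le_pow₀ (AdmissibleWeight.one_le ρ x))

theorem density_le : density ρ ≤ (4 : ℝ≥0∞) • (volume : Measure Plane) := by
  refine Measure.le_intro fun A hA _ => ?_
  rw [density, withDensity_apply _ hA, Measure.smul_apply, smul_eq_mul, ← setLIntegral_const]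
  refine setLIntegral_mono measurable_const fun x _ => ?_
  rw [← ENNReal.ofReal_ofNat]
  exact ENNReal.ofReal_le_ofReal (by
    nlinarith [AdmissibleWeight.one_le ρ x, AdmissibleWeight.le_two ρ x])

end WeightedPlane

/-! ### From the parallelogram law to infinitesimal Hilbertianity -/

/-- Half of the Jordan–von Neumann theorem: the polarization of a function satisfying the
parallelogram law is additive. -/
theorem polarization_add {V : Type*} [AddCommGroup V] {Q : V → ℝ}
    (hpar : ∀ x y, Q (x + y) + Q (x - y) = 2 * Q x + 2 * Q y) (hneg : ∀ x, Q (-x) = Q x)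
    (x y z : V) :
    (Q (x + y + z) - Q (x + y - z)) / 4 = (Q (x + z) - Q (x - z)) / 4 + (Q (y + z) - Q (y - z)) / 4 := by
  -- In `e1 + e2 - e3 - e4` the unwanted terms cancel because `Q` is even.
  have e1 := hpar (x + z) y
  have e2 := hpar (y + z) x
  have e3 := hpar (x - z) y
  have e4 := hpar (y - z) x
  have r1 : x + z + y = x + y + z := by abel
  have r2 : y + z + x = x + y + z := by abel
  have r3 : x - z + y = x + y - z := by abel
  have r4 : y - z + x = x + y - z := by abel
  have r5 : x + z - y = -(y - z - x) := by abel
  have r6 : y + z - x = -(x - z - y) := by abel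
  rw [r1, r5, hneg] at e1
  rw [r2, r6, hneg] at e2
  rw [r3] at e3
  rw [r4] at e4
  linarith

/-- Half of the Jordan–von Neumann theorem: the polarization of a nonnegative `2`-homogeneous
function satisfying the parallelogram law is homogeneous. -/
theorem polarization_smul {V : Type*} [AddCommGroup V] [Module ℝ V] {Q : V → ℝ}
    (hpar : ∀ x y, Q (x + y) + Q (x - y) = 2 * Q x + 2 * Q y)
    (hsmul : ∀ (c : ℝ) x, Q (c • x) = c ^ 2 * Q x) (hnonneg : ∀ x, 0 ≤ Q x) (c : ℝ) (x y : V) :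
    (Q (c • x + y) - Q (c • x - y)) / 4 = c * ((Q (x + y) - Q (x - y)) / 4) := by
  have hneg : ∀ x, Q (-x) = Q x := fun x => by simpa using hsmul (-1) x
  let φ : ℝ →+ ℝ :=
    { toFun := fun t => (Q (t • x + y) - Q (t • x - y)) / 4
      map_zero' := by simp [hneg]
      map_add' := fun s t => by
        have := polarization_add hpar hneg (s • x) (t • x) y
        rwa [← add_smul] at this }
  -- An additive function of a real variable that is bounded near `0` is continuous, hence linear.
  -- The bound for `|t| ≤ 1` follows from `Q ≥ 0` and the parallelogram law.
  have hφ : Continuous φ := by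
    refine AddMonoidHom.continuous_of_isBounded_nhds_zero φ (Icc_mem_nhds (a := -1) (b := 1)
      (by norm_num) (by norm_num)) ?_
    refine (isBounded_closedBall (x := (0 : ℝ)) (r := Q x + Q y)).subset ?_
    rintro _ ⟨t, ht, rfl⟩
    have h1 := hpar (t • x) y
    rw [hsmul] at h1
    have h2 := hnonneg (t • x + y)
    have h3 := hnonneg (t • x - y)
    have h4 : t ^ 2 * Q x ≤ Q x :=
      mul_le_of_le_one_left (hnonneg x) (by nlinarith [ht.1, ht.2])
    have h5 := hnonneg y
    have h6 := hnonneg x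
    rw [mem_closedBall, dist_zero_right, Real.norm_eq_abs]
    change |(Q (t • x + y) - Q (t • x - y)) / 4| ≤ _
    rw [abs_le]
    constructor <;> linarith
  have := map_real_smul φ hφ c 1
  rw [smul_eq_mul, mul_one, smul_eq_mul] at this
  simpa [φ] using this

theorem sobolevNorm_sq {X : Type*} [MetricSpace X] [MeasurableSpace X]
    {m : Measure X} (f : Lp ℝ 2 m) :
    sobolevNorm m f ^ 2 = ‖f‖ ^ 2 + (relaxedEnergy m f).toReal := by
  have hint : ∫ x, |f x| ^ 2 ∂m = ‖f‖ ^ 2 := by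
    rw [← real_inner_self_eq_norm_sq, L2.inner_def]
    simp
  rw [sobolevNorm, Real.sq_sqrt, hint]
  rw [hint]; positivity

section relaxation

variable {X : Type*} [MetricSpace X]

theorem IsBddSuppLipschitz.continuous {u : X → ℝ} (hu : IsBddSuppLipschitz u) : Continuous u :=
  hu.1.choose_spec.continuous

theorem IsBddSuppLipschitz.add {u v : X → ℝ} (hu : IsBddSuppLipschitz u)
    (hv : IsBddSuppLipschitz v) : IsBddSuppLipschitz (fun x => u x + v x) := by
  obtain ⟨⟨K, hK⟩, hu⟩ := hu
  obtain ⟨⟨L, hL⟩, hv⟩ := hv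
  exact ⟨⟨K + L, hK.add hL⟩, (hu.union hv).subset (Function.support_add u v)⟩

theorem IsBddSuppLipschitz.const_mul {u : X → ℝ} (hu : IsBddSuppLipschitz u) (c : ℝ) :
    IsBddSuppLipschitz (fun x => c * u x) := by
  obtain ⟨⟨K, hK⟩, hu⟩ := hu
  refine ⟨⟨‖c‖₊ * K, (LipschitzWith.of_dist_le_mul fun x y => ?_)⟩,
    hu.subset (Function.support_mul_subset_right (fun _ => c) u)⟩
  rw [dist_eq_norm, ← mul_sub, norm_mul, NNReal.coe_mul, coe_nnnorm, mul_assoc, ← dist_eq_norm]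
  exact mul_le_mul_of_nonneg_left (hK.dist_le_mul x y) (norm_nonneg _)

theorem IsBddSuppLipschitz.sub {u v : X → ℝ} (hu : IsBddSuppLipschitz u)
    (hv : IsBddSuppLipschitz v) : IsBddSuppLipschitz (fun x => u x - v x) := by
  convert! hu.add (hv.const_mul (-1)) using 2
  ring

theorem lipSlope_const_mul (c : ℝ) (u : X → ℝ) (x : X) :
    lipSlope (fun y => c * u y) x = ‖c‖ₑ * lipSlope u x := by
  rw [lipSlope, lipSlope, ← ENNReal.limsup_const_mul_of_ne_top enorm_ne_top]
  congr 1
  ext y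
  rw [edist_eq_enorm_sub, ← mul_sub, enorm_mul, ← edist_eq_enorm_sub, mul_div_assoc]

variable [MeasurableSpace X]

/-- The energy `∫ lip(u)² dm`. -/
noncomputable def slopeEnergy (m : Measure X) (u : X → ℝ) : ℝ≥0∞ := ∫⁻ x, lipSlope u x ^ 2 ∂m

theorem slopeEnergy_const_mul (m : Measure X) (c : ℝ) (u : X → ℝ) :
    slopeEnergy m (fun x => c * u x) = ENNReal.ofReal (c ^ 2) * slopeEnergy m u := by
  have h : ∀ x, lipSlope (fun y => c * u y) x ^ 2 = ENNReal.ofReal (c ^ 2) * lipSlope u x ^ 2 := by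
    intro x
    rw [lipSlope_const_mul, mul_pow, Real.enorm_eq_ofReal_abs, ← ENNReal.ofReal_pow (abs_nonneg c),
      sq_abs]
  rw [slopeEnergy, lintegral_congr h, lintegral_const_mul' _ _ ENNReal.ofReal_ne_top, slopeEnergy]

variable {m : Measure X}

theorem relaxedEnergy_le {f : Lp ℝ 2 m} {u : ℕ → X → ℝ} (hu : IsLipApprox m u f) :
    relaxedEnergy m f ≤ liminf (fun n => slopeEnergy m (u n)) atTop :=
  iInf₂_le u hu

/-- The infimum is realized by a diagonal sequence: for each `n`, one term is taken from an almost
optimal sequence, where low energy holds frequently and closeness in `L²` holds eventually. -/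
theorem exists_isLipApprox_of_relaxedEnergy_lt_top {f : Lp ℝ 2 m} (hf : relaxedEnergy m f < ⊤) :
    ∃ u, IsLipApprox m u f ∧
      ∀ n : ℕ, slopeEnergy m (u n) ≤ relaxedEnergy m f + ((n : ℝ≥0∞) + 1)⁻¹ := by
  have key : ∀ n : ℕ, ∃ u : X → ℝ, IsBddSuppLipschitz u ∧
      eLpNorm (fun x => u x - f x) 2 m ≤ ((n : ℝ≥0∞) + 1)⁻¹ ∧
      slopeEnergy m u ≤ relaxedEnergy m f + ((n : ℝ≥0∞) + 1)⁻¹ := by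
    intro n
    have hpos : (0 : ℝ≥0∞) < ((n : ℝ≥0∞) + 1)⁻¹ := by simp
    have hlt : relaxedEnergy m f < relaxedEnergy m f + ((n : ℝ≥0∞) + 1)⁻¹ :=
      ENNReal.lt_add_right hf.ne hpos.ne'
    obtain ⟨u, hu⟩ := iInf_lt_iff.1 hlt
    obtain ⟨hu, hlim⟩ := iInf_lt_iff.1 hu
    have h1 := frequently_lt_of_liminf_lt (by isBoundedDefault) hlim
    have h2 := hu.2.eventually (gt_mem_nhds hpos)
    obtain ⟨k, hk1, hk2⟩ := (h1.and_eventually h2).exists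
    exact ⟨u k, hu.1 k, hk2.le, hk1.le⟩
  choose u hu1 hu2 hu3 using key
  refine ⟨u, ⟨hu1, ?_⟩, hu3⟩
  refine tendsto_of_tendsto_of_tendsto_of_le_of_le tendsto_const_nhds ?_ (fun _ => zero_le) hu2
  have := ENNReal.tendsto_inv_nat_nhds_zero.comp (tendsto_add_atTop_nat 1)
  simpa [Function.comp_def] using this

theorem mem_sobolevSpace_iff {f : Lp ℝ 2 m} : f ∈ sobolevSpace m ↔ relaxedEnergy m f < ⊤ := by
  constructor
  · rintro ⟨u, hu, C, hC⟩
    refine (relaxedEnergy_le hu).trans_lt (lt_of_le_of_lt ?_ (ENNReal.coe_lt_top (r := C)))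
    refine liminf_le_of_frequently_le' (Frequently.of_forall fun n => hC n)
  · intro h
    obtain ⟨u, hu, hle⟩ := exists_isLipApprox_of_relaxedEnergy_lt_top h
    refine ⟨u, hu, (relaxedEnergy m f).toNNReal + 1, fun n => (hle n).trans ?_⟩
    rw [ENNReal.coe_add, ENNReal.coe_toNNReal h.ne, ENNReal.coe_one]
    gcongr
    simp

theorem IsLipApprox.const_smul {f : Lp ℝ 2 m} {u : ℕ → X → ℝ} (hu : IsLipApprox m u f) (c : ℝ) :
    IsLipApprox m (fun n x => c * u n x) (c • f) := by
  refine ⟨fun n => (hu.1 n).const_mul c, ?_⟩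
  have h := ENNReal.Tendsto.const_mul (a := ‖c‖ₑ) hu.2 (Or.inr enorm_ne_top)
  rw [mul_zero] at h
  refine h.congr fun n => ?_
  rw [← eLpNorm_const_smul]
  refine eLpNorm_congr_ae ?_
  filter_upwards [Lp.coeFn_smul c f] with x hx
  rw [hx, Pi.smul_apply, Pi.smul_apply, smul_eq_mul, smul_eq_mul, mul_sub]

theorem relaxedEnergy_smul_le {f : Lp ℝ 2 m} (hf : relaxedEnergy m f < ⊤) (c : ℝ) :
    relaxedEnergy m (c • f) ≤ ENNReal.ofReal (c ^ 2) * relaxedEnergy m f := by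
  obtain ⟨u, hu, hle⟩ := exists_isLipApprox_of_relaxedEnergy_lt_top hf
  refine (relaxedEnergy_le (hu.const_smul c)).trans ?_
  have hlim : Tendsto (fun n : ℕ => ENNReal.ofReal (c ^ 2) *
      (relaxedEnergy m f + ((n : ℝ≥0∞) + 1)⁻¹)) atTop
      (𝓝 (ENNReal.ofReal (c ^ 2) * (relaxedEnergy m f + 0))) := by
    refine ENNReal.Tendsto.const_mul (tendsto_const_nhds.add ?_) (Or.inr ENNReal.ofReal_ne_top)
    have := ENNReal.tendsto_inv_nat_nhds_zero.comp (tendsto_add_atTop_nat 1)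
    simpa [Function.comp_def] using this
  rw [add_zero] at hlim
  rw [← hlim.liminf_eq]
  refine liminf_le_liminf (Eventually.of_forall fun n => ?_)
  rw [slopeEnergy_const_mul]
  gcongr
  exact hle n

theorem relaxedEnergy_smul {f : Lp ℝ 2 m} (hf : relaxedEnergy m f < ⊤) (c : ℝ) :
    relaxedEnergy m (c • f) = ENNReal.ofReal (c ^ 2) * relaxedEnergy m f := by
  refine le_antisymm (relaxedEnergy_smul_le hf c) ?_
  rcases eq_or_ne c 0 with rfl | hc
  · simp
  have h1 : relaxedEnergy m (c • f) < ⊤ := (relaxedEnergy_smul_le hf c).trans_lt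
    (ENNReal.mul_lt_top ENNReal.ofReal_lt_top hf)
  have h2 := relaxedEnergy_smul_le h1 c⁻¹
  rw [smul_smul, inv_mul_cancel₀ hc, one_smul] at h2
  calc _ ≤ ENNReal.ofReal (c ^ 2) * (ENNReal.ofReal (c⁻¹ ^ 2) * relaxedEnergy m (c • f)) := by
        gcongr
    _ = relaxedEnergy m (c • f) := by
        rw [← mul_assoc, ← ENNReal.ofReal_mul (sq_nonneg c), ← mul_pow, mul_inv_cancel₀ hc]
        simp

variable [BorelSpace X]

theorem IsLipApprox.add {f g : Lp ℝ 2 m} {u v : ℕ → X → ℝ} (hu : IsLipApprox m u f)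
    (hv : IsLipApprox m v g) : IsLipApprox m (fun n x => u n x + v n x) (f + g) := by
  refine ⟨fun n => (hu.1 n).add (hv.1 n), ?_⟩
  have h := hu.2.add hv.2
  rw [add_zero] at h
  refine tendsto_of_tendsto_of_tendsto_of_le_of_le tendsto_const_nhds h (fun _ => zero_le)
    fun n => ?_
  have hle : eLpNorm (fun x => (u n x - f x) + (v n x - g x)) 2 m ≤ _ := eLpNorm_add_le
    ((hu.1 n).continuous.aestronglyMeasurable.sub (Lp.aestronglyMeasurable f))
    ((hv.1 n).continuous.aestronglyMeasurable.sub (Lp.aestronglyMeasurable g)) (by norm_num)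
  refine le_trans (le_of_eq (eLpNorm_congr_ae ?_)) hle
  filter_upwards [Lp.coeFn_add f g] with x hx
  rw [hx, Pi.add_apply]; ring

theorem IsLipApprox.sub {f g : Lp ℝ 2 m} {u v : ℕ → X → ℝ} (hu : IsLipApprox m u f)
    (hv : IsLipApprox m v g) : IsLipApprox m (fun n x => u n x - v n x) (f - g) := by
  convert! hu.add (hv.const_smul (-1)) using 1
  · ext n x; ring
  · module

theorem liminf_add_liminf_le {a b : ℕ → ℝ≥0∞} :
    liminf a atTop + liminf b atTop ≤ liminf (fun n => a n + b n) atTop := by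
  simp only [liminf_eq_iSup_iInf_of_nat]
  rw [ENNReal.iSup_add_iSup_of_monotone]
  · exact iSup_mono fun n => le_iInf₂ fun k hk => add_le_add (iInf₂_le k hk) (iInf₂_le k hk)
  · exact fun p q hpq => le_iInf₂ fun k hk => iInf₂_le k (hpq.trans hk)
  · exact fun p q hpq => le_iInf₂ fun k hk => iInf₂_le k (hpq.trans hk)

/-- Sums and differences of optimal sequences for `f` and `g` are competitors for `f + g` and `f -
g`, and the lower limit is superadditive. -/
theorem relaxedEnergy_add_sub_le
    (hpar : ∀ u v : X → ℝ, IsBddSuppLipschitz u → IsBddSuppLipschitz v →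
      slopeEnergy m (fun x => u x + v x) + slopeEnergy m (fun x => u x - v x) ≤
        2 * slopeEnergy m u + 2 * slopeEnergy m v)
    {f g : Lp ℝ 2 m} (hf : relaxedEnergy m f < ⊤) (hg : relaxedEnergy m g < ⊤) :
    relaxedEnergy m (f + g) + relaxedEnergy m (f - g) ≤
      2 * relaxedEnergy m f + 2 * relaxedEnergy m g := by
  obtain ⟨u, hu, hule⟩ := exists_isLipApprox_of_relaxedEnergy_lt_top hf
  obtain ⟨v, hv, hvle⟩ := exists_isLipApprox_of_relaxedEnergy_lt_top hg
  have hlim0 : Tendsto (fun n : ℕ => ((n : ℝ≥0∞) + 1)⁻¹) atTop (𝓝 0) := by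
    have := ENNReal.tendsto_inv_nat_nhds_zero.comp (tendsto_add_atTop_nat 1)
    simpa [Function.comp_def] using this
  have hlim : ∀ F : ℝ≥0∞, Tendsto (fun n : ℕ => 2 * (F + ((n : ℝ≥0∞) + 1)⁻¹)) atTop
      (𝓝 (2 * (F + 0))) := fun F =>
    ENNReal.Tendsto.const_mul (tendsto_const_nhds.add hlim0) (Or.inr (by simp))
  have hlim2 := (hlim (relaxedEnergy m f)).add (hlim (relaxedEnergy m g))
  rw [add_zero, add_zero] at hlim2
  rw [← hlim2.liminf_eq]
  calc _ ≤ liminf (fun n => slopeEnergy m fun x => u n x + v n x) atTop +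
        liminf (fun n => slopeEnergy m fun x => u n x - v n x) atTop :=
        add_le_add (relaxedEnergy_le (hu.add hv)) (relaxedEnergy_le (hu.sub hv))
    _ ≤ _ := liminf_add_liminf_le
    _ ≤ _ := liminf_le_liminf (Eventually.of_forall fun n =>
        (hpar _ _ (hu.1 n) (hv.1 n)).trans (add_le_add (mul_le_mul' le_rfl (hule n))
          (mul_le_mul' le_rfl (hvle n))))

/-- If the energy of boundedly supported Lipschitz functions satisfies the parallelogram
inequality, then the space is infinitesimally Hilbertian. -/
theorem infinitesimallyHilbertian_of_parallelogram
    (hpar : ∀ u v : X → ℝ, IsBddSuppLipschitz u → IsBddSuppLipschitz v →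
      slopeEnergy m (fun x => u x + v x) + slopeEnergy m (fun x => u x - v x) ≤
        2 * slopeEnergy m u + 2 * slopeEnergy m v) : InfinitesimallyHilbertian m := by
  have hadd : ∀ {f g : Lp ℝ 2 m}, f ∈ sobolevSpace m → g ∈ sobolevSpace m →
      f + g ∈ sobolevSpace m ∧ f - g ∈ sobolevSpace m := by
    intro f g hf hg
    rw [mem_sobolevSpace_iff] at *
    have := (relaxedEnergy_add_sub_le hpar hf hg).trans_lt (b := 2 * relaxedEnergy m f +
      2 * relaxedEnergy m g) (c := ⊤) (by
        exact ENNReal.add_lt_top.2 ⟨ENNReal.mul_lt_top (by simp) hf, ENNReal.mul_lt_top (by simp) hg⟩)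
    rw [mem_sobolevSpace_iff]
    exact ENNReal.add_lt_top.1 this
  have hsm : ∀ (c : ℝ) {f : Lp ℝ 2 m}, f ∈ sobolevSpace m → c • f ∈ sobolevSpace m := by
    intro c f hf
    rw [mem_sobolevSpace_iff] at *
    rw [relaxedEnergy_smul hf]
    exact ENNReal.mul_lt_top ENNReal.ofReal_lt_top hf
  have hzero : (0 : Lp ℝ 2 m) ∈ sobolevSpace m := by
    refine ⟨fun _ _ => 0, ⟨fun _ => ⟨⟨0, LipschitzWith.const 0⟩, by simp⟩, ?_⟩, 0, fun n => ?_⟩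
    · refine tendsto_const_nhds.congr fun n => ?_
      rw [eq_comm, ← eLpNorm_zero (p := 2) (μ := m) (ε := ℝ)]
      refine eLpNorm_congr_ae ?_
      filter_upwards [Lp.coeFn_zero ℝ 2 m] with x hx
      rw [hx]; simp
    · have := slopeEnergy_const_mul m 0 (fun _ => 0)
      simp only [zero_mul, ne_eq, OfNat.ofNat_ne_zero, not_false_eq_true, zero_pow,
        ENNReal.ofReal_zero, slopeEnergy] at this
      simp [this]
  let H : Submodule ℝ (Lp ℝ 2 m) :=
    { carrier := sobolevSpace m
      add_mem' := fun hf hg => (hadd hf hg).1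
      zero_mem' := hzero
      smul_mem' := fun c _ hf => hsm c hf }
  set Q : Lp ℝ 2 m → ℝ := fun f => sobolevNorm m f ^ 2 with hQ
  have hQeq : ∀ f, Q f = ‖f‖ ^ 2 + (relaxedEnergy m f).toReal := sobolevNorm_sq
  have hle : ∀ {f g : Lp ℝ 2 m}, f ∈ sobolevSpace m → g ∈ sobolevSpace m →
      Q (f + g) + Q (f - g) ≤ 2 * Q f + 2 * Q g := by
    intro f g hf hg
    have h1 := relaxedEnergy_add_sub_le hpar (mem_sobolevSpace_iff.1 hf) (mem_sobolevSpace_iff.1 hg)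
    have fin1 := (mem_sobolevSpace_iff.1 (hadd hf hg).1).ne
    have fin2 := (mem_sobolevSpace_iff.1 (hadd hf hg).2).ne
    have h2 := parallelogram_law_with_norm ℝ f g
    have h3 := ENNReal.toReal_mono (ENNReal.add_lt_top.2 ⟨ENNReal.mul_lt_top (by simp)
      (mem_sobolevSpace_iff.1 hf), ENNReal.mul_lt_top (by simp) (mem_sobolevSpace_iff.1 hg)⟩).ne h1
    rw [ENNReal.toReal_add fin1 fin2, ENNReal.toReal_add (ENNReal.mul_lt_top (by simp)
      (mem_sobolevSpace_iff.1 hf)).ne (ENNReal.mul_lt_top (by simp)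
      (mem_sobolevSpace_iff.1 hg)).ne, ENNReal.toReal_mul, ENNReal.toReal_mul,
      ENNReal.toReal_ofNat] at h3
    rw [hQeq, hQeq, hQeq, hQeq]
    linarith
  have hQsm : ∀ (c : ℝ) (f : H), Q (c • (f : Lp ℝ 2 m)) = c ^ 2 * Q f := by
    intro c f
    rw [hQeq, hQeq, relaxedEnergy_smul (mem_sobolevSpace_iff.1 f.2), norm_smul, mul_pow,
      ENNReal.toReal_mul, ENNReal.toReal_ofReal (sq_nonneg c), Real.norm_eq_abs, sq_abs, mul_add]
  have hQpar : ∀ f g : H, Q ((f + g : H) : Lp ℝ 2 m) + Q ((f - g : H) : Lp ℝ 2 m) =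
      2 * Q f + 2 * Q g := by
    intro f g
    refine le_antisymm (hle f.2 g.2) ?_
    -- The reverse inequality is the direct one applied to `f + g` and `f - g`, by `2`-homogeneity.
    have h := hle (hadd f.2 g.2).1 (hadd f.2 g.2).2
    have e1 : ((f : Lp ℝ 2 m) + g + (f - g)) = (2 : ℝ) • (f : Lp ℝ 2 m) := by module
    have e2 : ((f : Lp ℝ 2 m) + g - (f - g)) = (2 : ℝ) • (g : Lp ℝ 2 m) := by module
    rw [e1, e2, hQsm, hQsm] at h
    rw [Submodule.coe_add, Submodule.coe_sub]
    linarith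
  have hQneg : ∀ f : H, Q ((-f : H) : Lp ℝ 2 m) = Q f := fun f => by
    have := hQsm (-1) f
    rw [neg_one_smul] at this
    rw [Submodule.coe_neg, this]; ring
  refine ⟨fun f g => (Q (f + g) - Q (f - g)) / 4, fun f hf g hg => ?_, fun f hf g hg h hh => ?_,
    fun c f hf g hg => ?_, fun f hf => ?_⟩
  · have := hQneg (⟨g, hg⟩ - ⟨f, hf⟩)
    rw [neg_sub] at this
    simp only [Submodule.coe_sub] at this
    simp only [add_comm g f, this]
  · exact polarization_add (Q := fun f : H => Q f) hQpar hQneg ⟨f, hf⟩ ⟨g, hg⟩ ⟨h, hh⟩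
  · exact polarization_smul (Q := fun f : H => Q f) hQpar hQsm (fun f => sq_nonneg _) c
      ⟨f, hf⟩ ⟨g, hg⟩
  · have h1 := hQsm 2 ⟨f, hf⟩
    have h2 := hQsm 0 ⟨f, hf⟩
    simp only [two_smul, zero_smul] at h1 h2
    simp only [sub_self, h1, h2]
    ring

end relaxation

/-! ### Slopes, conformal invariance and Hilbertianity of the weighted plane -/

section slope

variable {X : Type*} [MetricSpace X]

theorem lipSlope_le_of_hasSlopeLE {f : X → ℝ} {x : X} {c : ℝ} (h : HasSlopeLE f x c)
    (hc : 0 ≤ c) : lipSlope f x ≤ ENNReal.ofReal c := by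
  have key : ∀ c' > c, lipSlope f x ≤ ENNReal.ofReal c' := by
    intro c' hc'
    refine limsup_le_of_le (by isBoundedDefault) ?_
    filter_upwards [mem_nhdsWithin_of_mem_nhds (h c' hc')] with y hy
    refine ENNReal.div_le_of_le_mul ?_
    rw [edist_dist, edist_dist, ← ENNReal.ofReal_mul (hc.trans hc'.le), Real.dist_eq]
    exact ENNReal.ofReal_le_ofReal hy
  refine ge_of_tendsto (x := 𝓝[>] c) (b := lipSlope f x)
    ((ENNReal.continuous_ofReal.tendsto c).mono_left nhdsWithin_le_nhds) ?_
  filter_upwards [self_mem_nhdsWithin] with c' hc' using key c' hc'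

theorem ofReal_le_lipSlope {f : X → ℝ} {x : X} {c : ℝ}
    (h : ∃ᶠ y in 𝓝[≠] x, c * dist y x ≤ |f y - f x|) : ENNReal.ofReal c ≤ lipSlope f x := by
  refine le_limsup_of_frequently_le' ?_
  refine (h.and_eventually self_mem_nhdsWithin).mono fun y hy => ?_
  have hyx : y ≠ x := hy.2
  rw [ENNReal.le_div_iff_mul_le (Or.inl (by simpa [edist_eq_zero] using hyx))
    (Or.inl (edist_ne_top _ _)), edist_dist, edist_dist, Real.dist_eq,
    ← ENNReal.ofReal_mul' dist_nonneg]
  exact ENNReal.ofReal_le_ofReal hy.1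

theorem lipSlope_le_of_lipschitzWith {f : X → ℝ} {K : ℝ≥0} (hf : LipschitzWith K f) (x : X) :
    lipSlope f x ≤ K := by
  have := lipSlope_le_of_hasSlopeLE (f := f) (x := x) (c := K)
    (HasSlopeLE.of_eventually (Eventually.of_forall fun y => hf.dist_le_mul y x)) K.2
  rwa [ENNReal.ofReal_coe_nnreal] at this

/-- A curve along which `f` has derivative `L` bounds the slope from below. -/
theorem ofReal_div_le_lipSlope {f : X → ℝ} {x : X} {η : ℝ → X} {L M : ℝ} (hM : 0 < M)
    (hf : Tendsto (fun t => t⁻¹ * (f (η t) - f x)) (𝓝[>] 0) (𝓝 L))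
    (hη : ∀ᶠ t in 𝓝[>] 0, η t ≠ x ∧ dist (η t) x ≤ M * t) :
    ENNReal.ofReal (|L| / M) ≤ lipSlope f x := by
  have hlim : Tendsto η (𝓝[>] 0) (𝓝[≠] x) := by
    refine tendsto_nhdsWithin_iff.2 ⟨?_, hη.mono fun _ h => h.1⟩
    rw [tendsto_iff_dist_tendsto_zero]
    have : Tendsto (fun t : ℝ => M * t) (𝓝[>] 0) (𝓝 0) := by
      have h : Continuous fun t : ℝ => M * t := by fun_prop
      simpa using (h.tendsto 0).mono_left nhdsWithin_le_nhds
    exact squeeze_zero' (Eventually.of_forall fun _ => dist_nonneg) (hη.mono fun _ h => h.2) this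
  have key : ∀ c, 0 ≤ c → c < |L| / M → ENNReal.ofReal c ≤ lipSlope f x := by
    intro c hc0 hc
    refine ofReal_le_lipSlope (hlim.frequently (Eventually.frequently ?_))
    have h1 : ∀ᶠ t in 𝓝[>] (0 : ℝ), c * M < |t⁻¹ * (f (η t) - f x)| :=
      hf.abs.eventually_const_lt ((lt_div_iff₀ hM).1 hc)
    filter_upwards [h1, hη, self_mem_nhdsWithin] with t h1 h2 (ht : 0 < t)
    rw [abs_mul, abs_of_pos (inv_pos.2 ht), ← div_eq_inv_mul, lt_div_iff₀ ht] at h1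
    calc c * dist (η t) x ≤ c * (M * t) := by gcongr; exact h2.2
      _ ≤ _ := by linarith
  rcases eq_or_lt_of_le (show 0 ≤ |L| / M by positivity) with h0 | h0
  · simp [← h0]
  refine le_of_tendsto (x := 𝓝[<] (|L| / M))
    ((ENNReal.continuous_ofReal.tendsto _).mono_left nhdsWithin_le_nhds) ?_
  filter_upwards [self_mem_nhdsWithin, mem_nhdsWithin_of_mem_nhds (Ioi_mem_nhds h0)] with c h1 h2
  exact key c (le_of_lt h2) h1

end slope

section normed

variable {E : Type*} [NormedAddCommGroup E] [NormedSpace ℝ E]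

theorem HasFDerivAt.hasSlopeLE {f : E → ℝ} {f' : E →L[ℝ] ℝ} {x : E} (h : HasFDerivAt f f' x) :
    HasSlopeLE f x ‖f'‖ := by
  intro c' hc'
  have := (hasFDerivAt_iff_isLittleO.1 h).def (sub_pos.2 hc')
  filter_upwards [this] with y hy
  have h1 := f'.le_opNorm (y - x)
  rw [Real.norm_eq_abs] at h1 hy
  rw [dist_eq_norm]
  have h2 := abs_add_le (f y - f x - f' (y - x)) (f' (y - x))
  rw [sub_add_cancel] at h2
  linarith

theorem HasLineDerivAt.tendsto_inv_mul {f : E → ℝ} {L : ℝ} {x v : E}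
    (h : HasLineDerivAt ℝ f L x v) :
    Tendsto (fun t : ℝ => t⁻¹ * (f (x + t • v) - f x)) (𝓝[>] 0) (𝓝 L) := by
  have := (hasDerivAt_iff_tendsto_slope_zero.1 h).mono_left
    (nhdsWithin_mono (0 : ℝ) (s := Ioi 0) (t := {0}ᶜ) (fun t (ht : 0 < t) => ht.ne'))
  simpa using this

theorem ofReal_abs_lineDeriv_le_lipSlope (f : E → ℝ) (x : E) {v : E} (hv : ‖v‖ = 1) :
    ENNReal.ofReal |lineDeriv ℝ f x v| ≤ lipSlope f x := by
  by_cases h : LineDifferentiableAt ℝ f x v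
  · have := ofReal_div_le_lipSlope (f := f) (x := x) (η := fun t => x + t • v) one_pos
      h.hasLineDerivAt.tendsto_inv_mul (by
        filter_upwards [self_mem_nhdsWithin] with t (ht : 0 < t)
        have hv0 : v ≠ 0 := by rintro rfl; simp at hv
        refine ⟨by simp [ht.ne', hv0], ?_⟩
        simp [dist_eq_norm, norm_smul, hv, abs_of_pos ht])
    simpa using this
  -- With the default value `0` of `lineDeriv` the bound is trivial, so no differentiability has to
  -- be assumed.
  · rw [lineDeriv_zero_of_not_lineDifferentiableAt h]; simp

end normed

namespace WeightedPlane

variable {ρ : Plane → ℝ} [hρ : AdmissibleWeight ρ]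

/-- At points of differentiability, the slope is the norm of the derivative divided by `ρ`. -/
theorem lipSlope_eq {f : WeightedPlane ρ → ℝ} {x : Plane} (hx : x ≠ 0)
    (hf : DifferentiableAt ℝ (fun y => f ((toPlane ρ).symm y)) x) :
    lipSlope f ((toPlane ρ).symm x) =
      ENNReal.ofReal (‖fderiv ℝ (fun y => f ((toPlane ρ).symm y)) x‖ / ρ x) := by
  set g : Plane → ℝ := fun y => f ((toPlane ρ).symm y) with hg
  have hpos := AdmissibleWeight.pos ρ x
  have hd := hf.hasFDerivAt
  refine le_antisymm ?_ ?_
  · refine lipSlope_le_of_hasSlopeLE ?_ (by positivity)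
    intro c hc
    rw [gt_iff_lt, div_lt_iff₀ hpos] at hc
    obtain ⟨ε, hε, hερ, hε2⟩ : ∃ ε > 0, ε < ρ x ∧ ‖fderiv ℝ g x‖ < c * (ρ x - ε) := by
      have hcont : Continuous fun ε : ℝ => c * (ρ x - ε) := by fun_prop
      have h0 : ∀ᶠ ε in 𝓝 (0 : ℝ), ‖fderiv ℝ g x‖ < c * (ρ x - ε) :=
        hcont.continuousAt.eventually_const_lt (by simpa using hc)
      have h2 : ∀ᶠ ε in 𝓝[>] (0 : ℝ), 0 < ε ∧ ε < ρ x ∧ ‖fderiv ℝ g x‖ < c * (ρ x - ε) := by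
        filter_upwards [mem_nhdsWithin_of_mem_nhds h0, self_mem_nhdsWithin,
          mem_nhdsWithin_of_mem_nhds (Iio_mem_nhds hpos)] with ε a b d
        exact ⟨b, d, a⟩
      obtain ⟨ε, a, b, d⟩ := h2.exists
      exact ⟨ε, a, b, d⟩
    have hc0 : 0 < c := by
      by_contra hneg
      nlinarith [norm_nonneg (fderiv ℝ g x), sub_pos.2 hερ]
    obtain ⟨δ, hδ, hloc⟩ := weightedEDist_local ρ hx hε
    have h1 := hd.hasSlopeLE _ hε2
    have h2 : ∀ᶠ y in 𝓝 x, |g y - g x| ≤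
        c * dist ((toPlane ρ).symm y) ((toPlane ρ).symm x) := by
      filter_upwards [h1, ball_mem_nhds x hδ] with y hy hyb
      refine hy.trans ?_
      rw [mul_assoc]
      refine mul_le_mul_of_nonneg_left ?_ hc0.le
      have := (hloc y hyb x (mem_ball_self hδ)).1
      rw [← ofReal_dist_toPlane_symm] at this
      exact (ENNReal.ofReal_le_ofReal_iff dist_nonneg).1 this
    have h3 := ((toPlane ρ).continuous.tendsto ((toPlane ρ).symm x))
    rw [Homeomorph.apply_symm_apply] at h3
    filter_upwards [h3.eventually h2] with y hy
    simpa [hg] using hy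
  -- Along the ray in direction `v` the distance travelled is at most `(ρ(x) + ε) t`. The supremum
  -- over unit vectors `v` then recovers the norm of the derivative.
  · have key : ∀ v : Plane, ‖v‖ = 1 → ∀ ε > 0,
        ENNReal.ofReal (|fderiv ℝ g x v| / (ρ x + ε)) ≤ lipSlope f ((toPlane ρ).symm x) := by
      intro v hv ε hε
      obtain ⟨δ, hδ, hloc⟩ := weightedEDist_local ρ hx hε
      refine ofReal_div_le_lipSlope (η := fun t => (toPlane ρ).symm (x + t • v)) (by positivity)
        (hd.hasLineDerivAt v).tendsto_inv_mul ?_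
      have hδ' : ∀ᶠ t : ℝ in 𝓝[>] 0, t < δ := mem_nhdsWithin_of_mem_nhds (Iio_mem_nhds hδ)
      filter_upwards [self_mem_nhdsWithin, hδ'] with t (ht : 0 < t) htδ
      have hv0 : v ≠ 0 := by rintro rfl; simp at hv
      refine ⟨by simp [ht.ne', hv0], ?_⟩
      have hdist : dist (x + t • v) x = t := by
        simp [dist_eq_norm, norm_smul, hv, abs_of_pos ht]
      have := (hloc (x + t • v) (by rw [mem_ball, hdist]; exact htδ) x (mem_ball_self hδ)).2
      rw [← ofReal_dist_toPlane_symm, hdist] at this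
      exact (ENNReal.ofReal_le_ofReal_iff (by positivity)).1 this
    have key2 : ∀ v : Plane, ‖v‖ = 1 →
        ENNReal.ofReal (|fderiv ℝ g x v| / ρ x) ≤ lipSlope f ((toPlane ρ).symm x) := by
      intro v hv
      have hcont : ContinuousAt (fun ε : ℝ => ENNReal.ofReal (|fderiv ℝ g x v| / (ρ x + ε))) 0 := by
        refine ENNReal.continuous_ofReal.continuousAt.comp ?_
        refine continuousAt_const.div (by fun_prop) (by simpa using hpos.ne')
      have := hcont.tendsto.mono_left (nhdsWithin_le_nhds (s := Ioi 0))
      rw [add_zero] at this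
      refine le_of_tendsto this ?_
      filter_upwards [self_mem_nhdsWithin] with ε hε using key v hv ε hε
    rcases eq_or_ne (lipSlope f ((toPlane ρ).symm x)) ⊤ with htop | htop
    · rw [htop]; exact le_top
    rw [← ENNReal.ofReal_toReal htop]
    refine ENNReal.ofReal_le_ofReal ((div_le_iff₀ hpos).2 ?_)
    refine ContinuousLinearMap.opNorm_le_of_unit_norm (by positivity) fun v hv => ?_
    have := ENNReal.toReal_mono htop (key2 v hv)
    rw [ENNReal.toReal_ofReal (by positivity), div_le_iff₀ hpos] at this
    exact this

theorem lipschitzWith_comp_symm {f : WeightedPlane ρ → ℝ} {K : ℝ≥0} (hf : LipschitzWith K f) :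
    LipschitzWith (K * 2) (fun y => f ((toPlane ρ).symm y)) :=
  hf.comp lipschitzWith_toPlane_symm

/-- Conformal invariance of the Dirichlet energy in dimension two: the density `ρ²` cancels the
factor `ρ⁻²` of the squared slope. -/
theorem ae_sq_mul_lipSlope_sq {f : WeightedPlane ρ → ℝ} {K : ℝ≥0} (hf : LipschitzWith K f) :
    ∀ᵐ x : Plane, ENNReal.ofReal (ρ x ^ 2) * lipSlope f ((toPlane ρ).symm x) ^ 2 =
      ‖fderiv ℝ (fun y => f ((toPlane ρ).symm y)) x‖ₑ ^ 2 := by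
  have h0 : ∀ᵐ x : Plane, x ≠ 0 := by simp [ae_iff, measure_singleton]
  filter_upwards [(lipschitzWith_comp_symm hf).ae_differentiableAt, h0] with x hx hx0
  have hpos := AdmissibleWeight.pos ρ x
  rw [lipSlope_eq hx0 hx, ← ENNReal.ofReal_pow (by positivity),
    ← ENNReal.ofReal_mul (by positivity), ← ofReal_norm, ← ENNReal.ofReal_pow (norm_nonneg _)]
  congr 1
  field_simp

/-- The energy of a Lipschitz function on the plane with the distance `d_ρ` is its Dirichlet
energy. -/
theorem setLIntegral_lipSlope_sq {f : WeightedPlane ρ → ℝ} {K : ℝ≥0} (hf : LipschitzWith K f)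
    {A : Set (WeightedPlane ρ)} (hA : MeasurableSet A) :
    ∫⁻ x in A, lipSlope f x ^ 2 ∂(μHE[2]) =
      ∫⁻ x in (toPlane ρ).symm ⁻¹' A, ‖fderiv ℝ (fun y => f ((toPlane ρ).symm y)) x‖ₑ ^ 2 := by
  have hA' : MeasurableSet ((toPlane ρ).symm ⁻¹' A) := (toPlane ρ).symm.measurable hA
  rw [← measurePreserving_toPlane_symm.setLIntegral_comp_preimage_emb
    (toPlane ρ).symm.toMeasurableEquiv.measurableEmbedding]
  have hae := ae_sq_mul_lipSlope_sq hf
  have hm : Measurable fun x => ENNReal.ofReal (ρ x ^ 2) :=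
    ((AdmissibleWeight.measurable ρ).pow_const 2).ennreal_ofReal
  rw [density, restrict_withDensity hA', lintegral_withDensity_eq_lintegral_mul_non_measurable _ hm
    (ae_of_all _ fun _ => ENNReal.ofReal_lt_top)]
  refine lintegral_congr_ae (ae_restrict_of_ae ?_)
  filter_upwards [hae] with x hx using hx

variable (ρ)

/-- The energy is the Euclidean Dirichlet integral. By Rademacher's theorem derivatives are additive
almost everywhere, and the dual norm of the Euclidean plane satisfies the parallelogram law. -/
theorem infinitesimallyHilbertian :
    InfinitesimallyHilbertian (μHE[2] : Measure (WeightedPlane ρ)) := by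
  refine infinitesimallyHilbertian_of_parallelogram fun u v hu hv => le_of_eq ?_
  have henergy : ∀ w : WeightedPlane ρ → ℝ, IsBddSuppLipschitz w →
      slopeEnergy μHE[2] w =
        ∫⁻ x : Plane, ‖fderiv ℝ (fun y => w ((toPlane ρ).symm y)) x‖ₑ ^ 2 := by
    intro w ⟨⟨K, hK⟩, _⟩
    have := setLIntegral_lipSlope_sq hK MeasurableSet.univ
    simpa [slopeEnergy] using this
  have hmeas : ∀ w : WeightedPlane ρ → ℝ,
      Measurable fun x => ‖fderiv ℝ (fun y => w ((toPlane ρ).symm y)) x‖ₑ ^ 2 := fun w =>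
    (measurable_fderiv ℝ _).enorm.pow_const 2
  rw [henergy _ (hu.add hv), henergy _ (hu.sub hv), henergy u hu, henergy v hv,
    ← lintegral_add_left (hmeas fun x => u x + v x), ← lintegral_const_mul 2 (hmeas _),
    ← lintegral_const_mul 2 (hmeas _), ← lintegral_add_left ((hmeas _).const_mul 2)]
  refine lintegral_congr_ae ?_
  obtain ⟨⟨K, hK⟩, _⟩ := hu
  obtain ⟨⟨L, hL⟩, _⟩ := hv
  filter_upwards [(lipschitzWith_comp_symm hK).ae_differentiableAt,
    (lipschitzWith_comp_symm hL).ae_differentiableAt] with x hx hy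
  have e1 := fderiv_fun_add hx hy
  have e2 := fderiv_fun_sub hx hy
  simp only [e1, e2]
  have hpar : ∀ a b : Plane →L[ℝ] ℝ, ‖a + b‖ ^ 2 + ‖a - b‖ ^ 2 = 2 * ‖a‖ ^ 2 + 2 * ‖b‖ ^ 2 := by
    intro a b
    have := parallelogram_law_with_norm ℝ ((InnerProductSpace.toDual ℝ Plane).symm a)
      ((InnerProductSpace.toDual ℝ Plane).symm b)
    rw [← map_add, ← map_sub, LinearIsometryEquiv.norm_map, LinearIsometryEquiv.norm_map,
      LinearIsometryEquiv.norm_map, LinearIsometryEquiv.norm_map] at this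
    linarith
  have hen : ∀ a : Plane →L[ℝ] ℝ, ‖a‖ₑ ^ 2 = ENNReal.ofReal (‖a‖ ^ 2) := fun a => by
    rw [← ofReal_norm, ENNReal.ofReal_pow (norm_nonneg _)]
  rw [hen, hen, hen, hen, ← ENNReal.ofReal_add (by positivity) (by positivity), hpar,
    ENNReal.ofReal_add (by positivity) (by positivity), ENNReal.ofReal_mul (by norm_num),
    ENNReal.ofReal_mul (by norm_num), ENNReal.ofReal_ofNat]

end WeightedPlane

/-! ### The Poincaré inequality on Euclidean balls -/

/-- Integration along segments needs a slope bound at every point, since a segment is a null set of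
the plane, whereas the final integral only sees the gradient almost everywhere. The constant `K`
fills in where `g` is not differentiable. -/
theorem LipschitzWith.exists_measurable_hasSlopeLE {E : Type*} [NormedAddCommGroup E]
    [NormedSpace ℝ E] [FiniteDimensional ℝ E] [MeasurableSpace E] [BorelSpace E] (μ : Measure E)
    [μ.IsAddHaarMeasure] {g : E → ℝ} {K : ℝ≥0} (hg : LipschitzWith K g) :
    ∃ G : E → ℝ, Measurable G ∧ (∀ x, G x ∈ Icc 0 (K : ℝ)) ∧ (∀ x, HasSlopeLE g x (G x)) ∧
      ∀ᵐ x ∂μ, G x = ‖fderiv ℝ g x‖ := by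
  classical
  refine ⟨fun x => if DifferentiableAt ℝ g x then ‖fderiv ℝ g x‖ else K, ?_, fun x => ?_,
    fun x => ?_, ?_⟩
  · exact Measurable.ite (measurableSet_of_differentiableAt ℝ g) (measurable_fderiv ℝ g).norm
      measurable_const
  · dsimp only
    split_ifs
    · exact ⟨norm_nonneg _, norm_fderiv_le_of_lipschitz ℝ hg⟩
    · exact ⟨K.2, le_rfl⟩
  · dsimp only
    split_ifs with h
    · exact h.hasFDerivAt.hasSlopeLE
    · exact HasSlopeLE.of_eventually (Eventually.of_forall fun y => hg.dist_le_mul y x)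
  · filter_upwards [hg.ae_differentiableAt] with x hx
    rw [if_pos hx]

/-- The homothety `y ↦ (1 - t)a + ty` maps the convex set `B` into itself and has Jacobian `t² ≥
1/4`. -/
theorem setLIntegral_comp_combo_le {B : Set Plane} (hB : Convex ℝ B) (hBm : MeasurableSet B)
    {F : Plane → ℝ≥0∞} (hF : Measurable F) {a : Plane} (ha : a ∈ B) {t : ℝ} (ht : 1 / 2 ≤ t)
    (ht1 : t ≤ 1) : ∫⁻ y in B, F ((1 - t) • a + t • y) ≤ 4 * ∫⁻ y in B, F y := by
  have ht0 : 0 < t := by linarith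
  have hmap : Measure.map (fun y : Plane => (1 - t) • a + t • y) volume =
      ENNReal.ofReal (|(t ^ 2)⁻¹|) • volume := by
    have h1 := Measure.map_addHaar_smul (volume : Measure Plane) ht0.ne'
    rw [finrank_euclideanSpace_fin] at h1
    have h2 : (fun y : Plane => (1 - t) • a + t • y) = (fun y => (1 - t) • a + y) ∘ (t • ·) := rfl
    rw [h2, ← Measure.map_map (by fun_prop) (by fun_prop), h1, Measure.map_smul,
      map_add_left_eq_self]
  calc ∫⁻ y in B, F ((1 - t) • a + t • y)
      ≤ ∫⁻ y, B.indicator F ((1 - t) • a + t • y) := by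
        rw [← lintegral_indicator hBm]
        refine lintegral_mono fun y => ?_
        by_cases hy : y ∈ B
        · rw [indicator_of_mem hy, indicator_of_mem]
          exact hB ha hy (by linarith) ht0.le (by ring)
        · rw [indicator_of_notMem hy]; exact zero_le
    _ = ENNReal.ofReal (|(t ^ 2)⁻¹|) * ∫⁻ y in B, F y := by
        rw [← lintegral_map (hF.indicator hBm) (by fun_prop), hmap, lintegral_smul_measure,
          lintegral_indicator hBm, smul_eq_mul]
    _ ≤ 4 * ∫⁻ y in B, F y := by
        gcongr
        rw [← ENNReal.ofReal_ofNat]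
        refine ENNReal.ofReal_le_ofReal ?_
        rw [abs_of_pos (by positivity)]
        refine inv_le_of_inv_le₀ (by norm_num) ?_
        nlinarith

/-- The Poincaré inequality on balls of the Euclidean plane. -/
theorem lintegral_lintegral_enorm_sub_le {g : Plane → ℝ} {K : ℝ≥0} (hg : LipschitzWith K g)
    (x : Plane) {r : ℝ} (hr : 0 < r) :
    ∫⁻ z in ball x r, ∫⁻ y in ball x r, ‖g y - g z‖ₑ ≤
      ENNReal.ofReal (8 * r) * volume (ball x r) * ∫⁻ y in ball x r, ‖fderiv ℝ g y‖ₑ := by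
  obtain ⟨G, hGm, hGb, hG, hGae⟩ := hg.exists_measurable_hasSlopeLE (volume : Measure Plane)
  set B := ball x r with hB
  have hBm : MeasurableSet B := measurableSet_ball
  have hconv : Convex ℝ B := convex_ball x r
  set F : Plane → ℝ≥0∞ := fun y => ENNReal.ofReal (G y) with hFdef
  have hF : Measurable F := hGm.ennreal_ofReal
  have hFint : ∫⁻ y in B, ‖fderiv ℝ g y‖ₑ = ∫⁻ y in B, F y := by
    refine lintegral_congr_ae (ae_restrict_of_ae ?_)
    filter_upwards [hGae] with y hy
    simp only [hFdef]
    rw [hy, ofReal_norm]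
  have hseg : ∀ z ∈ B, ∀ y ∈ B, ‖g y - g z‖ₑ ≤
      ENNReal.ofReal (2 * r) * ∫⁻ t in Icc (0 : ℝ) 1, F ((1 - t) • z + t • y) := by
    intro z hz y hy
    have h := abs_sub_le_lintegral_curve (f := g) (g := G) (M := K) (zero_le_one (α := ℝ))
      ((lipschitzWith_lineMap (𝕜 := ℝ) z y).lipschitzOnWith (s := Icc 0 1)) (fun t _ => hGb _)
      (fun t _ => hG _)
    rw [AffineMap.lineMap_apply_zero, AffineMap.lineMap_apply_one, ← Real.enorm_eq_ofReal_abs] at h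
    refine h.trans ?_
    rw [← lintegral_const_mul' _ _ ENNReal.ofReal_ne_top]
    refine lintegral_mono fun t => ?_
    rw [AffineMap.hasDerivAt_lineMap.deriv, mul_comm, AffineMap.lineMap_apply_module]
    gcongr
    rw [← ofReal_norm]
    refine ENNReal.ofReal_le_ofReal ?_
    rw [← dist_eq_norm]
    rw [hB, mem_ball] at hz hy
    linarith [dist_triangle_right y z x]
  have hmeas3 : Measurable fun p : (Plane × Plane) × ℝ =>
      F ((1 - p.2) • p.1.1 + p.2 • p.1.2) := hF.comp (by fun_prop)
  -- For `t ≥ 1/2` the change of variables is made in `y`. For `t ≤ 1/2` the roles of `y` and `z`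
  -- are exchanged, so the Jacobian never degenerates.
  have hinner : ∀ t ∈ Icc (0 : ℝ) 1,
      ∫⁻ z in B, ∫⁻ y in B, F ((1 - t) • z + t • y) ≤ 4 * volume B * ∫⁻ y in B, F y := by
    have half : ∀ t : ℝ, 1 / 2 ≤ t → t ≤ 1 →
        ∫⁻ z in B, ∫⁻ y in B, F ((1 - t) • z + t • y) ≤ 4 * volume B * ∫⁻ y in B, F y := by
      intro t ht ht1
      calc _ ≤ ∫⁻ _ in B, 4 * ∫⁻ y in B, F y :=
            setLIntegral_mono measurable_const fun z hz =>
              setLIntegral_comp_combo_le hconv hBm hF hz ht ht1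
        _ = _ := by rw [setLIntegral_const]; ring
    intro t ht
    rcases le_total (1 / 2) t with h | h
    · exact half t h ht.2
    · rw [lintegral_lintegral_swap]
      · have := half (1 - t) (by linarith) (by linarith [ht.1])
        simpa only [sub_sub_cancel, add_comm] using this
      · exact (hmeas3.comp (f := fun p : Plane × Plane => (p, t)) (by fun_prop)).aemeasurable
  calc ∫⁻ z in B, ∫⁻ y in B, ‖g y - g z‖ₑ
      ≤ ∫⁻ z in B, ∫⁻ y in B, ENNReal.ofReal (2 * r) *
          ∫⁻ t in Icc (0 : ℝ) 1, F ((1 - t) • z + t • y) :=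
        setLIntegral_mono' hBm fun z hz => setLIntegral_mono' hBm fun y hy => hseg z hz y hy
    _ = ENNReal.ofReal (2 * r) * ∫⁻ t in Icc (0 : ℝ) 1,
          ∫⁻ z in B, ∫⁻ y in B, F ((1 - t) • z + t • y) := by
        have e1 : ∀ z : Plane, ∫⁻ y in B, ENNReal.ofReal (2 * r) *
            ∫⁻ t in Icc (0 : ℝ) 1, F ((1 - t) • z + t • y) = ENNReal.ofReal (2 * r) *
            ∫⁻ t in Icc (0 : ℝ) 1, ∫⁻ y in B, F ((1 - t) • z + t • y) := by
          intro z
          rw [lintegral_const_mul' _ _ ENNReal.ofReal_ne_top, lintegral_lintegral_swap]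
          exact (hmeas3.comp (f := fun p : Plane × ℝ => ((z, p.1), p.2)) (by fun_prop)).aemeasurable
        simp only [e1]
        rw [lintegral_const_mul' _ _ ENNReal.ofReal_ne_top, lintegral_lintegral_swap]
        have h3 : Measurable fun q : (Plane × ℝ) × Plane =>
            F ((1 - q.1.2) • q.1.1 + q.1.2 • q.2) := hF.comp (by fun_prop)
        exact (h3.lintegral_prod_right' (ν := volume.restrict B)).aemeasurable
    _ ≤ ENNReal.ofReal (2 * r) * ∫⁻ _ in Icc (0 : ℝ) 1, 4 * volume B * ∫⁻ y in B, F y := by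
        gcongr 1
        exact setLIntegral_mono measurable_const hinner
    _ = ENNReal.ofReal (8 * r) * volume B * ∫⁻ y in B, ‖fderiv ℝ g y‖ₑ := by
        rw [hFint, setLIntegral_const, Real.volume_Icc, sub_zero, ENNReal.ofReal_one, mul_one,
          show (8 : ℝ) * r = 2 * r * 4 by ring, ENNReal.ofReal_mul (by positivity : 0 ≤ 2 * r),
          ENNReal.ofReal_ofNat]
        ring

/-- The mean oscillation is bounded by the double average of differences. -/
theorem ofReal_average_abs_sub_average_le {X : Type*} [MeasurableSpace X] {μ : Measure X}
    [IsProbabilityMeasure μ] {f : X → ℝ} (hf : Integrable f μ) :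
    ENNReal.ofReal (∫ y, |f y - ∫ z, f z ∂μ| ∂μ) ≤ ∫⁻ y, ∫⁻ z, ‖f y - f z‖ₑ ∂μ ∂μ := by
  have h1 : Integrable (fun y => f y - ∫ z, f z ∂μ) μ := hf.sub (integrable_const _)
  have h2 := ofReal_integral_norm_eq_lintegral_enorm h1
  simp only [Real.norm_eq_abs] at h2
  rw [h2]
  refine lintegral_mono fun y => ?_
  have h3 : f y - ∫ z, f z ∂μ = ∫ z, (f y - f z) ∂μ := by
    rw [integral_sub (integrable_const _) hf]; simp
  simp only [h3]
  exact enorm_integral_le_lintegral_enorm _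

/-! ### Ahlfors regularity, rectifiability and the PI property -/

namespace WeightedPlane

variable (ρ : Plane → ℝ) [hρ : AdmissibleWeight ρ]

theorem ball_subset_preimage (x : WeightedPlane ρ) (r : ℝ) :
    ball x r ⊆ toPlane ρ ⁻¹' ball (toPlane ρ x) r := fun y hy =>
  (dist_toPlane_le y x).trans_lt hy

theorem preimage_ball_subset (x : WeightedPlane ρ) (r : ℝ) :
    toPlane ρ ⁻¹' ball (toPlane ρ x) r ⊆ ball x (2 * r) := fun y (hy : dist _ _ < r) =>
  (dist_le_two_mul y x).trans_lt (by linarith)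

theorem measure_preimage_eq_density {A : Set Plane} (hA : MeasurableSet A) :
    μHE[2] (toPlane ρ ⁻¹' A) = density ρ A :=
  measurePreserving_toPlane.measure_preimage hA.nullMeasurableSet

theorem measure_ball_le (x : WeightedPlane ρ) (r : ℝ) :
    μHE[2] (ball x r) ≤ 4 * volume (ball (toPlane ρ x) r) :=
  calc μHE[2] (ball x r) ≤ μHE[2] (toPlane ρ ⁻¹' ball (toPlane ρ x) r) :=
        measure_mono (ball_subset_preimage ρ x r)
    _ = density ρ (ball (toPlane ρ x) r) := measure_preimage_eq_density ρ measurableSet_ball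
    _ ≤ _ := density_le ρ _

/-- The `d_ρ`-ball contains the Euclidean ball of half the radius, which has a quarter of the area,
and the density is at least `1`. -/
theorem le_measure_ball (x : WeightedPlane ρ) (r : ℝ) :
    volume (ball (toPlane ρ x) r) ≤ 4 * μHE[2] (ball x r) := by
  have h : volume (ball (toPlane ρ x) r) = 4 * volume (ball (toPlane ρ x) (r / 2)) := by
    have := Measure.addHaar_ball_mul (volume : Measure Plane) (toPlane ρ x)
      (by norm_num : (0 : ℝ) ≤ 2) (r / 2)
    rw [mul_div_cancel₀ _ (by norm_num : (2 : ℝ) ≠ 0)] at this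
    rw [this, finrank_euclideanSpace_fin, Measure.addHaar_ball_center]
    norm_num
  rw [h]
  gcongr
  calc volume (ball (toPlane ρ x) (r / 2)) ≤ density ρ (ball (toPlane ρ x) (r / 2)) :=
        volume_le_density ρ _
    _ = μHE[2] (toPlane ρ ⁻¹' ball (toPlane ρ x) (r / 2)) :=
        (measure_preimage_eq_density ρ measurableSet_ball).symm
    _ ≤ _ := measure_mono (by
        have := preimage_ball_subset ρ x (r / 2)
        rwa [mul_div_cancel₀ _ (by norm_num : (2 : ℝ) ≠ 0)] at this)

theorem isMetricMeasureSpace :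
    IsMetricMeasureSpace (μHE[2] : Measure (WeightedPlane ρ)) where
  complete := inferInstance
  separable := inferInstance
  boundedly_finite s hs := by
    obtain ⟨r, hr⟩ := hs.subset_ball ((toPlane ρ).symm 0)
    exact (measure_mono hr).trans_lt ((measure_ball_le ρ _ r).trans_lt
      (ENNReal.mul_lt_top (by simp) measure_ball_lt_top))

theorem measure_ball_pos (x : WeightedPlane ρ) {r : ℝ} (hr : 0 < r) :
    0 < μHE[2] (ball x r) := by
  have h1 := le_measure_ball ρ x r
  have h2 : 0 < volume (ball (toPlane ρ x) r) := Metric.measure_ball_pos _ _ hr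
  by_contra h
  rw [not_lt, nonpos_iff_eq_zero] at h
  rw [h, mul_zero] at h1
  exact absurd h1 (not_le.2 h2)

theorem isPointedMetricMeasureSpace (x : WeightedPlane ρ) :
    IsPointedMetricMeasureSpace (μHE[2] : Measure (WeightedPlane ρ)) x where
  toIsMetricMeasureSpace := isMetricMeasureSpace ρ
  mem_support := by
    rw [Measure.mem_support_iff_forall]
    intro U hU
    obtain ⟨r, hr, h⟩ := Metric.mem_nhds_iff.1 hU
    exact (measure_ball_pos ρ x hr).trans_le (measure_mono h)

theorem isAhlforsRegular : IsAhlforsRegular 2 (μHE[2] : Measure (WeightedPlane ρ)) := by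
  -- The measure lies between `πr²/4` and `4πr²`, and `3 < π ≤ 4`.
  refine ⟨16, by norm_num, fun x r hr _ => ?_⟩
  have hv : volume (ball (toPlane ρ x) r) = ENNReal.ofReal (r ^ 2 * Real.pi) := by
    rw [EuclideanSpace.volume_ball_fin_two, ENNReal.ofReal_mul (by positivity),
      ENNReal.ofReal_pow hr.le]
  have hpi := Real.pi_gt_three
  have hpi4 := Real.pi_le_four
  rw [Real.rpow_two]
  constructor
  · have h := le_measure_ball ρ x r
    rw [hv] at h
    refine (ENNReal.mul_le_mul_iff_right (a := 4) (by simp) (by simp)).1 (le_trans ?_ h)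
    rw [← ENNReal.ofReal_ofNat, ← ENNReal.ofReal_mul (by norm_num)]
    refine ENNReal.ofReal_le_ofReal ?_
    nlinarith [sq_nonneg r]
  · refine (measure_ball_le ρ x r).trans ?_
    rw [hv, ← ENNReal.ofReal_ofNat, ← ENNReal.ofReal_mul (by norm_num)]
    refine ENNReal.ofReal_le_ofReal ?_
    nlinarith [sq_nonneg r]

theorem volume_ball_mul (x : Plane) {r : ℝ} : volume (ball x (2 * r)) = 4 * volume (ball x r) := by
  rw [Measure.addHaar_ball_mul _ _ (by norm_num : (0 : ℝ) ≤ 2), finrank_euclideanSpace_fin,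
    Measure.addHaar_ball_center]
  norm_num

theorem isDoublingMeasureSpace :
    IsDoublingMeasureSpace (μHE[2] : Measure (WeightedPlane ρ)) := by
  -- `64 = 4 · 4 · 4`: upper density bound, doubling of Euclidean area, lower bound of the measure
  -- of a ball.
  refine ⟨64, by norm_num, fun x r hr => (measure_ball_le ρ x (2 * r)).trans ?_⟩
  rw [volume_ball_mul]
  calc 4 * (4 * volume (ball (toPlane ρ x) r)) ≤ 4 * (4 * (4 * μHE[2] (ball x r))) := by
        gcongr; exact le_measure_ball ρ x r
    _ = ((64 : ℝ≥0) : ℝ≥0∞) * μHE[2] (ball x r) := by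
        rw [← mul_assoc, ← mul_assoc]; norm_num

theorem isMRectifiable : IsMRectifiable (μHE[2] : Measure (WeightedPlane ρ)) := by
  have hac : (μHE[2] : Measure (WeightedPlane ρ)) ≪ (μH[(2 : ℕ)] : Measure (WeightedPlane ρ)) := by
    rw [Measure.euclideanHausdorffMeasure_def]
    exact Measure.smul_absolutelyContinuous
  refine ⟨fun _ => 2, fun i => if i = 0 then univ else ∅, fun _ => toPlane ρ, fun i => ⟨?_, ?_, ?_⟩,
    fun i j hij => ?_, ?_⟩
  · dsimp only
    split_ifs <;> simp
  · exact Measure.restrict_le_self.absolutelyContinuous.trans hac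
  · exact ⟨1, 2, lipschitzWith_toPlane.lipschitzOnWith, fun a b =>
      lipschitzWith_toPlane_symm (ρ := ρ) (toPlane ρ a) (toPlane ρ b)⟩
  · simp only
    split_ifs with h1 h2
    · exact absurd (h1.trans h2.symm) hij
    all_goals simp
  · have : (⋃ i : ℕ, if i = 0 then (univ : Set (WeightedPlane ρ)) else ∅) = univ :=
      eq_univ_of_forall fun x => mem_iUnion.2 ⟨0, by simp⟩
    rw [this]; simp

theorem setLIntegral_ball_le (F : WeightedPlane ρ → ℝ≥0∞) (x : WeightedPlane ρ) (r : ℝ) :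
    ∫⁻ y in ball x r, F y ∂(μHE[2]) ≤
      4 * ∫⁻ y in ball (toPlane ρ x) r, F ((toPlane ρ).symm y) := by
  calc ∫⁻ y in ball x r, F y ∂(μHE[2])
      ≤ ∫⁻ y in toPlane ρ ⁻¹' ball (toPlane ρ x) r, F y ∂(μHE[2]) :=
        lintegral_mono_set (ball_subset_preimage ρ x r)
    _ = ∫⁻ y in ball (toPlane ρ x) r, F ((toPlane ρ).symm y) ∂(density ρ) := by
        rw [← measurePreserving_toPlane.setLIntegral_comp_preimage_emb
          (toPlane ρ).toMeasurableEquiv.measurableEmbedding]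
        simp
    _ ≤ ∫⁻ y in ball (toPlane ρ x) r, F ((toPlane ρ).symm y) ∂((4 : ℝ≥0∞) • volume) :=
        lintegral_mono' (Measure.restrict_mono le_rfl (density_le ρ)) le_rfl
    _ = _ := by rw [Measure.restrict_smul, lintegral_smul_measure, smul_eq_mul]

/-- Cauchy–Schwarz, then the identity between Dirichlet and slope energies on the larger ball `ball
x (2 * r)`, which contains the Euclidean ball of radius `r`. The measure of that ball is at most `16
V`, whence the factor `4` after the square root. -/
theorem lintegral_enorm_fderiv_le {f : WeightedPlane ρ → ℝ} {K : ℝ≥0} (hf : LipschitzWith K f)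
    (x : WeightedPlane ρ) (r : ℝ) :
    ∫⁻ y in ball (toPlane ρ x) r, ‖fderiv ℝ (fun y => f ((toPlane ρ).symm y)) y‖ₑ ≤
      4 * volume (ball (toPlane ρ x) r) *
        (⨍⁻ y in ball x (2 * r), lipSlope f y ^ 2 ∂(μHE[2])) ^ (1 / 2 : ℝ) := by
  set V := volume (ball (toPlane ρ x) r)
  set A := ⨍⁻ y in ball x (2 * r), lipSlope f y ^ 2 ∂(μHE[2] : Measure (WeightedPlane ρ))
  have hm : Measurable fun y => ‖fderiv ℝ (fun y => f ((toPlane ρ).symm y)) y‖ₑ :=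
    (measurable_fderiv ℝ _).enorm
  have h1 := ENNReal.lintegral_mul_le_Lp_mul_Lq (volume.restrict (ball (toPlane ρ x) r))
    Real.HolderConjugate.two_two (f := fun _ => 1)
    (g := fun y => ‖fderiv ℝ (fun y => f ((toPlane ρ).symm y)) y‖ₑ)
    aemeasurable_const hm.aemeasurable
  simp only [Pi.mul_apply, one_mul, ENNReal.rpow_two, one_pow, lintegral_one,
    Measure.restrict_apply_univ] at h1
  have h2 : ∫⁻ y in ball (toPlane ρ x) r, ‖fderiv ℝ (fun y => f ((toPlane ρ).symm y)) y‖ₑ ^ 2 ≤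
      16 * V * A := by
    calc _ ≤ ∫⁻ y in (toPlane ρ).symm ⁻¹' ball x (2 * r),
          ‖fderiv ℝ (fun y => f ((toPlane ρ).symm y)) y‖ₑ ^ 2 := by
          refine lintegral_mono_set fun y hy => ?_
          have h : (toPlane ρ).symm y ∈ toPlane ρ ⁻¹' ball (toPlane ρ x) r := by
            rwa [mem_preimage, Homeomorph.apply_symm_apply]
          exact preimage_ball_subset ρ x r h
      _ = ∫⁻ y in ball x (2 * r), lipSlope f y ^ 2 ∂(μHE[2]) :=
          (setLIntegral_lipSlope_sq hf measurableSet_ball).symm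
      _ = μHE[2] (ball x (2 * r)) * A := by
          rw [measure_mul_setLAverage]
          exact ((isMetricMeasureSpace ρ).boundedly_finite _ isBounded_ball).ne
      _ ≤ 16 * V * A := by
          gcongr
          refine (measure_ball_le ρ x (2 * r)).trans (le_of_eq ?_)
          rw [volume_ball_mul, ← mul_assoc, show (4 : ℝ≥0∞) * 4 = 16 by norm_num]
  refine h1.trans ((mul_le_mul' le_rfl (ENNReal.rpow_le_rpow h2 (by norm_num))).trans
    (le_of_eq ?_))
  have h16 : (16 : ℝ≥0∞) ^ (1 / 2 : ℝ) = 4 := by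
    rw [show (16 : ℝ≥0∞) = 4 ^ (2 : ℝ) by norm_num, ← ENNReal.rpow_mul]
    norm_num
  rw [ENNReal.mul_rpow_of_nonneg _ _ (by norm_num), ENNReal.mul_rpow_of_nonneg _ _ (by norm_num),
    h16]
  have hV : V ^ (1 / 2 : ℝ) * V ^ (1 / 2 : ℝ) = V := by
    rw [← ENNReal.rpow_add_of_nonneg _ _ (by norm_num) (by norm_num)]
    norm_num
  calc V ^ (1 / 2 : ℝ) * (4 * V ^ (1 / 2 : ℝ) * A ^ (1 / 2 : ℝ)) =
      4 * (V ^ (1 / 2 : ℝ) * V ^ (1 / 2 : ℝ)) * A ^ (1 / 2 : ℝ) := by ring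
    _ = _ := by rw [hV]

theorem supportsWeakPoincare :
    SupportsWeakPoincare (μHE[2] : Measure (WeightedPlane ρ)) := by
  -- `8192 = 16 · 4 · 4 · 4 · 8`: the density bound `4` for each of the two integrals, `V ≤ 4M` used
  -- twice, the factor `4` from Cauchy–Schwarz, and the constant `8` of the Euclidean inequality.
  refine ⟨8192, by norm_num, 2, by norm_num, fun f ⟨⟨K, hK⟩, _⟩ x r hr => ?_⟩
  set m : Measure (WeightedPlane ρ) := μHE[2]
  set M := m (ball x r) with hM
  set V := volume (ball (toPlane ρ x) r) with hV
  set A := (⨍⁻ y in ball x (2 * r), lipSlope f y ^ 2 ∂m) ^ (1 / 2 : ℝ)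
  have hM0 : M ≠ 0 := (measure_ball_pos ρ x hr).ne'
  have hMtop : M ≠ ⊤ := ((isMetricMeasureSpace ρ).boundedly_finite _ isBounded_ball).ne
  have hVM : V ≤ 4 * M := le_measure_ball ρ x r
  have : IsFiniteMeasure (m.restrict (ball x r)) :=
    ⟨by rw [Measure.restrict_apply_univ]; exact hMtop.lt_top⟩
  have : NeZero (m.restrict (ball x r)) :=
    ⟨fun h => hM0 (by rw [hM, ← Measure.restrict_apply_univ, h]; simp)⟩
  have hint : Integrable f (m.restrict (ball x r)) := by
    refine Measure.integrableOn_of_bounded (M := ‖f x‖ + K * r) hMtop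
      hK.continuous.aestronglyMeasurable ?_
    refine (ae_restrict_iff' measurableSet_ball).2 (ae_of_all _ fun y hy => ?_)
    have h1 := hK.dist_le_mul y x
    have h2 : (K : ℝ) * dist y x ≤ K * r := mul_le_mul_of_nonneg_left (le_of_lt hy) K.2
    rw [dist_eq_norm] at h1
    have h3 := norm_add_le (f y - f x) (f x)
    rw [sub_add_cancel] at h3
    linarith
  have h1 := ofReal_average_abs_sub_average_le
    (μ := (m.restrict (ball x r) univ)⁻¹ • m.restrict (ball x r))
    (hint.smul_measure (by simpa using hM0))
  rw [Measure.restrict_apply_univ, ← hM] at h1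
  simp only [lintegral_smul_measure, smul_eq_mul] at h1
  rw [lintegral_const_mul' _ _ (ENNReal.inv_ne_top.2 hM0)] at h1
  have h2 : ∫⁻ y in ball x r, ∫⁻ z in ball x r, ‖f y - f z‖ₑ ∂m ∂m ≤
      16 * (ENNReal.ofReal (8 * r) * V * (4 * V * A)) := by
    calc _ ≤ 4 * ∫⁻ y in ball (toPlane ρ x) r, 4 * ∫⁻ z in ball (toPlane ρ x) r,
          ‖f ((toPlane ρ).symm y) - f ((toPlane ρ).symm z)‖ₑ :=
          (setLIntegral_ball_le ρ _ x r).trans (by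
            gcongr with y
            exact setLIntegral_ball_le ρ _ x r)
      _ = 16 * ∫⁻ y in ball (toPlane ρ x) r, ∫⁻ z in ball (toPlane ρ x) r,
          ‖f ((toPlane ρ).symm z) - f ((toPlane ρ).symm y)‖ₑ := by
          rw [lintegral_const_mul' _ _ (by simp), ← mul_assoc]
          norm_num
          simp only [enorm_sub_rev]
      _ ≤ 16 * (ENNReal.ofReal (8 * r) * V * ∫⁻ y in ball (toPlane ρ x) r,
            ‖fderiv ℝ (fun y => f ((toPlane ρ).symm y)) y‖ₑ) := by
          gcongr
          exact lintegral_lintegral_enorm_sub_le (lipschitzWith_comp_symm hK) _ hr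
      _ ≤ _ := by
          gcongr
          exact lintegral_enorm_fderiv_le ρ hK x r
  rw [average, average, Measure.restrict_apply_univ, ← hM]
  refine h1.trans ?_
  calc M⁻¹ * (M⁻¹ * ∫⁻ y in ball x r, ∫⁻ z in ball x r, ‖f y - f z‖ₑ ∂m ∂m)
      ≤ M⁻¹ * (M⁻¹ * (16 * (ENNReal.ofReal (8 * r) * (4 * M) * (4 * (4 * M) * A)))) := by
        gcongr
        exact h2.trans (by gcongr)
    _ = (M⁻¹ * M) * (M⁻¹ * M) * (1024 * ENNReal.ofReal (8 * r)) * A := by ring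
    _ = ENNReal.ofReal (8192 * r) * A := by
        rw [ENNReal.inv_mul_cancel hM0 hMtop, one_mul, one_mul, ← ENNReal.ofReal_ofNat,
          ← ENNReal.ofReal_mul (by norm_num)]
        congr 2; ring

theorem isPISpace : IsPISpace (μHE[2] : Measure (WeightedPlane ρ)) :=
  ⟨isDoublingMeasureSpace ρ, supportsWeakPoincare ρ⟩

end WeightedPlane

/-! ### The conformal Riemannian metric on the punctured plane -/

/-- All charts of an open subset of a vector space are the same inclusion, so the coordinate changes
of its tangent bundle are the identity. -/
theorem trivializationAt_puncturedPlane_symm (x y : puncturedPlane) (v : Plane) :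
    (trivializationAt Plane (TangentSpace 𝓘(ℝ, Plane)) x).symm y v = v := by
  have hb : y ∈ (chartAt Plane x).source := by
    have : chartAt Plane x = chartAt Plane y := rfl
    rw [this]; exact mem_chart_source _ y
  have h := TangentBundle.symmL_trivializationAt_eq_core (𝕜 := ℝ) (I := 𝓘(ℝ, Plane)) hb
  have h2 := congrArg (fun L : Plane →L[ℝ] Plane => L v) h
  have h3 := (tangentBundleCore 𝓘(ℝ, Plane) puncturedPlane).coordChange_self
    (achart Plane y) y (by exact mem_chart_source _ y) v
  rw [← Bundle.Trivialization.symmL_apply (R := ℝ) _ (by exact hb)]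
  exact h2.trans h3

theorem hasMFDerivAt_puncturedPlane_val (x : puncturedPlane) :
    HasMFDerivAt 𝓘(ℝ, Plane) 𝓘(ℝ, Plane) (Subtype.val : puncturedPlane → Plane) x
      (ContinuousLinearMap.id ℝ Plane) := by
  refine ⟨continuous_subtype_val.continuousAt, ?_⟩
  have h1 : HasFDerivWithinAt (fun y : Plane => y) (ContinuousLinearMap.id ℝ Plane)
    (range 𝓘(ℝ, Plane)) (extChartAt 𝓘(ℝ, Plane) x x) := hasFDerivWithinAt_id _ _
  refine h1.congr_of_eventuallyEq ?_ ?_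
  · have : (extChartAt 𝓘(ℝ, Plane) x).target ∈ 𝓝[range 𝓘(ℝ, Plane)] (extChartAt 𝓘(ℝ, Plane) x x) :=
      extChartAt_target_mem_nhdsWithin x
    filter_upwards [this] with y hy
    have := (extChartAt 𝓘(ℝ, Plane) x).right_inv hy
    exact this
  · simp [writtenInExtChartAt]
    rfl

noncomputable def planeInner : Plane →L[ℝ] Plane →L[ℝ] ℝ :=
  LinearMap.mkContinuous₂ (innerₗ Plane) 1 fun v w => by
    simpa using norm_inner_le_norm (𝕜 := ℝ) v w

noncomputable def conformalInner (ρ : Plane → ℝ) (x : Plane) : Plane →L[ℝ] Plane →L[ℝ] ℝ :=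
  ρ x ^ 2 • planeInner

theorem conformalInner_apply (ρ : Plane → ℝ) (x v w : Plane) :
   conformalInner ρ x v w = ρ x ^ 2 * inner ℝ v w := by
  simp [conformalInner, planeInner]

theorem ContDiffAt.sq_smul_const {E V : Type*} [NormedAddCommGroup E] [NormedSpace ℝ E]
    [NormedAddCommGroup V] [NormedSpace ℝ V] {f : E → ℝ} {x : E} (hf : ContDiffAt ℝ ∞ f x) (v : V) :
    ContDiffAt ℝ ∞ (fun y => f y ^ 2 • v) x := (hf.pow 2).smul contDiffAt_const

noncomputable def conformalMetric (ρ : Plane → ℝ) (hpos : ∀ x, 1 ≤ ρ x)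
    (hρ : ContDiffOn ℝ ∞ ρ {0}ᶜ) : PuncturedPlaneMetric where
  inner x := conformalInner ρ x
  symm x v w := by
    change conformalInner ρ x v w = conformalInner ρ x w v
    exact (conformalInner_apply ρ x v w).trans (((congrArg (ρ x ^ 2 * ·)
      (real_inner_comm (F := Plane) _ _)).trans (conformalInner_apply ρ x w v).symm))
  pos x v hv := by
    have h1 : 0 < inner ℝ (show Plane from v) (show Plane from v) := real_inner_self_pos.2 hv
    have := hpos x
    exact lt_of_lt_of_eq (by positivity) (conformalInner_apply ρ x v v).symm
  isVonNBounded x := by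
    change Bornology.IsVonNBounded ℝ {v : Plane | conformalInner ρ x v v < 1}
    rw [NormedSpace.isVonNBounded_iff]
    refine (isBounded_ball (x := (0 : Plane)) (r := 1)).subset fun v hv => ?_
    rw [mem_ofPred_eq, conformalInner_apply, real_inner_self_eq_norm_sq] at hv
    rw [mem_ball_zero_iff]
    have := hpos x
    nlinarith [norm_nonneg v, sq_nonneg ‖v‖, one_le_pow₀ this (n := 2)]
  contMDiff := by
    intro x₀
    rw [contMDiffAt_hom_bundle]
    refine ⟨contMDiffAt_id, ?_⟩
    have h1 : ContMDiffAt 𝓘(ℝ, Plane) 𝓘(ℝ, Plane →L[ℝ] Plane →L[ℝ] ℝ) ∞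
        (fun x : puncturedPlane => conformalInner ρ x) x₀ := by
      rw [contMDiffAt_subtype_iff (f := conformalInner ρ), contMDiffAt_iff_contDiffAt]
      have h2 : ContDiffAt ℝ ∞ ρ x₀ :=
        hρ.contDiffAt (isOpen_compl_singleton.mem_nhds x₀.2)
      exact h2.sq_smul_const planeInner
    -- The trivializations being the identity, the coordinate expression of the metric is
    -- `conformalInner ρ` itself.
    refine h1.congr_of_eventuallyEq (Eventually.of_forall fun x => ?_)
    ext v w
    have hs : x ∈ (trivializationAt Plane (TangentSpace 𝓘(ℝ, Plane)) x₀).baseSet := by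
      exact mem_chart_source Plane x
    have key := inCoordinates_apply_eq₂ (𝕜 := ℝ) (F₁ := Plane) (F₂ := Plane) (F₃ := ℝ)
      (E₁ := fun x : puncturedPlane => TangentSpace 𝓘(ℝ, Plane) x)
      (E₂ := fun x : puncturedPlane => TangentSpace 𝓘(ℝ, Plane) x)
      (E₃ := Bundle.Trivial puncturedPlane ℝ) (x₀ := x₀) (x := x) (ϕ := conformalInner ρ x)
      (v := v) (w := w) hs hs (mem_univ x)
    refine key.trans ?_
    rw [trivializationAt_puncturedPlane_symm, trivializationAt_puncturedPlane_symm]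
    simp
    rfl

theorem conformalMetric_form {ρ : Plane → ℝ} (hpos : ∀ x, 1 ≤ ρ x) (hρ : ContDiffOn ℝ ∞ ρ {0}ᶜ)
    (x : puncturedPlane) (v w : Plane) :
    (conformalMetric ρ hpos hρ).form x v w = ρ x ^ 2 * inner ℝ v w :=
  conformalInner_apply ρ x v w

theorem pathELength_conformalMetric {ρ : Plane → ℝ} (hpos : ∀ x, 1 ≤ ρ x)
    (hρ : ContDiffOn ℝ ∞ ρ {0}ᶜ) {γ : ℝ → puncturedPlane} {a b : ℝ}
    (hγ : ContMDiffOn 𝓘(ℝ, ℝ) 𝓘(ℝ, Plane) 1 γ (Icc a b)) :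
    letI : Bundle.RiemannianBundle (fun x : puncturedPlane => TangentSpace 𝓘(ℝ, Plane) x) :=
      ⟨(conformalMetric ρ hpos hρ).toRiemannianMetric⟩
    Manifold.pathELength 𝓘(ℝ, Plane) γ a b =
      ∫⁻ t in Icc a b, ENNReal.ofReal (ρ (γ t)) * ‖deriv (fun t => (γ t : Plane)) t‖ₑ := by
  let _ : Bundle.RiemannianBundle (fun x : puncturedPlane => TangentSpace 𝓘(ℝ, Plane) x) :=
      ⟨(conformalMetric ρ hpos hρ).toRiemannianMetric⟩
  have hnorm : ∀ (x : puncturedPlane) (v : TangentSpace 𝓘(ℝ, Plane) x),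
      ‖v‖ₑ = ENNReal.ofReal (ρ x) * ‖(show Plane from v)‖ₑ := by
    intro x v
    have h1 : ‖v‖ ^ 2 = (ρ x * ‖(show Plane from v)‖) ^ 2 := by
      rw [← real_inner_self_eq_norm_sq, mul_pow, ← real_inner_self_eq_norm_sq]
      exact conformalInner_apply ρ x v v
    have hp : 0 ≤ ρ x := zero_le_one.trans (hpos x)
    have h2 : ‖v‖ = ρ x * ‖(show Plane from v)‖ :=
      (sq_eq_sq₀ (norm_nonneg _) (mul_nonneg hp (norm_nonneg _))).1 h1
    rw [← ofReal_norm, h2, ENNReal.ofReal_mul hp, ofReal_norm]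
  rw [Manifold.pathELength_eq_lintegral_mfderiv_Ioo, ← restrict_Ioo_eq_restrict_Icc]
  refine setLIntegral_congr_fun measurableSet_Ioo fun t ht => ?_
  have hd : MDifferentiableAt 𝓘(ℝ, ℝ) 𝓘(ℝ, Plane) γ t :=
    ((hγ t ⟨ht.1.le, ht.2.le⟩).contMDiffAt (Icc_mem_nhds ht.1 ht.2)).mdifferentiableAt one_ne_zero
  have hc := (hasMFDerivAt_puncturedPlane_val (γ t)).comp t hd.hasMFDerivAt
  have hf : HasFDerivAt (fun t => (γ t : Plane))
      (show ℝ →L[ℝ] Plane from mfderiv 𝓘(ℝ, ℝ) 𝓘(ℝ, Plane) γ t) t :=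
    hasMFDerivAt_iff_hasFDerivAt.1 hc
  have hd' := (hasFDerivAt_iff_hasDerivAt (F := Plane)).1 hf
  refine (hnorm _ _).trans ?_
  rw [hd'.deriv]
  rfl

/-- The `C¹` curves that compute the Riemannian distance are Lipschitz, so they compete for `d_ρ`.
The converse is harder: Lipschitz curves are more numerous and may cross the origin. -/
theorem weightedEDist_le_riemEDist {ρ : Plane → ℝ} (hpos : ∀ x, 1 ≤ ρ x)
    (hρ : ContDiffOn ℝ ∞ ρ {0}ᶜ) (x y : puncturedPlane) :
    weightedEDist ρ x y ≤ (conformalMetric ρ hpos hρ).riemEDist x y := by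
  refine le_of_forall_gt fun r hr => ?_
  let _ : Bundle.RiemannianBundle (fun x : puncturedPlane => TangentSpace 𝓘(ℝ, Plane) x) :=
      ⟨(conformalMetric ρ hpos hρ).toRiemannianMetric⟩
  obtain ⟨γ, h0, h1, hγ, hlt⟩ := Manifold.exists_lt_of_riemannianEDist_lt hr
  have hγ' : ContDiffOn ℝ 1 (fun t => (γ t : Plane)) (Icc 0 1) := by
    rw [← contMDiffOn_iff_contDiffOn]
    exact (contMDiff_subtype_val (n := 1)).comp_contMDiffOn hγ
  obtain ⟨K, hK⟩ := hγ'.exists_lipschitzOnWith one_ne_zero (convex_Icc 0 1) isCompact_Icc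
  rw [← h0, ← h1]
  exact (weightedEDist_le_of_curve ρ zero_le_one hK).trans_lt
    ((pathELength_conformalMetric hpos hρ hγ).symm.trans_lt hlt)

theorem riemEDist_le_of_segment {ρ : Plane → ℝ} (hpos : ∀ x, 1 ≤ ρ x)
    (hρ : ContDiffOn ℝ ∞ ρ {0}ᶜ) (x y : puncturedPlane) {M : ℝ}
    (h0 : (0 : Plane) ∉ segment ℝ (x : Plane) y) (hM : ∀ z ∈ segment ℝ (x : Plane) y, ρ z ≤ M) :
    (conformalMetric ρ hpos hρ).riemEDist x y ≤ ENNReal.ofReal M * edist (x : Plane) y := by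
  let _ : Bundle.RiemannianBundle (fun x : puncturedPlane => TangentSpace 𝓘(ℝ, Plane) x) :=
      ⟨(conformalMetric ρ hpos hρ).toRiemannianMetric⟩
  have hmem : ∀ t ∈ Icc (0 : ℝ) 1,
      (AffineMap.lineMap (x : Plane) (y : Plane) t : Plane) ∈ segment ℝ (x : Plane) y := fun t ht =>
    segment_eq_image_lineMap ℝ (x : Plane) (y : Plane) ▸ mem_image_of_mem _ ht
  -- Clamping the parameter to `[0, 1]` keeps the curve off the origin for all real times.
  let γ : ℝ → puncturedPlane := fun t =>
    ⟨AffineMap.lineMap (x : Plane) (y : Plane) (projIcc (0 : ℝ) 1 zero_le_one t : ℝ),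
      fun h => h0 (h ▸ hmem _ (projIcc (0 : ℝ) 1 zero_le_one t).2)⟩
  have hval : EqOn (fun t => (γ t : Plane)) (AffineMap.lineMap (x : Plane) (y : Plane))
      (Icc (0 : ℝ) 1) := fun t ht => by simp [γ, projIcc_of_mem zero_le_one ht]
  have hs : ContMDiffOn 𝓘(ℝ, ℝ) 𝓘(ℝ, Plane) 1 γ (Icc 0 1) := by
    intro t ht
    have h1 : ContMDiffWithinAt 𝓘(ℝ, ℝ) 𝓘(ℝ, Plane) ∞ (Subtype.val ∘ γ) (Icc 0 1) t := by
      rw [contMDiffWithinAt_iff_contDiffWithinAt]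
      refine ContDiffWithinAt.congr ?_ (fun t ht => hval ht) (hval ht)
      exact (AffineMap.contDiff_lineMap _ _).contDiffWithinAt
    exact ((ContMDiffWithinAt.subtypeVal_comp_iff _ _ _ _).1 h1).of_le (by simp)
  have e0 : γ 0 = x := Subtype.ext (by simpa using hval (left_mem_Icc.2 zero_le_one))
  have e1 : γ 1 = y := Subtype.ext (by simpa using hval (right_mem_Icc.2 zero_le_one))
  refine (Manifold.riemannianEDist_le_pathELength hs e0 e1 zero_le_one).trans ?_
  refine (pathELength_conformalMetric hpos hρ hs).trans_le ?_
  have hb : ∀ t ∈ Ioo (0 : ℝ) 1, ENNReal.ofReal (ρ (γ t)) * ‖deriv (fun t => (γ t : Plane)) t‖ₑ ≤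
      ENNReal.ofReal M * edist (x : Plane) y := by
    intro t ht
    have ht' : t ∈ Icc (0 : ℝ) 1 := ⟨ht.1.le, ht.2.le⟩
    have hd : deriv (fun t => (γ t : Plane)) t = (y : Plane) - x := by
      rw [(hval.eventuallyEq_of_mem (Icc_mem_nhds ht.1 ht.2)).deriv_eq]
      simp
    rw [hd, ← edist_eq_enorm_sub, edist_comm]
    gcongr
    exact hM _ (by rw [show (γ t : Plane) = _ from hval ht']; exact hmem t ht')
  rw [← restrict_Ioo_eq_restrict_Icc]
  refine (setLIntegral_mono measurable_const hb).trans ?_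
  simp

/-! ### Equality of `d_ρ` and the Riemannian distance -/

section distance

variable {ρ : Plane → ℝ} [AdmissibleWeight ρ] {D : puncturedPlane → puncturedPlane → ℝ≥0∞}

/-- `D` stands for the Riemannian distance, of which only the triangle inequality and the bound on
segments are used here. The estimate makes it cheap to go around the origin at small radius. -/
theorem le_of_segment_bound_of_ne
    (htri : ∀ x y z, D x z ≤ D x y + D y z)
    (hseg : ∀ (x y : puncturedPlane) (M : ℝ), (0 : Plane) ∉ segment ℝ (x : Plane) y →
      (∀ z ∈ segment ℝ (x : Plane) y, ρ z ≤ M) → D x y ≤ ENNReal.ofReal M * edist (x : Plane) y)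
    (x y : puncturedPlane) : D x y ≤ ENNReal.ofReal (6 * (‖(x : Plane)‖ + ‖(y : Plane)‖)) := by
  have h2 : ∀ x y : puncturedPlane, (0 : Plane) ∉ segment ℝ (x : Plane) y →
      D x y ≤ ENNReal.ofReal (2 * (‖(x : Plane)‖ + ‖(y : Plane)‖)) := by
    intro x y h
    refine (hseg x y 2 h fun z _ => AdmissibleWeight.le_two ρ z).trans ?_
    rw [edist_dist, ← ENNReal.ofReal_mul zero_le_two]
    exact ENNReal.ofReal_le_ofReal
      (mul_le_mul_of_nonneg_left (dist_le_norm_add_norm _ _) zero_le_two)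
  by_cases h : (0 : Plane) ∈ segment ℝ (x : Plane) y
  · have hxs : 0 < (x : Plane) 0 ^ 2 + (x : Plane) 1 ^ 2 := by
      have h1 : 0 < ‖(x : Plane)‖ := norm_pos_iff.2 x.2
      have h2 := EuclideanSpace.real_norm_sq_eq (x : Plane)
      rw [Fin.sum_univ_two] at h2
      rw [← h2]; positivity
    -- When the origin lies on the segment, the detour goes through the quarter turn of `x`. It is
    -- orthogonal to `x`, and to `y`, which is then a multiple of `x`; so neither leg meets the
    -- origin.
    let z : Plane := !₂[-(x : Plane) 1, (x : Plane) 0]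
    have hz : ‖z‖ = ‖(x : Plane)‖ := by
      rw [EuclideanSpace.norm_eq, EuclideanSpace.norm_eq]
      congr 1
      simp [z, Fin.sum_univ_two, add_comm]
    have hz0 : z ≠ 0 := by
      rw [← norm_ne_zero_iff, hz]; exact norm_ne_zero_iff.2 x.2
    obtain ⟨c, d, hc, hd, hcd, h0⟩ := h
    have e0 : c * (x : Plane) 0 + d * (y : Plane) 0 = 0 := by
      simpa using congrArg (fun w : Plane => w 0) h0
    have e1 : c * (x : Plane) 1 + d * (y : Plane) 1 = 0 := by
      simpa using congrArg (fun w : Plane => w 1) h0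
    have hd0 : d ≠ 0 := by
      rintro rfl
      have : c = 1 := by linarith
      subst this
      nlinarith
    have hseg1 : (0 : Plane) ∉ segment ℝ (x : Plane) z := by
      rintro ⟨a, b, ha, hb, hab, h0⟩
      have f0 : a * (x : Plane) 0 - b * (x : Plane) 1 = 0 := by
        simpa [z, sub_eq_add_neg] using congrArg (fun w : Plane => w 0) h0
      have f1 : a * (x : Plane) 1 + b * (x : Plane) 0 = 0 := by
        simpa [z] using congrArg (fun w : Plane => w 1) h0
      have : (a ^ 2 + b ^ 2) * ((x : Plane) 0 ^ 2 + (x : Plane) 1 ^ 2) = 0 := by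
        linear_combination (a * (x : Plane) 0 - b * (x : Plane) 1) * f0 +
          (a * (x : Plane) 1 + b * (x : Plane) 0) * f1
      have h3 : a ^ 2 + b ^ 2 = 0 := (mul_eq_zero.1 this).resolve_right hxs.ne'
      have h4 : (a + b) ^ 2 ≤ 2 * (a ^ 2 + b ^ 2) := by nlinarith [sq_nonneg (a - b)]
      rw [hab, h3] at h4
      norm_num at h4
    have hseg2 : (0 : Plane) ∉ segment ℝ z (y : Plane) := by
      rintro ⟨a, b, ha, hb, hab, h0⟩
      have f0 : -(a * (x : Plane) 1) + b * (y : Plane) 0 = 0 := by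
        simpa [z] using congrArg (fun w : Plane => w 0) h0
      have f1 : a * (x : Plane) 0 + b * (y : Plane) 1 = 0 := by
        simpa [z] using congrArg (fun w : Plane => w 1) h0
      have : ((a * d) ^ 2 + (b * c) ^ 2) * ((x : Plane) 0 ^ 2 + (x : Plane) 1 ^ 2) = 0 := by
        have g0 : -(a * d * (x : Plane) 1) - b * c * (x : Plane) 0 = 0 := by
          linear_combination d * f0 - b * e0
        have g1 : a * d * (x : Plane) 0 - b * c * (x : Plane) 1 = 0 := by
          linear_combination d * f1 - b * e1
        linear_combination (-(a * d * (x : Plane) 1) - b * c * (x : Plane) 0) * g0 +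
          (a * d * (x : Plane) 0 - b * c * (x : Plane) 1) * g1
      have h3 : (a * d) ^ 2 + (b * c) ^ 2 = 0 := (mul_eq_zero.1 this).resolve_right hxs.ne'
      have h4 : a * d = 0 := by nlinarith [sq_nonneg (a * d), sq_nonneg (b * c)]
      have ha0 : a = 0 := (mul_eq_zero.1 h4).resolve_right hd0
      have hb1 : b = 1 := by linarith
      rw [ha0, hb1] at h0
      exact y.2 (by simpa using h0)
    refine (htri x ⟨z, hz0⟩ y).trans ((add_le_add (h2 x ⟨z, hz0⟩ hseg1)
      (h2 ⟨z, hz0⟩ y hseg2)).trans ?_)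
    rw [← ENNReal.ofReal_add (by positivity) (by positivity)]
    refine ENNReal.ofReal_le_ofReal ?_
    simp only [hz]
    linarith [norm_nonneg (y : Plane)]
  · refine (h2 x y h).trans (ENNReal.ofReal_le_ofReal ?_)
    linarith [norm_nonneg (x : Plane), norm_nonneg (y : Plane)]

/-- The function `D x` is a calibration off the origin: short segments at `z` cost at most `c'`
times their length for every `c' > ρ(z)`, by continuity of `ρ`. Its value at the origin plays no
role because the curve avoids it. -/
theorem le_lintegral_curve_of_segment_bound (hself : ∀ x, D x x = 0)
    (hcomm : ∀ x y, D x y = D y x)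
    (htri : ∀ x y z, D x z ≤ D x y + D y z)
    (hseg : ∀ (x y : puncturedPlane) (M : ℝ), (0 : Plane) ∉ segment ℝ (x : Plane) y →
      (∀ z ∈ segment ℝ (x : Plane) y, ρ z ≤ M) → D x y ≤ ENNReal.ofReal M * edist (x : Plane) y)
    {γ : ℝ → Plane} {c d : ℝ} {K : ℝ≥0} (hcd : c ≤ d) (hγ : LipschitzOnWith K γ (Icc c d))
    (hne : ∀ t ∈ Icc c d, γ t ≠ 0) (x y : puncturedPlane) (hx : γ c = x) (hy : γ d = y) :
    D x y ≤ ∫⁻ t in Icc c d, ENNReal.ofReal (ρ (γ t)) * ‖deriv γ t‖ₑ := by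
  classical
  have hfin : ∀ x y, D x y ≠ ⊤ := fun x y =>
    ((le_of_segment_bound_of_ne htri hseg x y).trans_lt ENNReal.ofReal_lt_top).ne
  let F : Plane → ℝ := fun z => if h : z ≠ 0 then (D x ⟨z, h⟩).toReal else 0
  have hF : ∀ z (h : z ≠ 0), F z = (D x ⟨z, h⟩).toReal := fun z h => dif_pos h
  have hslope : ∀ z, z ≠ 0 → HasSlopeLE F z (ρ z) := by
    intro z hz c' hc'
    have h1 : ∀ᶠ w in 𝓝 z, w ≠ 0 ∧ ρ w ≤ c' :=
      (isOpen_compl_singleton.eventually_mem hz).and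
        (((AdmissibleWeight.continuousAt ρ hz).eventually_lt_const hc').mono fun w hw => hw.le)
    obtain ⟨δ, hδ, hball⟩ := Metric.eventually_nhds_iff_ball.1 h1
    filter_upwards [ball_mem_nhds z hδ] with w hw
    have hs : segment ℝ z w ⊆ ball z δ :=
      (convex_ball z δ).segment_subset (mem_ball_self hδ) hw
    have hw0 := (hball w hw).1
    have hb := hseg ⟨z, hz⟩ ⟨w, hw0⟩ c' (fun h => (hball _ (hs h)).1 rfl)
      fun u hu => (hball u (hs hu)).2
    have hc0 : 0 ≤ c' := (AdmissibleWeight.pos ρ z).le.trans hc'.le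
    have hb' : (D ⟨z, hz⟩ ⟨w, hw0⟩).toReal ≤ c' * dist w z := by
      rw [edist_dist, ← ENNReal.ofReal_mul hc0, dist_comm] at hb
      exact ENNReal.toReal_le_of_le_ofReal (by positivity) hb
    rw [hF z hz, hF w hw0, abs_le]
    have t1 := ENNReal.toReal_mono (ENNReal.add_ne_top.2 ⟨hfin _ _, hfin _ _⟩)
      (htri x ⟨z, hz⟩ ⟨w, hw0⟩)
    have t2 := ENNReal.toReal_mono (ENNReal.add_ne_top.2 ⟨hfin _ _, hfin _ _⟩)
      (htri x ⟨w, hw0⟩ ⟨z, hz⟩)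
    rw [ENNReal.toReal_add (hfin _ _) (hfin _ _)] at t1 t2
    rw [hcomm ⟨w, hw0⟩] at t2
    constructor <;> linarith
  have h := abs_sub_le_lintegral_curve (f := F) (g := ρ) (M := 2) hcd hγ
    (fun t _ => ⟨(AdmissibleWeight.pos ρ _).le, AdmissibleWeight.le_two ρ _⟩)
    (fun t ht => hslope _ (hne t ht))
  rw [hx, hy, hF x x.2, hF y y.2] at h
  simp only [Subtype.coe_eta, hself, ENNReal.toReal_zero, sub_zero,
    abs_of_nonneg ENNReal.toReal_nonneg, ENNReal.ofReal_toReal (hfin x y)] at h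
  exact h

/-- If a curve meets the origin, the part between its first and last times on the circle of radius
`δ` is replaced by a detour of cost at most `6(δ + δ) = 12δ`. -/
theorem le_weightedEDist_of_segment_bound (hself : ∀ x, D x x = 0)
    (hcomm : ∀ x y, D x y = D y x)
    (htri : ∀ x y z, D x z ≤ D x y + D y z)
    (hseg : ∀ (x y : puncturedPlane) (M : ℝ), (0 : Plane) ∉ segment ℝ (x : Plane) y →
      (∀ z ∈ segment ℝ (x : Plane) y, ρ z ≤ M) → D x y ≤ ENNReal.ofReal M * edist (x : Plane) y)
    (x y : puncturedPlane) : D x y ≤ weightedEDist ρ x y := by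
  refine le_iInf₂ fun γ ⟨⟨K, hK⟩, h0, h1⟩ => ?_
  rw [weightedLength]
  by_cases hne : ∀ t ∈ Icc (0 : ℝ) 1, γ t ≠ 0
  · exact le_lintegral_curve_of_segment_bound hself hcomm htri hseg zero_le_one hK hne x y h0 h1
  push Not at hne
  obtain ⟨t₀, ht₀, hγ₀⟩ := hne
  refine ENNReal.le_of_forall_pos_le_add fun ε hε _ => ?_
  have hx0 : 0 < ‖(x : Plane)‖ := norm_pos_iff.2 x.2
  have hy0 : 0 < ‖(y : Plane)‖ := norm_pos_iff.2 y.2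
  obtain ⟨δ, hδ0, hδx, hδy, hδε⟩ : ∃ δ : ℝ, 0 < δ ∧ δ ≤ ‖(x : Plane)‖ ∧ δ ≤ ‖(y : Plane)‖ ∧
      12 * δ ≤ ε := by
    refine ⟨min (min ‖(x : Plane)‖ ‖(y : Plane)‖) (ε / 12), ?_, ?_, ?_, ?_⟩
    · have : (0 : ℝ) < ε := hε
      positivity
    · exact (min_le_left _ _).trans (min_le_left _ _)
    · exact (min_le_left _ _).trans (min_le_right _ _)
    · have := min_le_right (min ‖(x : Plane)‖ ‖(y : Plane)‖) ((ε : ℝ) / 12)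
      linarith
  have hcn : ContinuousOn (fun t => ‖γ t‖) (Icc 0 1) := hK.continuousOn.norm
  let S : Set ℝ := Icc 0 1 ∩ (fun t => ‖γ t‖) ⁻¹' {δ}
  have hS : IsCompact S :=
    isCompact_Icc.of_isClosed_subset (hcn.preimage_isClosed_of_isClosed isClosed_Icc
      isClosed_singleton) inter_subset_left
  have hleft : ∀ t ∈ Icc (0 : ℝ) 1, γ t = 0 → ∃ s ∈ S, s ≤ t := by
    intro t ht h
    obtain ⟨s, hs, hs'⟩ := intermediate_value_Icc' ht.1 (hcn.mono (Icc_subset_Icc_right ht.2))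
      (show δ ∈ Icc ‖γ t‖ ‖γ 0‖ by rw [h, h0, norm_zero]; exact ⟨hδ0.le, hδx⟩)
    exact ⟨s, ⟨⟨hs.1, hs.2.trans ht.2⟩, hs'⟩, hs.2⟩
  have hright : ∀ t ∈ Icc (0 : ℝ) 1, γ t = 0 → ∃ s ∈ S, t ≤ s := by
    intro t ht h
    obtain ⟨s, hs, hs'⟩ := intermediate_value_Icc ht.2 (hcn.mono (Icc_subset_Icc_left ht.1))
      (show δ ∈ Icc ‖γ t‖ ‖γ 1‖ by rw [h, h1, norm_zero]; exact ⟨hδ0.le, hδy⟩)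
    exact ⟨s, ⟨⟨ht.1.trans hs.1, hs.2⟩, hs'⟩, hs.1⟩
  have hSne : S.Nonempty := (hleft t₀ ht₀ hγ₀).imp fun s hs => hs.1
  have hSn : ∀ s ∈ S, γ s ≠ 0 := fun s hs h => by
    have : ‖γ s‖ = δ := hs.2
    rw [h, norm_zero] at this
    exact hδ0.ne this
  obtain ⟨t₁, ht₁⟩ := hS.exists_isLeast hSne
  obtain ⟨t₂, ht₂⟩ := hS.exists_isGreatest hSne
  have h12 : t₁ ≤ t₂ := ht₁.2 ht₂.1
  -- A zero before `t₁` would be preceded, by the intermediate value theorem, by a crossing of the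
  -- circle, against the minimality of `t₁`.
  have hne1 : ∀ t ∈ Icc 0 t₁, γ t ≠ 0 := fun t ht h => by
    obtain ⟨s, hs, hst⟩ := hleft t ⟨ht.1, ht.2.trans ht₁.1.1.2⟩ h
    have : s = t := le_antisymm hst (ht.2.trans (ht₁.2 hs))
    exact hSn s hs (this ▸ h)
  have hne2 : ∀ t ∈ Icc t₂ 1, γ t ≠ 0 := fun t ht h => by
    obtain ⟨s, hs, hst⟩ := hright t ⟨ht₂.1.1.1.trans ht.1, ht.2⟩ h
    have : s = t := le_antisymm ((ht₂.2 hs).trans ht.1) hst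
    exact hSn s hs (this ▸ h)
  have b1 := le_lintegral_curve_of_segment_bound hself hcomm htri hseg ht₁.1.1.1
    (hK.mono (Icc_subset_Icc_right ht₁.1.1.2)) hne1 x ⟨γ t₁, hSn _ ht₁.1⟩ h0 rfl
  have b2 := le_lintegral_curve_of_segment_bound hself hcomm htri hseg ht₂.1.1.2
    (hK.mono (Icc_subset_Icc_left ht₂.1.1.1)) hne2 ⟨γ t₂, hSn _ ht₂.1⟩ y rfl h1
  have b3 := le_of_segment_bound_of_ne htri hseg ⟨γ t₁, hSn _ ht₁.1⟩ ⟨γ t₂, hSn _ ht₂.1⟩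
  have e1 : ‖γ t₁‖ = δ := ht₁.1.2
  have e2 : ‖γ t₂‖ = δ := ht₂.1.2
  have b4 : D ⟨γ t₁, hSn _ ht₁.1⟩ ⟨γ t₂, hSn _ ht₂.1⟩ ≤ ε := by
    refine b3.trans ?_
    simp only [e1, e2]
    rw [← ENNReal.ofReal_coe_nnreal]
    exact ENNReal.ofReal_le_ofReal (by linarith)
  -- The half-open interval gives disjointness from `t₁ ≤ t₂` alone.
  have hdisj : Disjoint (Ico 0 t₁) (Icc t₂ 1) :=
    Set.disjoint_left.2 fun t ht ht' => absurd (ht.2.trans_le h12) (not_lt.2 ht'.1)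
  have b5 : (∫⁻ t in Icc 0 t₁, ENNReal.ofReal (ρ (γ t)) * ‖deriv γ t‖ₑ) +
      (∫⁻ t in Icc t₂ 1, ENNReal.ofReal (ρ (γ t)) * ‖deriv γ t‖ₑ) ≤
      ∫⁻ t in Icc 0 1, ENNReal.ofReal (ρ (γ t)) * ‖deriv γ t‖ₑ := by
    rw [← restrict_Ico_eq_restrict_Icc (a := 0) (b := t₁),
      ← lintegral_union measurableSet_Icc hdisj]
    exact lintegral_mono_set (union_subset
      (Ico_subset_Icc_self.trans (Icc_subset_Icc_right ht₁.1.1.2))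
      (Icc_subset_Icc_left ht₂.1.1.1))
  calc D x y ≤ D x ⟨γ t₁, hSn _ ht₁.1⟩ + (D ⟨γ t₁, hSn _ ht₁.1⟩ ⟨γ t₂, hSn _ ht₂.1⟩ +
        D ⟨γ t₂, hSn _ ht₂.1⟩ y) := (htri _ _ _).trans (add_le_add le_rfl (htri _ _ _))
    _ ≤ _ := add_le_add b1 (add_le_add b4 b2)
    _ ≤ _ := by
      rw [add_comm (ε : ℝ≥0∞), ← add_assoc]
      exact add_le_add b5 le_rfl

end distance

theorem edist_toPlane_symm_eq_riemEDist (ρ : Plane → ℝ) [AdmissibleWeight ρ]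
    (hρ : ContDiffOn ℝ ∞ ρ {0}ᶜ) (x y : puncturedPlane) :
    weightedEDist ρ x y =
      (conformalMetric ρ (AdmissibleWeight.one_le ρ) hρ).riemEDist x y := by
  refine le_antisymm (weightedEDist_le_riemEDist _ hρ x y) ?_
  let _ : Bundle.RiemannianBundle (fun x : puncturedPlane => TangentSpace 𝓘(ℝ, Plane) x) :=
      ⟨(conformalMetric ρ (AdmissibleWeight.one_le ρ) hρ).toRiemannianMetric⟩
  exact le_weightedEDist_of_segment_bound
    (D := (conformalMetric ρ (AdmissibleWeight.one_le ρ) hρ).riemEDist)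
    (fun x => Manifold.riemannianEDist_self) (fun x y => Manifold.riemannianEDist_comm)
    (fun x y z => Manifold.riemannianEDist_triangle)
    (fun x y M h0 hM => riemEDist_le_of_segment _ hρ x y h0 hM) x y

theorem riemVolume_conformalMetric (ρ : Plane → ℝ) [AdmissibleWeight ρ]
    (hρ : ContDiffOn ℝ ∞ ρ {0}ᶜ) {s : Set puncturedPlane} (hs : MeasurableSet s) :
    (conformalMetric ρ (AdmissibleWeight.one_le ρ) hρ).riemVolume s =
      WeightedPlane.density ρ (Subtype.val '' s) := by
  have hm : MeasurableSet (puncturedPlane : Set Plane) := puncturedPlane.isOpen.measurableSet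
  have hms : MeasurableSet (Subtype.val '' s : Set Plane) := hm.subtype_image hs
  rw [PuncturedPlaneMetric.riemVolume, withDensity_apply _ hs, WeightedPlane.density,
    withDensity_apply _ hms]
  refine Eq.trans ?_ (setLIntegral_subtype hm s _)
  refine setLIntegral_congr_fun hs fun x _ => ?_
  congr 1
  simp only [conformalMetric_form, EuclideanSpace.inner_single_left, Matrix.det_fin_two,
    Matrix.of_apply]
  have h := AdmissibleWeight.pos ρ (x : Plane)
  simp only [map_one, PiLp.single_apply, if_true, mul_one, one_ne_zero,
    zero_ne_one, if_false, mul_zero, sub_zero]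
  exact Real.sqrt_mul_self (by positivity)

theorem WeightedPlane.measure_image_puncturedPlane (ρ : Plane → ℝ) [AdmissibleWeight ρ]
    (hρ : ContDiffOn ℝ ∞ ρ {0}ᶜ) {s : Set puncturedPlane} (hs : MeasurableSet s) :
    (μHE[2] : Measure (WeightedPlane ρ))
      ((fun x : puncturedPlane => (toPlane ρ).symm (x : Plane)) '' s) =
      (conformalMetric ρ (AdmissibleWeight.one_le ρ) hρ).riemVolume s := by
  have hm : MeasurableSet (puncturedPlane : Set Plane) := puncturedPlane.isOpen.measurableSet
  rw [riemVolume_conformalMetric ρ hρ hs]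
  refine (congrArg (μHE[2] : Measure (WeightedPlane ρ)) ?_).trans
    (measure_preimage_eq_density ρ (hm.subtype_image hs))
  ext y
  constructor
  · rintro ⟨x, hx, rfl⟩
    exact ⟨x, hx, by simp⟩
  · rintro ⟨x, hx, h⟩
    exact ⟨x, hx, by simp [h]⟩

/-! ### The profiles and the Whitney weight -/

/-- A smooth cutoff of the unit interval: it vanishes within distance `2^{-(n+3)}` of the endpoints
and outside of the interval, and equals `1` at distance at least `2^{-(n+2)}` of them. -/
noncomputable def gridBump (n : ℕ) (t : ℝ) : ℝ :=
  Real.smoothTransition (2 ^ (n + 3) * t - 1) * Real.smoothTransition (2 ^ (n + 3) * (1 - t) - 1)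

theorem gridBump_contDiff (n : ℕ) : ContDiff ℝ ∞ (gridBump n) := by
  unfold gridBump; fun_prop

theorem gridBump_mem_Icc (n : ℕ) (t : ℝ) : gridBump n t ∈ Icc (0 : ℝ) 1 :=
  ⟨mul_nonneg (Real.smoothTransition.nonneg _) (Real.smoothTransition.nonneg _),
    mul_le_one₀ (Real.smoothTransition.le_one _) (Real.smoothTransition.nonneg _)
      (Real.smoothTransition.le_one _)⟩

theorem two_pow_mul_half_pow (n : ℕ) : (2 : ℝ) ^ n * (1 / 2) ^ n = 1 := by
  rw [← mul_pow]; norm_num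

theorem gridBump_eq_zero_of_le {n : ℕ} {t : ℝ} (ht : t ≤ (1 / 2) ^ (n + 3)) :
    gridBump n t = 0 := by
  have h : (2 : ℝ) ^ (n + 3) * t ≤ 1 := (mul_le_mul_of_nonneg_left ht (by positivity)).trans_eq
    (two_pow_mul_half_pow _)
  rw [gridBump, Real.smoothTransition.zero_of_nonpos (by linarith), zero_mul]

theorem gridBump_eq_zero_of_ge {n : ℕ} {t : ℝ} (ht : 1 - (1 / 2) ^ (n + 3) ≤ t) :
    gridBump n t = 0 := by
  have h : (2 : ℝ) ^ (n + 3) * (1 - t) ≤ 1 :=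
    (mul_le_mul_of_nonneg_left (by linarith) (by positivity)).trans_eq (two_pow_mul_half_pow _)
  rw [gridBump, Real.smoothTransition.zero_of_nonpos (x := 2 ^ (n + 3) * (1 - t) - 1)
    (by linarith), mul_zero]

theorem gridBump_eq_one {n : ℕ} {t : ℝ}
    (ht : t ∈ Icc ((1 / 2 : ℝ) ^ (n + 2)) (1 - (1 / 2 : ℝ) ^ (n + 2))) : gridBump n t = 1 := by
  have h : ∀ s : ℝ, (1 / 2) ^ (n + 2) ≤ s → 1 ≤ 2 ^ (n + 3) * s - 1 := by
    intro s hs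
    have h1 : (2 : ℝ) ^ (n + 3) * (1 / 2) ^ (n + 2) ≤ 2 ^ (n + 3) * s :=
      mul_le_mul_of_nonneg_left hs (by positivity)
    have h2 : (2 : ℝ) ^ (n + 3) * (1 / 2) ^ (n + 2) = 2 := by
      rw [pow_succ, mul_right_comm, two_pow_mul_half_pow, one_mul]
    linarith
  rw [gridBump, Real.smoothTransition.one_of_one_le (h _ ht.1),
    Real.smoothTransition.one_of_one_le (h _ (by linarith [ht.2])), mul_one]

theorem gridBump_le_succ (n : ℕ) (t : ℝ) : gridBump n t ≤ gridBump (n + 1) t := by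
  -- Enlarging the factor `2 ^ (n + 3)` increases both arguments only when `t ≥ 0` and `1 - t ≥ 0`.
  -- Outside `[0, 1]` the left side vanishes.
  rcases lt_or_ge t 0 with h0 | h0
  · rw [gridBump_eq_zero_of_le (h0.le.trans (by positivity))]
    exact (gridBump_mem_Icc _ _).1
  rcases lt_or_ge 1 t with h1 | h1
  · rw [gridBump_eq_zero_of_ge]
    · exact (gridBump_mem_Icc _ _).1
    · have : (0 : ℝ) < (1 / 2) ^ (n + 3) := by positivity
      linarith
  have hp : (2 : ℝ) ^ (n + 3) ≤ 2 ^ (n + 1 + 3) := pow_le_pow_right₀ one_le_two (by omega)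
  refine mul_le_mul (Real.smoothTransition.monotone ?_) (Real.smoothTransition.monotone ?_)
    (Real.smoothTransition.nonneg _) (Real.smoothTransition.nonneg _)
  · exact sub_le_sub_right (mul_le_mul_of_nonneg_right hp h0) _
  · exact sub_le_sub_right (mul_le_mul_of_nonneg_right hp (by linarith)) _

/-- The profiles on the unit square. -/
noncomputable def profile (n : ℕ) (x : Plane) : ℝ := 1 + gridBump n (x 0) * gridBump n (x 1)

theorem one_add_mul_mem_Icc {a b : ℝ} (ha : a ∈ Icc (0 : ℝ) 1) (hb : b ∈ Icc (0 : ℝ) 1) :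
    1 + a * b ∈ Icc (1 : ℝ) 2 := by
  have h0 := mul_nonneg ha.1 hb.1
  have h1 := mul_le_one₀ ha.2 hb.1 hb.2
  constructor <;> linarith

theorem isProfileSequence_profile : IsProfileSequence profile where
  smooth n := by
    have := gridBump_contDiff n
    unfold profile
    exact ContDiff.contDiffOn (by fun_prop)
  mem_Icc n x _ := one_add_mul_mem_Icc (gridBump_mem_Icc _ _) (gridBump_mem_Icc _ _)
  eq_one n := by
    rw [eventually_nhdsSet_iff_forall]
    intro x hx
    have h : ∃ i, x i ∉ Ioo (0 : ℝ) 1 := by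
      by_contra! h
      have ho : IsOpen {x : Plane | ∀ i, x i ∈ Ioo (0 : ℝ) 1} := by
        have : {x : Plane | ∀ i, x i ∈ Ioo (0 : ℝ) 1} =
            ⋂ i, (fun x : Plane => x i) ⁻¹' Ioo (0 : ℝ) 1 := by ext; simp
        rw [this]
        exact isOpen_iInter_of_finite fun i => isOpen_Ioo.preimage (by fun_prop)
      exact hx.2 (mem_interior.2 ⟨{x : Plane | ∀ i, x i ∈ Ioo (0 : ℝ) 1},
        fun y (hy : ∀ i, y i ∈ Ioo (0 : ℝ) 1) i => Ioo_subset_Icc_self (hy i), ho, h⟩)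
    obtain ⟨i, hi⟩ := h
    have hc : ContinuousAt (fun y : Plane => y i) x := by fun_prop
    have hp : (0 : ℝ) < (1 / 2) ^ (n + 3) := by positivity
    have key : ∀ᶠ y in 𝓝 x, gridBump n (y i) = 0 := by
      rcases le_or_gt (x i) 0 with h0 | h0
      · filter_upwards [hc.eventually_lt_const (h0.trans_lt hp)] with y hy
        exact gridBump_eq_zero_of_le hy.le
      · have h1 : 1 ≤ x i := not_lt.1 fun h1 => hi ⟨h0, h1⟩
        filter_upwards [hc.eventually_const_lt
          (show 1 - (1 / 2 : ℝ) ^ (n + 3) < x i by linarith)] with y hy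
        exact gridBump_eq_zero_of_ge hy.le
    filter_upwards [key] with y hy
    fin_cases i <;> simp_all [profile]
  eq_two n x hx := by
    rw [profile, gridBump_eq_one (hx 0), gridBump_eq_one (hx 1)]; norm_num
  mono n x _ := by
    have := mul_le_mul (gridBump_le_succ n (x 0)) (gridBump_le_succ n (x 1))
      (gridBump_mem_Icc _ _).1 (gridBump_mem_Icc _ _).1
    unfold profile
    linarith

/-- The periodic extension of `gridBump n`. -/
noncomputable def periodicBump (n : ℕ) (t : ℝ) : ℝ := gridBump n (Int.fract t)

theorem periodicBump_mem_Icc (n : ℕ) (t : ℝ) : periodicBump n t ∈ Icc (0 : ℝ) 1 :=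
  gridBump_mem_Icc _ _

/-- The interval starts slightly to the left of `m`, where both sides vanish. One smooth formula
thus holds on a neighbourhood of every real number, integers included, although `Int.fract` jumps
there. -/
theorem periodicBump_eq_of_mem {n : ℕ} {m : ℤ} {t : ℝ}
    (ht : t ∈ Ioo (m - (1 / 2 : ℝ) ^ (n + 3)) (m + 1)) :
    periodicBump n t = gridBump n (t - m) := by
  rcases lt_or_ge t m with h | h
  · have h1 : (1 / 2 : ℝ) ^ (n + 3) ≤ 1 := pow_le_one₀ (by norm_num) (by norm_num)
    have hf : Int.fract t = t - m + 1 := by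
      rw [Int.fract_eq_iff]
      refine ⟨by linarith [ht.1], by linarith, m - 1, by push_cast; ring⟩
    rw [periodicBump, hf, gridBump_eq_zero_of_ge (by linarith [ht.1]),
      gridBump_eq_zero_of_le ((sub_neg.2 h).le.trans (by positivity))]
  · have hf : Int.fract t = t - m := by
      rw [Int.fract_eq_iff]
      exact ⟨by linarith, by linarith [ht.2], m, by ring⟩
    rw [periodicBump, hf]

theorem periodicBump_contDiff (n : ℕ) : ContDiff ℝ ∞ (periodicBump n) := by
  rw [contDiff_iff_contDiffAt]
  intro t
  have hp : (0 : ℝ) < (1 / 2) ^ (n + 3) := by positivity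
  have hmem : t ∈ Ioo (⌊t⌋ - (1 / 2 : ℝ) ^ (n + 3)) (⌊t⌋ + 1) :=
    ⟨by linarith [Int.floor_le t], Int.lt_floor_add_one t⟩
  have h : periodicBump n =ᶠ[𝓝 t] fun s => gridBump n (s - ⌊t⌋) := by
    filter_upwards [Ioo_mem_nhds hmem.1 hmem.2] with s hs
    exact periodicBump_eq_of_mem hs
  refine ContDiffAt.congr_of_eventuallyEq ?_ h
  have := gridBump_contDiff n
  exact ContDiff.contDiffAt (by fun_prop)

theorem periodicBump_eq_zero {n : ℕ} {m : ℤ} {t : ℝ} (ht : |t - m| < (1 / 2 : ℝ) ^ (n + 3)) :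
    periodicBump n t = 0 := by
  have h1 : (1 / 2 : ℝ) ^ (n + 3) ≤ 1 := pow_le_one₀ (by norm_num) (by norm_num)
  rw [abs_lt] at ht
  rw [periodicBump_eq_of_mem (m := m) ⟨by linarith, by linarith⟩]
  exact gridBump_eq_zero_of_le (by linarith)

theorem periodicBump_eq_one {n : ℕ} {t : ℝ} (ht : ∀ m : ℤ, (1 / 2 : ℝ) ^ (n + 2) ≤ |t - m|) :
    periodicBump n t = 1 := by
  refine gridBump_eq_one ⟨?_, ?_⟩
  · have := ht ⌊t⌋
    rwa [Int.self_sub_floor, abs_of_nonneg (Int.fract_nonneg t)] at this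
  · have := ht (⌊t⌋ + 1)
    rw [Int.cast_add, Int.cast_one, ← sub_sub, Int.self_sub_floor,
      abs_of_neg (by linarith [Int.fract_lt_one t])] at this
    linarith

/-- The mesh of the grid in the annulus `2^K < |x|_∞ < 2^(K+1)`. -/
noncomputable def mesh (K : ℤ) : ℝ := 2 ^ (K + min K 0)

theorem mesh_pos (K : ℤ) : 0 < mesh K := by unfold mesh; positivity

/-- The index of the profile used in the annulus `2^K < |x|_∞ < 2^(K+1)`. -/
def level (n : ℕ → ℕ) (K : ℤ) : ℕ := if K < 0 then n (-K - 1).toNat else 0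

/-- The periodic weight which agrees with the Whitney weight in the annulus
`2^K < |x|_∞ < 2^(K+1)`. -/
noncomputable def annulusWeight (n : ℕ → ℕ) (K : ℤ) (x : Plane) : ℝ :=
  1 + periodicBump (level n K) (x 0 / mesh K) * periodicBump (level n K) (x 1 / mesh K)

theorem annulusWeight_mem_Icc (n : ℕ → ℕ) (K : ℤ) (x : Plane) :
    annulusWeight n K x ∈ Icc (1 : ℝ) 2 :=
  one_add_mul_mem_Icc (periodicBump_mem_Icc _ _) (periodicBump_mem_Icc _ _)

theorem annulusWeight_contDiff (n : ℕ → ℕ) (K : ℤ) : ContDiff ℝ ∞ (annulusWeight n K) := by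
  have := periodicBump_contDiff (level n K)
  unfold annulusWeight
  fun_prop

theorem annulusWeight_eventually_eq_one {n : ℕ → ℕ} {K : ℤ} {x : Plane} {i : Fin 2} {m : ℤ}
    (h : x i / mesh K = m) : ∀ᶠ y in 𝓝 x, annulusWeight n K y = 1 := by
  have hc : ContinuousAt (fun y : Plane => |y i / mesh K - m|) x := by fun_prop
  have h0 : |x i / mesh K - m| < (1 / 2 : ℝ) ^ (level n K + 3) := by
    rw [h, sub_self, abs_zero]; positivity
  filter_upwards [hc.eventually_lt_const h0] with y hy
  have := periodicBump_eq_zero hy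
  fin_cases i <;> simp_all [annulusWeight]

theorem annulusWeight_eq_one {n : ℕ → ℕ} {K : ℤ} {x : Plane} {i : Fin 2} {m : ℤ}
    (h : x i / mesh K = m) : annulusWeight n K x = 1 :=
  (annulusWeight_eventually_eq_one h).self_of_nhds

/-- The supremum norm on the plane. -/
def supNorm (x : Plane) : ℝ := max |x 0| |x 1|

theorem continuous_supNorm : Continuous supNorm := by unfold supNorm; fun_prop

theorem supNorm_pos {x : Plane} (hx : x ≠ 0) : 0 < supNorm x := by
  by_contra! h
  have h0 : |x 0| ≤ 0 := (le_max_left _ _).trans h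
  have h1 : |x 1| ≤ 0 := (le_max_right _ _).trans h
  refine hx (PiLp.ext fun i => ?_)
  fin_cases i
  · simpa using h0
  · simpa using h1

theorem mem_centralSquare_iff {k : ℕ} {x : Plane} :
    x ∈ centralSquare k ↔ supNorm x ≤ (1 / 2 : ℝ) ^ k := max_le_iff.symm

/-- The index `K` of the annulus `2^K < |x|_∞ ≤ 2^(K+1)` containing `x`. -/
noncomputable def annulusIndex (x : Plane) : ℤ := Int.clog 2 (supNorm x) - 1

theorem annulusIndex_spec {x : Plane} (hx : x ≠ 0) :
    (2 : ℝ) ^ annulusIndex x < supNorm x ∧ supNorm x ≤ 2 ^ (annulusIndex x + 1) := by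
  constructor
  · exact_mod_cast Int.zpow_pred_clog_lt_self one_lt_two (supNorm_pos hx)
  · have := Int.self_le_zpow_clog (one_lt_two (α := ℕ)) (supNorm x)
    rw [annulusIndex, sub_add_cancel]
    exact_mod_cast this

theorem annulusIndex_eq {x : Plane} {K : ℤ} (h1 : (2 : ℝ) ^ K < supNorm x)
    (h2 : supNorm x ≤ 2 ^ (K + 1)) : annulusIndex x = K := by
  have hx : x ≠ 0 := by
    rintro rfl
    have : (0 : ℝ) < 2 ^ K := by positivity
    simp [supNorm] at h1
    linarith
  obtain ⟨h3, h4⟩ := annulusIndex_spec hx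
  have a1 := (zpow_lt_zpow_iff_right₀ (one_lt_two (α := ℝ))).1 (h1.trans_le h4)
  have a2 := (zpow_lt_zpow_iff_right₀ (one_lt_two (α := ℝ))).1 (h3.trans_le h2)
  omega

open Classical in
/-- The weight built on the Whitney decomposition of the punctured plane. -/
noncomputable def whitneyWeight (n : ℕ → ℕ) (x : Plane) : ℝ :=
  if x = 0 then 1 else annulusWeight n (annulusIndex x) x

theorem whitneyWeight_mem_Icc (n : ℕ → ℕ) (x : Plane) : whitneyWeight n x ∈ Icc (1 : ℝ) 2 := by
  unfold whitneyWeight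
  split_ifs
  · norm_num
  · exact annulusWeight_mem_Icc _ _ _

theorem whitneyWeight_of_ne {n : ℕ → ℕ} {x : Plane} (hx : x ≠ 0) :
    whitneyWeight n x = annulusWeight n (annulusIndex x) x := if_neg hx

theorem whitneyWeight_eq {n : ℕ → ℕ} {x : Plane} {K : ℤ} (h1 : (2 : ℝ) ^ K < supNorm x)
    (h2 : supNorm x ≤ 2 ^ (K + 1)) : whitneyWeight n x = annulusWeight n K x := by
  have hx : x ≠ 0 := by
    rintro rfl
    have : (0 : ℝ) < 2 ^ K := by positivity
    simp [supNorm] at h1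
    linarith
  rw [whitneyWeight_of_ne hx, annulusIndex_eq h1 h2]

theorem two_zpow_eq_mul_mesh (K : ℤ) : (2 : ℝ) ^ K = 2 ^ (-min K 0).toNat * mesh K := by
  rw [mesh, ← zpow_natCast, ← zpow_add₀ two_ne_zero]
  congr 1
  omega

theorem two_zpow_succ_div_mesh (K : ℤ) : ∃ m : ℤ, (2 : ℝ) ^ (K + 1) / mesh K = m := by
  refine ⟨2 ^ (-min K 0).toNat * 2, ?_⟩
  rw [zpow_add_one₀ two_ne_zero, two_zpow_eq_mul_mesh]
  have := mesh_pos K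
  push_cast
  field_simp

theorem two_zpow_div_mesh (K : ℤ) : ∃ m : ℤ, (2 : ℝ) ^ K / mesh K = m := by
  refine ⟨2 ^ (-min K 0).toNat, ?_⟩
  rw [two_zpow_eq_mul_mesh]
  have := mesh_pos K
  push_cast
  field_simp

/-- Inside an annulus the weight is a smooth periodic function. The square separating two annuli
consists of grid lines for both meshes, so near each of its points both formulas give the constant
`1`. -/
theorem whitneyWeight_contDiffOn (n : ℕ → ℕ) : ContDiffOn ℝ ∞ (whitneyWeight n) {0}ᶜ := by
  intro x hx
  refine ContDiffAt.contDiffWithinAt ?_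
  obtain ⟨h1, h2⟩ := annulusIndex_spec hx
  set K := annulusIndex x
  have e1 := continuous_supNorm.continuousAt.eventually_const_lt h1
  rcases h2.lt_or_eq with h2 | h2
  · have e2 := continuous_supNorm.continuousAt.eventually_lt_const h2
    refine (annulusWeight_contDiff n K).contDiffAt.congr_of_eventuallyEq ?_
    filter_upwards [e1, e2] with y hy1 hy2
    exact whitneyWeight_eq hy1 hy2.le
  · have e2 := continuous_supNorm.continuousAt.eventually_lt_const
      (h2.trans_lt (zpow_lt_zpow_right₀ (one_lt_two (α := ℝ)) (by omega : K + 1 < K + 1 + 1)))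
    have hi : ∃ i, |x i| = 2 ^ (K + 1) := by
      rcases max_choice |x 0| |x 1| with h | h
      · exact ⟨0, h.symm.trans h2⟩
      · exact ⟨1, h.symm.trans h2⟩
    obtain ⟨i, hi⟩ := hi
    have hint : ∀ L : ℤ, (∃ m : ℤ, (2 : ℝ) ^ (K + 1) / mesh L = m) →
        ∃ m : ℤ, x i / mesh L = m := by
      rintro L ⟨m, hm⟩
      rcases abs_choice (x i) with h | h
      · exact ⟨m, by rw [← hm, ← hi, h]⟩
      · exact ⟨-m, by rw [Int.cast_neg, ← hm, ← hi, h, neg_div, neg_neg]⟩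
    obtain ⟨m, hm⟩ := hint K (two_zpow_succ_div_mesh K)
    obtain ⟨m', hm'⟩ := hint (K + 1) (two_zpow_div_mesh (K + 1))
    refine (contDiffAt_const (c := (1 : ℝ))).congr_of_eventuallyEq ?_
    filter_upwards [e1, e2, annulusWeight_eventually_eq_one (n := n) hm,
      annulusWeight_eventually_eq_one (n := n) hm'] with y hy1 hy2 hy3 hy4
    rcases le_or_gt (supNorm y) (2 ^ (K + 1)) with h | h
    · rw [whitneyWeight_eq hy1 h, hy3]
    · rw [whitneyWeight_eq h hy2.le, hy4]

instance (n : ℕ → ℕ) : AdmissibleWeight (whitneyWeight n) where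
  mem_Icc := whitneyWeight_mem_Icc n
  continuousOn := (whitneyWeight_contDiffOn n).continuousOn

theorem supNorm_mem_of_mem_whitneySquare {Q : DyadicSquare} (hQ : Q ∈ whitneySquares) {x : Plane}
    (hx : x ∈ Q.toSet) : (2 : ℝ) ^ Q.k < supNorm x ∧ supNorm x < 2 ^ (Q.k + 1) := by
  obtain ⟨k, i, j⟩ := Q
  have hp : (0 : ℝ) < 2 ^ k := by positivity
  obtain ⟨⟨a1, a2⟩, b1, b2⟩ := hx
  rw [whitneySquares, mem_ofPred_eq, whitneyPositions] at hQ
  simp only at hQ a1 a2 b1 b2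
  have e : (2 : ℝ) ^ (k + 1) = 2 * 2 ^ k := by rw [zpow_add_one₀ two_ne_zero, mul_comm]
  simp only [supNorm]
  rw [e, lt_max_iff, max_lt_iff, abs_lt, abs_lt, lt_abs, lt_abs]
  simp only [Finset.mem_insert, Finset.mem_singleton, Prod.mk.injEq] at hQ
  rcases hQ with ⟨rfl, rfl⟩ | ⟨rfl, rfl⟩ | ⟨rfl, rfl⟩ | ⟨rfl, rfl⟩ | ⟨rfl, rfl⟩ | ⟨rfl, rfl⟩ |
    ⟨rfl, rfl⟩ | ⟨rfl, rfl⟩ | ⟨rfl, rfl⟩ | ⟨rfl, rfl⟩ | ⟨rfl, rfl⟩ | ⟨rfl, rfl⟩ <;>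
    push_cast at a1 a2 b1 b2 <;>
    refine ⟨?_, ⟨by linarith, by linarith⟩, by linarith, by linarith⟩ <;>
    first
      | exact Or.inl (Or.inl (by linarith))
      | exact Or.inl (Or.inr (by linarith))
      | exact Or.inr (Or.inl (by linarith))
      | exact Or.inr (Or.inr (by linarith))

theorem mem_whitneyPositions {i j : ℤ} (hi : -2 ≤ i) (hi' : i ≤ 1) (hj : -2 ≤ j) (hj' : j ≤ 1)
    (h : ¬ ((i = -1 ∨ i = 0) ∧ (j = -1 ∨ j = 0))) : (i, j) ∈ whitneyPositions := by
  interval_cases i <;> interval_cases j <;> simp_all [whitneyPositions]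

theorem annulusWeight_eq_profile {n : ℕ → ℕ} {K : ℤ} {Q : DyadicSquare}
    (hQ : Q.k = K + min K 0) {x : Plane} (hx : x ∈ Q.toSet) :
    annulusWeight n K x = profile (level n K) (Q.unitCoord x) := by
  have hm : (2 : ℝ) ^ Q.k = mesh K := by rw [hQ, mesh]
  have hp := mesh_pos K
  have hfract : ∀ (i : ℤ) (t : ℝ), t ∈ Ioo (i * mesh K) ((i + 1) * mesh K) →
      Int.fract (t / mesh K) = (t - i * mesh K) / mesh K := by
    intro i t ht
    rw [Int.fract_eq_iff, le_div_iff₀ hp, div_lt_one hp, zero_mul]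
    refine ⟨by linarith [ht.1], by linarith [ht.2], i, ?_⟩
    field_simp
    ring
  obtain ⟨h0, h1⟩ := hx
  rw [hm] at h0 h1
  rw [annulusWeight, profile, periodicBump, periodicBump, hfract _ _ h0, hfract _ _ h1]
  simp [DyadicSquare.unitCoord, hm]

theorem isWhitneyWeight_whitneyWeight (n : ℕ → ℕ) :
    IsWhitneyWeight profile n (whitneyWeight n) where
  on_grid x hx := by
    by_cases h0 : x = 0
    · rw [h0, whitneyWeight, if_pos rfl]
    rw [whitneyWeight_of_ne h0]
    obtain ⟨h1, h2⟩ := annulusIndex_spec h0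
    set K := annulusIndex x
    -- A weight different from `1` forces both coordinates off the grid of the annulus; the open
    -- mesh cell of `x` is then shown to belong to `S`.
    by_contra hne
    have hni : ∀ (i : Fin 2) (m : ℤ), x i / mesh K ≠ m := fun i m h => hne (annulusWeight_eq_one h)
    have hp := mesh_pos K
    have h2p : (0 : ℝ) < 2 ^ K := by positivity
    -- The number of mesh cells along a side of a Whitney square. Being an integer, it makes each
    -- cell fit inside a single dyadic square of side `2 ^ K`.
    let q : ℤ := 2 ^ (-min K 0).toNat
    have hq : (2 : ℝ) ^ K = q * mesh K := by
      rw [two_zpow_eq_mul_mesh]; simp [q]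
    have hcell : ∀ i, x i ∈ Ioo ((⌊x i / mesh K⌋ : ℝ) * mesh K)
        ((⌊x i / mesh K⌋ + 1 : ℝ) * mesh K) := by
      intro i
      constructor
      · rw [← lt_div_iff₀ hp]
        exact lt_of_le_of_ne (Int.floor_le _) (hni i _).symm
      · rw [← div_lt_iff₀ hp]
        exact Int.lt_floor_add_one _
    have hsub : ∀ i, Ioo ((⌊x i / mesh K⌋ : ℝ) * mesh K) ((⌊x i / mesh K⌋ + 1 : ℝ) * mesh K) ⊆
        Ioo ((⌊x i / 2 ^ K⌋ : ℝ) * 2 ^ K) ((⌊x i / 2 ^ K⌋ + 1 : ℝ) * 2 ^ K) := by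
      intro i
      have a1 : ⌊x i / 2 ^ K⌋ * q ≤ ⌊x i / mesh K⌋ := by
        rw [Int.le_floor]
        push_cast
        rw [le_div_iff₀ hp, mul_assoc, ← hq, ← le_div_iff₀ h2p]
        exact Int.floor_le _
      have a2 : ⌊x i / mesh K⌋ + 1 ≤ (⌊x i / 2 ^ K⌋ + 1) * q := by
        rw [Int.add_one_le_iff, Int.floor_lt]
        push_cast
        rw [div_lt_iff₀ hp, mul_assoc, ← hq, ← div_lt_iff₀ h2p]
        exact Int.lt_floor_add_one _
      generalize ⌊x i / 2 ^ K⌋ = F at a1 a2 ⊢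
      rw [hq, ← mul_assoc, ← mul_assoc]
      exact Ioo_subset_Ioo (mul_le_mul_of_nonneg_right (by exact_mod_cast a1) hp.le)
        (mul_le_mul_of_nonneg_right (by exact_mod_cast a2) hp.le)
    refine hx ⟨K + min K 0, ⌊x 0 / mesh K⌋, ⌊x 1 / mesh K⌋⟩
      ⟨⟨K, ⌊x 0 / 2 ^ K⌋, ⌊x 1 / 2 ^ K⌋⟩, ?_, ?_, rfl⟩ ⟨hcell 0, hcell 1⟩
    · have hr : ∀ i, -2 ≤ ⌊x i / 2 ^ K⌋ ∧ ⌊x i / 2 ^ K⌋ ≤ 1 := by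
        intro i
        have hi : |x i| ≤ 2 * 2 ^ K := by
          rw [mul_comm, ← zpow_add_one₀ two_ne_zero]
          refine le_trans ?_ h2
          fin_cases i
          · exact le_max_left _ _
          · exact le_max_right _ _
        rw [abs_le] at hi
        obtain ⟨c1, c2⟩ := hsub i (hcell i)
        constructor
        · rw [Int.le_floor, le_div_iff₀ h2p]
          push_cast
          linarith
        · have : (⌊x i / 2 ^ K⌋ : ℝ) < 2 := by
            have := c1.trans_le hi.2
            exact lt_of_mul_lt_mul_right this h2p.le
          have : ⌊x i / 2 ^ K⌋ < 2 := by exact_mod_cast this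
          omega
      -- The positions excluded from `W` fill the inner square `|x|_∞ ≤ 2 ^ K`, which `x` is outside
      -- of.
      have hm : ∀ i, ⌊x i / 2 ^ K⌋ = -1 ∨ ⌊x i / 2 ^ K⌋ = 0 → |x i| ≤ 2 ^ K := by
        intro i hi
        obtain ⟨c1, c2⟩ := hsub i (hcell i)
        rw [abs_le]
        rcases hi with h | h <;> rw [h] at c1 c2 <;> push_cast at c1 c2 <;>
          constructor <;> linarith
      have hor : ¬ ((⌊x 0 / 2 ^ K⌋ = -1 ∨ ⌊x 0 / 2 ^ K⌋ = 0) ∧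
          (⌊x 1 / 2 ^ K⌋ = -1 ∨ ⌊x 1 / 2 ^ K⌋ = 0)) := fun h =>
        absurd h1 (not_lt.2 (max_le (hm 0 h.1) (hm 1 h.2)))
      obtain ⟨a1, a2⟩ := hr 0
      obtain ⟨b1, b2⟩ := hr 1
      exact mem_whitneyPositions a1 a2 b1 b2 hor
    · exact fun y hy => ⟨hsub 0 hy.1, hsub 1 hy.2⟩
  on_inner Q := by
    rintro ⟨P, hP, hsub, hk⟩ k h1 h2 x hx
    obtain ⟨a1, a2⟩ := supNorm_mem_of_mem_whitneySquare hP (hsub hx)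
    obtain ⟨y, hy, hy'⟩ := not_subset.1 h2
    obtain ⟨b1, b2⟩ := supNorm_mem_of_mem_whitneySquare hP (hsub hy)
    rw [mem_centralSquare_iff, not_le] at hy'
    have hx' := mem_centralSquare_iff.1 (h1 hx)
    have e : ∀ j : ℕ, (1 / 2 : ℝ) ^ j = 2 ^ (-(j : ℤ)) := fun j => by
      rw [zpow_neg, zpow_natCast, one_div, inv_pow]
    rw [e] at hx' hy'
    have c1 := (zpow_lt_zpow_iff_right₀ (one_lt_two (α := ℝ))).1 (a1.trans_le hx')
    have c2 := (zpow_lt_zpow_iff_right₀ (one_lt_two (α := ℝ))).1 (hy'.trans b2)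
    -- `c1` and `c2` leave only `P.k = -k - 1`, for which `level` returns `n k`.
    rw [whitneyWeight_eq a1 a2.le, annulusWeight_eq_profile hk hx, level, if_pos (by omega)]
    congr 2
    push_cast at c2
    omega
  on_outer Q := by
    rintro ⟨P, hP, hsub, hk⟩ h2 x hx
    obtain ⟨a1, a2⟩ := supNorm_mem_of_mem_whitneySquare hP (hsub hx)
    obtain ⟨y, hy, hy'⟩ := not_subset.1 h2
    obtain ⟨b1, b2⟩ := supNorm_mem_of_mem_whitneySquare hP (hsub hy)
    rw [mem_centralSquare_iff, not_le, pow_zero, ← zpow_zero (2 : ℝ)] at hy'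
    have c2 := (zpow_lt_zpow_iff_right₀ (one_lt_two (α := ℝ))).1 (hy'.trans b2)
    rw [whitneyWeight_eq a1 a2.le, annulusWeight_eq_profile hk hx, level, if_neg (by omega)]

/-! ### Grid strips and the lower bound by the ℓ¹-distance -/

theorem two_zpow_neg_nat (j : ℕ) : (2 : ℝ) ^ (-(j : ℤ)) = (1 / 2) ^ j := by
  rw [zpow_neg, zpow_natCast, one_div, inv_pow]

theorem mesh_neg_succ (j : ℕ) : mesh (-(j : ℤ) - 1) = (4 ^ (j + 1))⁻¹ := by
  have : -(j : ℤ) - 1 + min (-(j : ℤ) - 1) 0 = -((2 * (j + 1) : ℕ) : ℤ) := by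
    push_cast; omega
  rw [mesh, this, zpow_neg, zpow_natCast, pow_mul]
  norm_num

theorem whitneyWeight_eq_of_supNorm {n : ℕ → ℕ} {x : Plane} {j : ℕ}
    (h1 : (1 / 2 : ℝ) ^ (j + 1) < supNorm x) (h2 : supNorm x ≤ (1 / 2 : ℝ) ^ j) :
    whitneyWeight n x =
      1 + periodicBump (n j) (4 ^ (j + 1) * x 0) * periodicBump (n j) (4 ^ (j + 1) * x 1) := by
  have e : -(j : ℤ) - 1 = -((j + 1 : ℕ) : ℤ) := by push_cast; ring
  have hK : level n (-(j : ℤ) - 1) = n j := by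
    rw [level, if_pos (by omega)]
    congr 1
    omega
  rw [whitneyWeight_eq (K := -(j : ℤ) - 1), annulusWeight, hK, mesh_neg_succ, div_inv_eq_mul,
    div_inv_eq_mul, mul_comm (x 0), mul_comm (x 1)]
  · rwa [e, two_zpow_neg_nat]
  · rwa [sub_add_cancel, two_zpow_neg_nat]

theorem exists_half_pow_lt_le {k : ℕ} {r : ℝ} (h0 : 0 < r) (hr : r ≤ (1 / 2 : ℝ) ^ k) :
    ∃ j, k ≤ j ∧ (1 / 2 : ℝ) ^ (j + 1) < r ∧ r ≤ (1 / 2 : ℝ) ^ j := by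
  obtain ⟨j, hj1, hj2⟩ := exists_nat_pow_near_of_lt_one h0
    (hr.trans (pow_le_one₀ (by norm_num) (by norm_num))) (y := (1 / 2 : ℝ)) (by norm_num)
    (by norm_num)
  refine ⟨j, ?_, hj1, hj2⟩
  have := (pow_lt_pow_iff_right_of_lt_one₀ (by norm_num : (0 : ℝ) < 1 / 2)
    (by norm_num)).1 (hj1.trans_le hr)
  omega

/-- The weight used for the tangent cone computation. -/
noncomputable abbrev whitneyWeight₀ : Plane → ℝ := whitneyWeight fun j => j + 5

/-- The neighbourhood of the `j`-th grid outside of which the `j`-th profile equals `2`. -/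
def gridStrip (j : ℕ) : Set ℝ :=
  {t | |t| < 2 * (1 / 2 : ℝ) ^ j ∧ ∃ m : ℤ, |4 ^ (j + 1) * t - m| < (1 / 2 : ℝ) ^ (j + 7)}

theorem isOpen_gridStrip (j : ℕ) : IsOpen (gridStrip j) := by
  have : gridStrip j = {t | |t| < 2 * (1 / 2 : ℝ) ^ j} ∩
      ⋃ m : ℤ, {t : ℝ | |4 ^ (j + 1) * t - m| < (1 / 2 : ℝ) ^ (j + 7)} := by
    ext; simp [gridStrip]
  rw [this]
  exact (isOpen_lt (by fun_prop) continuous_const).inter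
    (isOpen_iUnion fun m => isOpen_lt (by fun_prop) continuous_const)

/-- There are at most `19 · 2^j` lines, each with a neighbourhood of length `2 · 2^{-(j+7)} /
4^{j+1}`. The growth of `n(j) = j + 5` compensates the number of lines, so the total is a multiple
of `4^{-j}`. The bound `3/8` is chosen so that the sum over `j ≥ k` is `4^{-k}/2`. -/
theorem volume_gridStrip_le (j : ℕ) :
    volume (gridStrip j) ≤ ENNReal.ofReal (3 / 8 * (1 / 4 : ℝ) ^ j) := by
  -- From `|t| < 2 · 2^{-j}` follows `|4^{j+1} t| < 8 · 2^j`; the extra `1` absorbs the distance to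
  -- the integer `m`.
  let M : ℕ := 8 * 2 ^ j + 1
  have hpos : (0 : ℝ) < 4 ^ (j + 1) := by positivity
  have hsub : gridStrip j ⊆ ⋃ m ∈ Finset.Icc (-(M : ℤ)) M,
      ball ((m : ℝ) / 4 ^ (j + 1)) ((1 / 2 : ℝ) ^ (j + 7) / 4 ^ (j + 1)) := by
    rintro t ⟨ht, m, hm⟩
    simp only [mem_iUnion, Finset.mem_Icc, mem_ball, Real.dist_eq, exists_prop]
    refine ⟨m, ?_, ?_⟩
    · have h1 : (1 / 2 : ℝ) ^ (j + 7) ≤ 1 := pow_le_one₀ (by norm_num) (by norm_num)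
      have h2 : |4 ^ (j + 1) * t| < 8 * 2 ^ j := by
        rw [abs_mul, abs_of_pos hpos]
        refine (mul_lt_mul_of_pos_left ht hpos).trans_eq ?_
        rw [pow_succ, show (4 : ℝ) = 2 * 2 by norm_num, mul_pow]
        linear_combination (8 * 2 ^ j) * two_pow_mul_half_pow j
      have h3 : |(m : ℝ)| < 8 * 2 ^ j + 1 := by
        have := abs_sub_abs_le_abs_sub (m : ℝ) (4 ^ (j + 1) * t)
        rw [abs_sub_comm] at this
        linarith
      have h4 : |m| < (M : ℤ) := by
        have : (|m| : ℝ) < (M : ℝ) := by simpa [M] using h3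
        exact_mod_cast this
      exact ⟨by linarith [neg_abs_le m], by linarith [le_abs_self m]⟩
    · have : t - m / 4 ^ (j + 1) = (4 ^ (j + 1) * t - m) / 4 ^ (j + 1) := by
        field_simp
      rw [this, abs_div, abs_of_pos hpos]
      exact div_lt_div_of_pos_right hm hpos
  have hcard : (Finset.Icc (-(M : ℤ)) M).card = 2 * M + 1 := by
    rw [Int.card_Icc]; omega
  refine (measure_mono hsub).trans ((measure_biUnion_finset_le _ _).trans ?_)
  simp only [Real.volume_ball, Finset.sum_const, hcard, nsmul_eq_mul]
  rw [← ENNReal.ofReal_natCast, ← ENNReal.ofReal_mul (by positivity)]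
  refine ENNReal.ofReal_le_ofReal ?_
  have h1 : (1 : ℝ) ≤ 2 ^ j := one_le_pow₀ one_le_two
  have h2 : ((2 * M + 1 : ℕ) : ℝ) ≤ 19 * 2 ^ j := by
    push_cast [M]; linarith
  calc ((2 * M + 1 : ℕ) : ℝ) * (2 * ((1 / 2) ^ (j + 7) / 4 ^ (j + 1)))
      ≤ 19 * 2 ^ j * (2 * ((1 / 2) ^ (j + 7) / 4 ^ (j + 1))) :=
        mul_le_mul_of_nonneg_right h2 (by positivity)
    _ = 19 / 256 * (1 / 4) ^ j * (2 ^ j * (1 / 2) ^ j) := by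
        rw [one_div_pow 4 j]
        field_simp
        ring
    _ ≤ 3 / 8 * (1 / 4 : ℝ) ^ j := by
        rw [two_pow_mul_half_pow, mul_one]
        exact mul_le_mul_of_nonneg_right (by norm_num) (by positivity)

/-- The union of the grid neighbourhoods of depth at least `k`. -/
def gridStrips (k : ℕ) : Set ℝ := ⋃ i, gridStrip (k + i)

theorem isOpen_gridStrips (k : ℕ) : IsOpen (gridStrips k) :=
  isOpen_iUnion fun _ => isOpen_gridStrip _

theorem volume_gridStrips_le (k : ℕ) :
    volume (gridStrips k) ≤ ENNReal.ofReal (1 / 2 * (1 / 4 : ℝ) ^ k) := by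
  refine (measure_iUnion_le _).trans ((ENNReal.tsum_le_tsum fun i =>
    volume_gridStrip_le (k + i)).trans ?_)
  have hs : HasSum (fun i : ℕ => 3 / 8 * (1 / 4 : ℝ) ^ (k + i)) (1 / 2 * (1 / 4 : ℝ) ^ k) := by
    have := (hasSum_geometric_of_lt_one (r := (1 / 4 : ℝ)) (by norm_num)
      (by norm_num)).mul_left (3 / 8 * (1 / 4 : ℝ) ^ k)
    convert! this using 1
    · ext i; rw [pow_add, mul_assoc]
    · norm_num; ring
  rw [← ENNReal.ofReal_tsum_of_nonneg (fun i => by positivity) hs.summable, hs.tsum_eq]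

theorem zero_mem_gridStrips (k : ℕ) : (0 : ℝ) ∈ gridStrips k :=
  mem_iUnion.2 ⟨0, by rw [abs_zero]; positivity, 0, by simp⟩

/-- A point of `N_k` lies in an annulus of some index `j ≥ k`, and both its coordinates are at most
`2^{-j}` in absolute value. Avoiding the strips of that index puts both at distance at least
`2^{-(n(j)+2)}` from the grid in unit coordinates. -/
theorem whitneyWeight₀_eq_two {k : ℕ} {x : Plane} (hx : x ∈ centralSquare k)
    (h0 : x 0 ∉ gridStrips k) (h1 : x 1 ∉ gridStrips k) : whitneyWeight₀ x = 2 := by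
  have hx0 : x ≠ 0 := by rintro rfl; exact h0 (zero_mem_gridStrips k)
  obtain ⟨j, hkj, hj1, hj2⟩ := exists_half_pow_lt_le (supNorm_pos hx0) (mem_centralSquare_iff.1 hx)
  obtain ⟨i, rfl⟩ := Nat.exists_eq_add_of_le hkj
  have key : ∀ t : ℝ, |t| ≤ supNorm x → t ∉ gridStrips k →
      periodicBump (k + i + 5) (4 ^ (k + i + 1) * t) = 1 := by
    intro t ht hts
    refine periodicBump_eq_one fun m => ?_
    by_contra! h
    refine hts (mem_iUnion.2 ⟨i, ?_, m, h⟩)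
    have : (0 : ℝ) < (1 / 2) ^ (k + i) := by positivity
    linarith
  rw [whitneyWeight₀, whitneyWeight_eq_of_supNorm hj1 hj2, key _ (le_max_left _ _) h0, key _ (le_max_right _ _) h1]
  norm_num

/-- The measure of the part of `(-∞, t] ∩ [-2^{-k}, 2^{-k}]` outside of the grid strips. -/
noncomputable def stripFun (k : ℕ) (t : ℝ) : ℝ :=
  volume.real (Iic t ∩ (Icc (-(1 / 2 : ℝ) ^ k) ((1 / 2) ^ k) \ gridStrips k))

theorem stripFun_sub (k : ℕ) {s t : ℝ} (hst : s ≤ t) :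
    stripFun k t - stripFun k s =
      volume.real (Ioc s t ∩ (Icc (-(1 / 2 : ℝ) ^ k) ((1 / 2) ^ k) \ gridStrips k)) := by
  set A := Icc (-(1 / 2 : ℝ) ^ k) ((1 / 2) ^ k) \ gridStrips k
  have hA : MeasurableSet A := measurableSet_Icc.diff (isOpen_gridStrips k).measurableSet
  have hfin : volume A ≠ ⊤ := ((measure_mono sdiff_subset).trans_lt measure_Icc_lt_top).ne
  have hu : Iic t ∩ A = (Iic s ∩ A) ∪ (Ioc s t ∩ A) := by
    rw [← union_inter_distrib_right, Iic_union_Ioc_eq_Iic hst]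
  rw [stripFun, stripFun, hu, measureReal_union _ _
    (measure_ne_top_of_subset inter_subset_right hfin)
    (measure_ne_top_of_subset inter_subset_right hfin)]
  · ring
  · exact (Iic_disjoint_Ioc le_rfl).mono inter_subset_left inter_subset_left
  · exact measurableSet_Ioc.inter hA

theorem stripFun_sub_nonneg (k : ℕ) {s t : ℝ} (hst : s ≤ t) : 0 ≤ stripFun k t - stripFun k s := by
  rw [stripFun_sub k hst]; exact measureReal_nonneg

theorem stripFun_sub_le (k : ℕ) {s t : ℝ} (hst : s ≤ t) :
    stripFun k t - stripFun k s ≤ t - s := by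
  rw [stripFun_sub k hst]
  refine (measureReal_mono inter_subset_left (by simp)).trans_eq ?_
  rw [Real.volume_real_Ioc_of_le hst]

theorem abs_stripFun_sub_le (k : ℕ) (s t : ℝ) : |stripFun k t - stripFun k s| ≤ |t - s| := by
  rcases le_total s t with h | h
  · rw [abs_of_nonneg (stripFun_sub_nonneg k h), abs_of_nonneg (sub_nonneg.2 h)]
    exact stripFun_sub_le k h
  · rw [abs_sub_comm, abs_sub_comm t, abs_of_nonneg (stripFun_sub_nonneg k h),
      abs_of_nonneg (sub_nonneg.2 h)]
    exact stripFun_sub_le k h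

theorem le_stripFun_sub (k : ℕ) {s t : ℝ} (hst : s ≤ t) (hs : |s| ≤ (1 / 2 : ℝ) ^ k)
    (ht : |t| ≤ (1 / 2 : ℝ) ^ k) :
    t - s - 1 / 2 * (1 / 4 : ℝ) ^ k ≤ stripFun k t - stripFun k s := by
  rw [stripFun_sub k hst]
  have hsub : Ioc s t ⊆ (Ioc s t ∩ (Icc (-(1 / 2 : ℝ) ^ k) ((1 / 2) ^ k) \ gridStrips k)) ∪
      gridStrips k := by
    intro r hr
    by_cases h : r ∈ gridStrips k
    · exact Or.inr h
    · exact Or.inl ⟨hr, ⟨(abs_le.1 hs).1.trans hr.1.le, hr.2.trans (abs_le.1 ht).2⟩, h⟩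
  have hv := volume_gridStrips_le k
  have hfin : volume (gridStrips k) ≠ ⊤ := (hv.trans_lt ENNReal.ofReal_lt_top).ne
  have hreal : volume.real (gridStrips k) ≤ 1 / 2 * (1 / 4 : ℝ) ^ k :=
    ENNReal.toReal_le_of_le_ofReal (by positivity) hv
  have h1 := measureReal_mono (μ := volume) hsub (measure_union_ne_top
    (measure_ne_top_of_subset inter_subset_left (by simp)) hfin)
  have h2 := measureReal_union_le (μ := volume)
    (Ioc s t ∩ (Icc (-(1 / 2 : ℝ) ^ k) ((1 / 2) ^ k) \ gridStrips k)) (gridStrips k)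
  rw [Real.volume_real_Ioc_of_le hst] at h1
  linarith

theorem le_abs_stripFun_sub (k : ℕ) {s t : ℝ} (hs : |s| ≤ (1 / 2 : ℝ) ^ k)
    (ht : |t| ≤ (1 / 2 : ℝ) ^ k) :
    ∃ σ : ℝ, |σ| = 1 ∧
      |t - s| - 1 / 2 * (1 / 4 : ℝ) ^ k ≤ σ * (stripFun k t - stripFun k s) := by
  rcases le_total s t with h | h
  · exact ⟨1, abs_one, by rw [one_mul, abs_of_nonneg (sub_nonneg.2 h)]; exact le_stripFun_sub k h hs ht⟩
  · refine ⟨-1, by simp, ?_⟩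
    rw [abs_sub_comm, abs_of_nonneg (sub_nonneg.2 h), neg_one_mul, neg_sub]
    exact le_stripFun_sub k h ht hs

/-- The set being measured is closed, so its measure does not accumulate near a point outside it. -/
theorem stripFun_eventually_eq (k : ℕ) {t : ℝ}
    (ht : t ∉ Icc (-(1 / 2 : ℝ) ^ k) ((1 / 2) ^ k) \ gridStrips k) :
    ∀ᶠ s in 𝓝 t, stripFun k s = stripFun k t := by
  have hcl : IsClosed (Icc (-(1 / 2 : ℝ) ^ k) ((1 / 2) ^ k) \ gridStrips k) :=
    isClosed_Icc.sdiff (isOpen_gridStrips k)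
  obtain ⟨δ, hδ, hball⟩ := Metric.isOpen_iff.1 hcl.isOpen_compl t ht
  have key : ∀ s r : ℝ, s ≤ r → uIcc s r ⊆ ball t δ → stripFun k r = stripFun k s := by
    intro s r hsr h
    have h0 : Ioc s r ∩ (Icc (-(1 / 2 : ℝ) ^ k) ((1 / 2) ^ k) \ gridStrips k) = ∅ :=
      disjoint_iff_inter_eq_empty.1 (disjoint_left.2 fun q hq hq' =>
        hball (h (Icc_subset_uIcc (Ioc_subset_Icc_self hq))) hq')
    have := stripFun_sub k hsr
    rw [h0, measureReal_empty] at this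
    linarith
  filter_upwards [ball_mem_nhds t hδ] with s hs
  have hsub : uIcc s t ⊆ ball t δ :=
    segment_eq_uIcc s t ▸ (convex_ball t δ).segment_subset hs (mem_ball_self hδ)
  rcases le_total s t with h | h
  · exact (key s t h hsub).symm
  · exact key t s h (uIcc_comm s t ▸ hsub)

/-- The calibration. If both coordinates are off the strips and the point is in `N_k`, then `ρ = 2`
dominates the sum of two `1`-Lipschitz terms. Otherwise one term is locally constant and `ρ ≥ 1`
suffices. This covers the whole plane, so curves leaving `N_k` are controlled too. -/
theorem hasSlopeLE_stripFun_add (k : ℕ) {σ τ : ℝ} (hσ : |σ| = 1) (hτ : |τ| = 1) (x : Plane) :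
    HasSlopeLE (fun y : Plane => σ * stripFun k (y 0) + τ * stripFun k (y 1)) x
      (whitneyWeight₀ x) := by
  have hd : ∀ (y : Plane) (i : Fin 2), |stripFun k (y i) - stripFun k (x i)| ≤ dist y x := by
    intro y i
    refine (abs_stripFun_sub_le k _ _).trans ?_
    rw [dist_eq_norm]
    exact PiLp.norm_apply_le (y - x) i
  have hb : ∀ y : Plane, |σ * stripFun k (y 0) + τ * stripFun k (y 1) -
      (σ * stripFun k (x 0) + τ * stripFun k (x 1))| ≤
      |stripFun k (y 0) - stripFun k (x 0)| + |stripFun k (y 1) - stripFun k (x 1)| := by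
    intro y
    have e : σ * stripFun k (y 0) + τ * stripFun k (y 1) -
      (σ * stripFun k (x 0) + τ * stripFun k (x 1)) = σ * (stripFun k (y 0) - stripFun k (x 0)) +
        τ * (stripFun k (y 1) - stripFun k (x 1)) := by ring
    rw [e]
    refine (abs_add_le _ _).trans_eq ?_
    rw [abs_mul, abs_mul, hσ, hτ, one_mul, one_mul]
  have hone : ∀ i : Fin 2, x i ∉ Icc (-(1 / 2 : ℝ) ^ k) ((1 / 2) ^ k) \ gridStrips k →
      ∀ᶠ y : Plane in 𝓝 x, stripFun k (y i) = stripFun k (x i) := by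
    intro i hi
    have hc : ContinuousAt (fun y : Plane => y i) x := by fun_prop
    exact hc.eventually (stripFun_eventually_eq k hi)
  have h1 := AdmissibleWeight.one_le whitneyWeight₀ x
  by_cases h0 : x 0 ∈ Icc (-(1 / 2 : ℝ) ^ k) ((1 / 2) ^ k) \ gridStrips k
  · by_cases h1 : x 1 ∈ Icc (-(1 / 2 : ℝ) ^ k) ((1 / 2) ^ k) \ gridStrips k
    · rw [whitneyWeight₀_eq_two ⟨abs_le.2 h0.1, abs_le.2 h1.1⟩ h0.2 h1.2]
      refine HasSlopeLE.of_eventually (Eventually.of_forall fun y => (hb y).trans ?_)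
      linarith [hd y 0, hd y 1]
    · refine (HasSlopeLE.of_eventually (c := 1) ?_).mono ‹_›
      filter_upwards [hone 1 h1] with y hy
      refine (hb y).trans ?_
      rw [hy, sub_self, abs_zero, add_zero, one_mul]
      exact hd y 0
  · refine (HasSlopeLE.of_eventually (c := 1) ?_).mono ‹_›
    filter_upwards [hone 0 h0] with y hy
    refine (hb y).trans ?_
    rw [hy, sub_self, abs_zero, zero_add, one_mul]
    exact hd y 1

namespace WeightedPlane

/-- The distance `d_ρ` of the weight `ρ = whitneyWeight₀`, as a function on the plane. -/
noncomputable def whitneyDist (a b : Plane) : ℝ :=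
  dist ((toPlane whitneyWeight₀).symm a) ((toPlane whitneyWeight₀).symm b)

/-- The signs `σ` and `τ` make both coordinate increments count positively, and each coordinate
loses at most half of `4^{-k}`. -/
theorem l1Norm_sub_le_whitneyDist {k : ℕ} {a b : Plane} (ha : a ∈ centralSquare k)
    (hb : b ∈ centralSquare k) : l1Norm (a - b) - (1 / 4) ^ k ≤ whitneyDist a b := by
  obtain ⟨σ, hσ, h0⟩ := le_abs_stripFun_sub k hb.1 ha.1
  obtain ⟨τ, hτ, h1⟩ := le_abs_stripFun_sub k hb.2 ha.2
  have h := ofReal_abs_sub_le_weightedEDist (ρ := whitneyWeight₀) (M := 2)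
    (fun x => ⟨(AdmissibleWeight.pos _ x).le, AdmissibleWeight.le_two _ x⟩)
    (fun x => hasSlopeLE_stripFun_add k hσ hτ x) b a
  rw [weightedEDist_comm, ← ofReal_dist_toPlane_symm,
    ENNReal.ofReal_le_ofReal_iff dist_nonneg] at h
  have h2 := (le_abs_self _).trans h
  rw [l1Norm, PiLp.sub_apply, PiLp.sub_apply, whitneyDist]
  linarith

theorem whitneyDist_le_of_segment {a b : Plane} {M : ℝ} (hM0 : 0 ≤ M)
    (hM : ∀ x ∈ segment ℝ a b, whitneyWeight₀ x ≤ M) : whitneyDist a b ≤ M * dist a b := by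
  have h := weightedEDist_le_of_segment hM
  rw [← ofReal_dist_toPlane_symm, edist_dist, ← ENNReal.ofReal_mul hM0,
    ENNReal.ofReal_le_ofReal_iff (by positivity)] at h
  exact h

end WeightedPlane

/-! ### Paths along the grid and the upper bound by the ℓ¹-distance -/

/-- The meshes are nested: a line of the grid with mesh `4^{-(k+1)}` also belongs to every finer
grid met deeper inside `N_k`, so the weight is `1` along its whole trace on `N_k`. -/
theorem whitneyWeight₀_eq_one {k : ℕ} {x : Plane} (hx : x ∈ centralSquare k) {i : Fin 2} {m : ℤ}
    (hm : 4 ^ (k + 1) * x i = m) : whitneyWeight₀ x = 1 := by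
  by_cases hx0 : x = 0
  · rw [hx0, whitneyWeight₀, whitneyWeight, if_pos rfl]
  obtain ⟨j, hkj, hj1, hj2⟩ := exists_half_pow_lt_le (supNorm_pos hx0) (mem_centralSquare_iff.1 hx)
  obtain ⟨l, rfl⟩ := Nat.exists_eq_add_of_le hkj
  rw [whitneyWeight₀, whitneyWeight_eq_of_supNorm hj1 hj2]
  have : periodicBump (k + l + 5) (4 ^ (k + l + 1) * x i) = 0 := by
    refine periodicBump_eq_zero (m := 4 ^ l * m) ?_
    have e : (4 : ℝ) ^ (k + l + 1) * x i - ((4 ^ l * m : ℤ) : ℝ) = 0 := by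
      push_cast
      rw [← hm]
      ring
    rw [e, abs_zero]
    positivity
  fin_cases i <;> simp_all

theorem dist_eq_abs_of_apply_eq {i j : Fin 2} (hij : i ≠ j) {a b : Plane} (h : a i = b i) :
    dist a b = |a j - b j| := by
  rw [EuclideanSpace.dist_eq, Fin.sum_univ_two]
  fin_cases i <;> fin_cases j <;> simp_all [Real.dist_eq, Real.sqrt_sq_eq_abs]

theorem mem_centralSquare_iff_of_ne {i j : Fin 2} (hij : i ≠ j) {k : ℕ} {x : Plane} :
    x ∈ centralSquare k ↔ |x i| ≤ (1 / 2 : ℝ) ^ k ∧ |x j| ≤ (1 / 2 : ℝ) ^ k := by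
  fin_cases i <;> fin_cases j <;> simp_all [centralSquare, and_comm]

theorem l1Norm_eq_of_ne {i j : Fin 2} (hij : i ≠ j) (v : Plane) : l1Norm v = |v i| + |v j| := by
  fin_cases i <;> fin_cases j <;> simp_all [l1Norm, add_comm]

theorem convex_centralSquare (k : ℕ) : Convex ℝ (centralSquare k) := by
  intro x hx y hy a b ha hb hab
  have key : ∀ s t : ℝ, |s| ≤ (1 / 2 : ℝ) ^ k → |t| ≤ (1 / 2 : ℝ) ^ k →
      |a * s + b * t| ≤ (1 / 2 : ℝ) ^ k := by
    intro s t hs ht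
    refine (abs_add_le _ _).trans ?_
    rw [abs_mul, abs_mul, abs_of_nonneg ha, abs_of_nonneg hb]
    calc a * |s| + b * |t| ≤ a * (1 / 2) ^ k + b * (1 / 2) ^ k :=
          add_le_add (mul_le_mul_of_nonneg_left hs ha) (mul_le_mul_of_nonneg_left ht hb)
      _ = (1 / 2) ^ k := by rw [← add_mul, hab, one_mul]
  exact ⟨key _ _ hx.1 hy.1, key _ _ hx.2 hy.2⟩

/-- Rounding towards the origin. -/
theorem exists_grid_point {s : ℝ} (hs : 0 < s) (t : ℝ) :
    ∃ m : ℤ, |m * s| ≤ |t| ∧ |t - m * s| ≤ s := by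
  rcases le_total 0 t with h | h
  · have h1 : (⌊t / s⌋ : ℝ) * s ≤ t := (le_div_iff₀ hs).1 (Int.floor_le _)
    have h2 : t < (⌊t / s⌋ + 1 : ℝ) * s := (div_lt_iff₀ hs).1 (Int.lt_floor_add_one _)
    have h3 : 0 ≤ (⌊t / s⌋ : ℝ) * s :=
      mul_nonneg (by exact_mod_cast Int.floor_nonneg.2 (by positivity)) hs.le
    refine ⟨⌊t / s⌋, ?_, ?_⟩
    · rwa [abs_of_nonneg h3, abs_of_nonneg h]
    · rw [abs_of_nonneg (by linarith)]; linarith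
  · have h1 : t ≤ (⌈t / s⌉ : ℝ) * s := (div_le_iff₀ hs).1 (Int.le_ceil _)
    have h2 : (⌈t / s⌉ - 1 : ℝ) * s < t := (lt_div_iff₀ hs).1 (by linarith [Int.ceil_lt_add_one (t / s)])
    have h3 : (⌈t / s⌉ : ℝ) * s ≤ 0 := by
      refine mul_nonpos_of_nonpos_of_nonneg ?_ hs.le
      exact_mod_cast Int.ceil_le.2 (by simpa using div_nonpos_of_nonpos_of_nonneg h hs.le)
    refine ⟨⌈t / s⌉, ?_, ?_⟩
    · rw [abs_of_nonpos h3, abs_of_nonpos h]; linarith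
    · rw [abs_of_nonpos (by linarith)]; linarith

theorem exists_grid_point_between {s α β : ℝ} (hs : 0 < s) (h : s < |α - β|) :
    ∃ m : ℤ, |m * s| ≤ max |α| |β| ∧ |α - m * s| + |m * s - β| = |α - β| ∧ |m * s - β| ≤ s := by
  have key : ∀ q : ℝ, q ∈ uIcc α β → |q| ≤ max |α| |β| ∧ |α - q| + |q - β| = |α - β| := by
    intro q hq
    rcases le_total α β with hab | hab
    · rw [uIcc_of_le hab] at hq
      refine ⟨abs_le_max_abs_abs hq.1 hq.2, ?_⟩
      rw [abs_of_nonpos (by linarith [hq.1]), abs_of_nonpos (by linarith [hq.2]),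
        abs_of_nonpos (by linarith)]
      ring
    · rw [uIcc_of_ge hab] at hq
      refine ⟨by rw [max_comm]; exact abs_le_max_abs_abs hq.1 hq.2, ?_⟩
      rw [abs_of_nonneg (by linarith [hq.2]), abs_of_nonneg (by linarith [hq.1]),
        abs_of_nonneg (by linarith)]
      ring
  rcases le_total α β with hab | hab
  · have h1 : (⌊β / s⌋ : ℝ) * s ≤ β := (le_div_iff₀ hs).1 (Int.floor_le _)
    have h2 : β < (⌊β / s⌋ + 1 : ℝ) * s := (div_lt_iff₀ hs).1 (Int.lt_floor_add_one _)
    rw [abs_of_nonpos (by linarith)] at h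
    obtain ⟨k1, k2⟩ := key (⌊β / s⌋ * s) (by rw [uIcc_of_le hab]; exact ⟨by linarith, h1⟩)
    refine ⟨⌊β / s⌋, k1, k2, ?_⟩
    rw [abs_of_nonpos (by linarith)]; linarith
  · have h1 : β ≤ (⌈β / s⌉ : ℝ) * s := (div_le_iff₀ hs).1 (Int.le_ceil _)
    have h2 : (⌈β / s⌉ - 1 : ℝ) * s < β :=
      (lt_div_iff₀ hs).1 (by linarith [Int.ceil_lt_add_one (β / s)])
    rw [abs_of_nonneg (by linarith)] at h
    obtain ⟨k1, k2⟩ := key (⌈β / s⌉ * s) (by rw [uIcc_of_ge hab]; exact ⟨h1, by linarith⟩)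
    refine ⟨⌈β / s⌉, k1, k2, ?_⟩
    rw [abs_of_nonneg (by linarith)]; linarith

/-- The point whose `i`-th coordinate is `s` and whose other coordinate is `t`. -/
def planePoint (i : Fin 2) (s t : ℝ) : Plane := WithLp.toLp 2 fun j => if j = i then s else t

theorem planePoint_apply_self (i : Fin 2) (s t : ℝ) : planePoint i s t i = s := by
  simp [planePoint]

theorem planePoint_apply_of_ne {i j : Fin 2} (h : i ≠ j) (s t : ℝ) : planePoint i s t j = t := by
  simp [planePoint, h.symm]

namespace WeightedPlane

theorem whitneyDist_triangle (a b c : Plane) :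
    whitneyDist a c ≤ whitneyDist a b + whitneyDist b c := dist_triangle _ _ _

theorem whitneyDist_le_of_grid {k : ℕ} {i j : Fin 2} (hij : i ≠ j) {a b : Plane}
    (ha : a ∈ centralSquare k) (hb : b ∈ centralSquare k) (h : a i = b i) {m : ℤ}
    (hm : a i = m * ((4 : ℝ) ^ (k + 1))⁻¹) : whitneyDist a b ≤ |a j - b j| := by
  rw [← dist_eq_abs_of_apply_eq hij h, ← one_mul (dist a b)]
  refine whitneyDist_le_of_segment zero_le_one fun x hx => ?_
  refine (whitneyWeight₀_eq_one ((convex_centralSquare k).segment_subset ha hb hx) (i := i)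
    (m := m) ?_).le
  obtain ⟨c, d, -, -, hcd, rfl⟩ := hx
  have e : (c • a + d • b) i = a i := by
    rw [PiLp.add_apply, PiLp.smul_apply, PiLp.smul_apply, ← h, smul_eq_mul, smul_eq_mul, ← add_mul,
      hcd, one_mul]
  rw [e, hm]
  field_simp

theorem whitneyDist_le_two_mul {i j : Fin 2} (hij : i ≠ j) {a b : Plane} (h : a i = b i) :
    whitneyDist a b ≤ 2 * |a j - b j| := by
  rw [← dist_eq_abs_of_apply_eq hij h]
  exact whitneyDist_le_of_segment zero_le_two fun x _ => AdmissibleWeight.le_two _ x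

/-- With `s = 4^{-(k+1)}`, the path moves from `a` to a grid line (cost at most `2s`), follows it to
a crossing line chosen between `a j` and `b j`, follows that line, and finally leaves it for `b`.
The excess over the ℓ¹-distance is at most `2s + s + s = 4s = 4^{-k}`. Rounding towards the origin
keeps the path inside `N_k`. -/
theorem whitneyDist_le_of_separated {k : ℕ} {i j : Fin 2} (hij : i ≠ j) {a b : Plane}
    (ha : a ∈ centralSquare k) (hb : b ∈ centralSquare k)
    (h : ((4 : ℝ) ^ (k + 1))⁻¹ < |a j - b j|) :
    whitneyDist a b ≤ l1Norm (a - b) + (1 / 4) ^ k := by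
  have hs4 : 4 * ((4 : ℝ) ^ (k + 1))⁻¹ = (1 / 4) ^ k := by
    rw [pow_succ, one_div, inv_pow]; field_simp
  set s : ℝ := ((4 : ℝ) ^ (k + 1))⁻¹ with hs_def
  have hs : 0 < s := by positivity
  obtain ⟨m, hm1, hm2⟩ := exists_grid_point hs (a i)
  obtain ⟨l, hl1, hl2, hl3⟩ := exists_grid_point_between hs h
  have ha' := (mem_centralSquare_iff_of_ne hij).1 ha
  have hb' := (mem_centralSquare_iff_of_ne hij).1 hb
  have hl : |(l : ℝ) * s| ≤ (1 / 2 : ℝ) ^ k := hl1.trans (max_le ha'.2 hb'.2)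
  have hm : |(m : ℝ) * s| ≤ (1 / 2 : ℝ) ^ k := hm1.trans ha'.1
  have hmem : ∀ {u v : ℝ}, |u| ≤ (1 / 2 : ℝ) ^ k → |v| ≤ (1 / 2 : ℝ) ^ k →
      planePoint i u v ∈ centralSquare k := fun hu hv =>
    (mem_centralSquare_iff_of_ne hij).2
      ⟨by rwa [planePoint_apply_self], by rwa [planePoint_apply_of_ne hij]⟩
  have d1 : whitneyDist a (planePoint i (m * s) (a j)) ≤ 2 * |a i - m * s| := by
    have := whitneyDist_le_two_mul hij.symm (a := a) (b := planePoint i (m * s) (a j))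
      (by rw [planePoint_apply_of_ne hij])
    rwa [planePoint_apply_self] at this
  have d2 : whitneyDist (planePoint i (m * s) (a j)) (planePoint i (m * s) (l * s)) ≤
      |a j - l * s| := by
    have := whitneyDist_le_of_grid hij (hmem hm ha'.2) (hmem hm hl) (m := m)
      (by rw [planePoint_apply_self, planePoint_apply_self]) (by rw [planePoint_apply_self])
    rwa [planePoint_apply_of_ne hij, planePoint_apply_of_ne hij] at this
  have d3 : whitneyDist (planePoint i (m * s) (l * s)) (planePoint i (b i) (l * s)) ≤
      |m * s - b i| := by
    have := whitneyDist_le_of_grid hij.symm (hmem hm hl) (hmem hb'.1 hl) (m := l)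
      (by rw [planePoint_apply_of_ne hij, planePoint_apply_of_ne hij])
      (by rw [planePoint_apply_of_ne hij])
    rwa [planePoint_apply_self, planePoint_apply_self] at this
  have d4 : whitneyDist (planePoint i (b i) (l * s)) b ≤ 2 * |l * s - b j| := by
    have := whitneyDist_le_two_mul hij (a := planePoint i (b i) (l * s)) (b := b)
      (by rw [planePoint_apply_self])
    rwa [planePoint_apply_of_ne hij] at this
  have t1 := whitneyDist_triangle a (planePoint i (m * s) (a j)) b
  have t2 := whitneyDist_triangle (planePoint i (m * s) (a j)) (planePoint i (m * s) (l * s)) b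
  have t3 := whitneyDist_triangle (planePoint i (m * s) (l * s)) (planePoint i (b i) (l * s)) b
  have t4 := abs_sub_le (m * s) (a i) (b i)
  rw [abs_sub_comm (m * s) (a i)] at t4
  rw [l1Norm_eq_of_ne hij, PiLp.sub_apply, PiLp.sub_apply]
  linarith

theorem abs_whitneyDist_sub_l1Norm_le {k : ℕ} {a b : Plane} (ha : a ∈ centralSquare k)
    (hb : b ∈ centralSquare k) : |whitneyDist a b - l1Norm (a - b)| ≤ (1 / 4) ^ k := by
  have hlow := l1Norm_sub_le_whitneyDist ha hb
  have hup : whitneyDist a b ≤ l1Norm (a - b) + (1 / 4) ^ k := by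
    by_cases h0 : ((4 : ℝ) ^ (k + 1))⁻¹ < |a 0 - b 0|
    · exact whitneyDist_le_of_separated one_ne_zero ha hb h0
    by_cases h1 : ((4 : ℝ) ^ (k + 1))⁻¹ < |a 1 - b 1|
    · exact whitneyDist_le_of_separated zero_ne_one ha hb h1
    -- When both coordinates differ by at most `s = 4^{-(k+1)}`, the straight segment suffices:
    -- twice the ℓ¹-distance exceeds it by at most `2s`.
    have hs4 : 4 * ((4 : ℝ) ^ (k + 1))⁻¹ = (1 / 4) ^ k := by
      rw [pow_succ, one_div, inv_pow]; field_simp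
    have hs : 0 < ((4 : ℝ) ^ (k + 1))⁻¹ := by positivity
    have h2 := whitneyDist_le_of_segment (a := a) (b := b) zero_le_two fun x _ =>
      AdmissibleWeight.le_two _ x
    have h3 : dist a b ≤ |a 0 - b 0| + |a 1 - b 1| := by
      rw [EuclideanSpace.dist_eq, Fin.sum_univ_two, Real.dist_eq, Real.dist_eq]
      refine Real.sqrt_le_iff.2 ⟨by positivity, ?_⟩
      nlinarith [abs_nonneg (a 0 - b 0), abs_nonneg (a 1 - b 1),
        mul_nonneg (abs_nonneg (a 0 - b 0)) (abs_nonneg (a 1 - b 1))]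
    rw [l1Norm, PiLp.sub_apply, PiLp.sub_apply]
    linarith
  rw [abs_le]
  constructor <;> linarith

end WeightedPlane

/-! ### The blow-up at the origin -/

theorem ae_apply_of_ae {P : ℝ → Prop} (h : ∀ᵐ t : ℝ, P t) (i : Fin 2) : ∀ᵐ x : Plane, P (x i) :=
  ((Measure.quasiMeasurePreserving_eval (fun _ : Fin 2 => (volume : Measure ℝ)) i).comp
    (EuclideanSpace.volume_preserving_symm_measurableEquiv_toLp (Fin 2)).quasiMeasurePreserving).ae h

/-- Borel–Cantelli: the strips have length `O(4^{-k})` and rescaling multiplies it by `2^{k+c}`,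
which leaves a summable `O(2^{-k})`. The shift `c` is there to reach points with `|x|_∞ ≤ 2^c`. -/
theorem ae_eventually_notMem_gridStrips (c : ℕ) :
    ∀ᵐ t : ℝ, ∀ᶠ k in atTop, (1 / 2 : ℝ) ^ (k + c) * t ∉ gridStrips k := by
  refine ae_eventually_notMem (s := fun k => (fun t => (1 / 2 : ℝ) ^ (k + c) * t) ⁻¹' gridStrips k) ?_
  have hb : ∀ k : ℕ, volume ((fun t => (1 / 2 : ℝ) ^ (k + c) * t) ⁻¹' gridStrips k) ≤
      ENNReal.ofReal (2 ^ c / 2 * (1 / 2 : ℝ) ^ k) := by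
    intro k
    rw [Real.volume_preimage_mul_left (by positivity)]
    refine (mul_le_mul_right (volume_gridStrips_le k) _).trans_eq ?_
    rw [← ENNReal.ofReal_mul (by positivity), abs_of_pos (by positivity)]
    congr 1
    rw [← inv_pow, one_div, inv_inv, pow_add, show (1 / 4 : ℝ) = 1 / 2 * (1 / 2) by norm_num,
      mul_pow]
    linear_combination (1 / 2 * 2 ^ c * (1 / 2 : ℝ) ^ k) * two_pow_mul_half_pow k
  have hs : Summable fun k : ℕ => 2 ^ c / 2 * (1 / 2 : ℝ) ^ k :=
    (summable_geometric_of_lt_one (by norm_num) (by norm_num)).mul_left _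
  refine ((ENNReal.tsum_le_tsum hb).trans_lt ?_).ne
  rw [← ENNReal.ofReal_tsum_of_nonneg (fun k => by positivity) hs]
  exact ENNReal.ofReal_lt_top

theorem smul_mem_centralSquare {c k : ℕ} {x : Plane} (hx : supNorm x ≤ 2 ^ c) :
    (1 / 2 : ℝ) ^ (k + c) • x ∈ centralSquare k := by
  have key : ∀ t : ℝ, |t| ≤ supNorm x → |(1 / 2 : ℝ) ^ (k + c) * t| ≤ (1 / 2 : ℝ) ^ k := by
    intro t ht
    rw [abs_mul, abs_of_pos (by positivity)]
    refine (mul_le_mul_of_nonneg_left (ht.trans hx) (by positivity)).trans_eq ?_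
    rw [pow_add]
    linear_combination (1 / 2 : ℝ) ^ k * two_pow_mul_half_pow c
  exact ⟨key _ (le_max_left _ _), key _ (le_max_right _ _)⟩

theorem exists_supNorm_le_two_pow (x : Plane) : ∃ c : ℕ, supNorm x ≤ 2 ^ c :=
  (pow_unbounded_of_one_lt _ one_lt_two).imp fun _ h => h.le

theorem ae_eventually_whitneyWeight₀_smul_eq_two :
    ∀ᵐ x : Plane, ∀ᶠ k : ℕ in atTop, whitneyWeight₀ ((1 / 2 : ℝ) ^ k • x) = 2 := by
  have h : ∀ᵐ x : Plane, ∀ c : ℕ, ∀ i : Fin 2,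
      ∀ᶠ k in atTop, (1 / 2 : ℝ) ^ (k + c) * x i ∉ gridStrips k :=
    ae_all_iff.2 fun c => ae_all_iff.2 fun i => ae_apply_of_ae (ae_eventually_notMem_gridStrips c) i
  filter_upwards [h] with x hx
  obtain ⟨c, hc⟩ := exists_supNorm_le_two_pow x
  rw [← map_add_atTop_eq_nat c, eventually_map]
  filter_upwards [hx c 0, hx c 1] with k h0 h1
  exact whitneyWeight₀_eq_two (smul_mem_centralSquare hc) h0 h1

theorem l1Norm_smul {r : ℝ} (hr : 0 ≤ r) (x : Plane) : l1Norm (r • x) = r * l1Norm x := by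
  simp only [l1Norm, PiLp.smul_apply, smul_eq_mul, abs_mul, abs_of_nonneg hr]; ring

theorem supNorm_le_l1Norm (x : Plane) : supNorm x ≤ l1Norm x :=
  max_le (le_add_of_nonneg_right (abs_nonneg _)) (le_add_of_nonneg_left (abs_nonneg _))

theorem supNorm_le_norm (x : Plane) : supNorm x ≤ ‖x‖ :=
  max_le (PiLp.norm_apply_le x 0) (PiLp.norm_apply_le x 1)

/-- The identity between the Euclidean plane and the `ℓ¹`-plane. -/
noncomputable def toL1 : Plane ≃L[ℝ] PlaneL1 :=
  (PiLp.continuousLinearEquiv 2 ℝ fun _ : Fin 2 => ℝ).trans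
    (PiLp.continuousLinearEquiv 1 ℝ fun _ : Fin 2 => ℝ).symm

theorem norm_toL1 (x : Plane) : ‖toL1 x‖ = l1Norm x := by
  rw [PiLp.norm_eq_of_L1, Fin.sum_univ_two]
  rfl

/-- Lebesgue measure on the `ℓ¹`-plane. -/
noncomputable def volumeL1 : Measure PlaneL1 := (volume : Measure Plane).map toL1

instance : volumeL1.IsAddHaarMeasure := toL1.isAddHaarMeasure_map volume

theorem toL1_measurableEmbedding : MeasurableEmbedding toL1 :=
  toL1.toHomeomorph.measurableEmbedding

theorem preimage_toL1_ball (R : ℝ) : toL1 ⁻¹' ball 0 R = {z : Plane | l1Norm z < R} := by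
  ext z; rw [mem_preimage, mem_ball_zero_iff, norm_toL1]; rfl

theorem measurableSet_l1Norm_lt (R : ℝ) : MeasurableSet {z : Plane | l1Norm z < R} :=
  preimage_toL1_ball R ▸ toL1.continuous.measurable measurableSet_ball

theorem ae_l1Norm_ne (R : ℝ) : ∀ᵐ z : Plane, l1Norm z ≠ R := by
  have h : ∀ᵐ y ∂volumeL1, ‖y‖ ≠ R := by
    rw [ae_iff]
    have : {y : PlaneL1 | ¬ ‖y‖ ≠ R} = sphere 0 R := by ext; simp
    rw [this]
    exact Measure.addHaar_sphere _ _ _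
  have h2 := ae_of_ae_map toL1.continuous.aemeasurable h
  filter_upwards [h2] with z hz
  rwa [norm_toL1] at hz

namespace WeightedPlane

theorem continuous_whitneyDist_right (a : Plane) : Continuous fun b => whitneyDist b a :=
  ((toPlane whitneyWeight₀).symm.continuous).dist continuous_const

/-- The rescaled points lie in `N_{k-c}`, where the error is `4^{-(k-c)}`. One of the two factors
`2^{-k}` remains after division by the scale and tends to `0`. -/
theorem abs_whitneyDist_smul_sub_le {c k : ℕ} (hk : c ≤ k) {a b : Plane} (ha : supNorm a ≤ 2 ^ c)
    (hb : supNorm b ≤ 2 ^ c) :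
    |whitneyDist ((1 / 2 : ℝ) ^ k • a) ((1 / 2 : ℝ) ^ k • b) - (1 / 2 : ℝ) ^ k * l1Norm (a - b)| ≤
      4 ^ c * (1 / 2 : ℝ) ^ k * (1 / 2 : ℝ) ^ k := by
  obtain ⟨l, rfl⟩ := Nat.exists_eq_add_of_le' hk
  have h := abs_whitneyDist_sub_l1Norm_le (smul_mem_centralSquare (k := l) ha)
    (smul_mem_centralSquare (k := l) hb)
  rw [← smul_sub, l1Norm_smul (by positivity)] at h
  refine h.trans_eq ?_
  rw [mul_assoc, ← mul_pow, show (1 / 2 * (1 / 2) : ℝ) = 1 / 4 by norm_num, pow_add, mul_left_comm,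
    ← mul_pow]
  norm_num

theorem tendsto_whitneyDist_smul (z : Plane) :
    Tendsto (fun k : ℕ => whitneyDist ((1 / 2 : ℝ) ^ k • z) 0 / (1 / 2 : ℝ) ^ k) atTop
      (𝓝 (l1Norm z)) := by
  obtain ⟨c, hc⟩ := exists_supNorm_le_two_pow z
  rw [tendsto_iff_dist_tendsto_zero]
  have h0 : Tendsto (fun k : ℕ => 4 ^ c * (1 / 2 : ℝ) ^ k) atTop (𝓝 0) := by
    simpa using (tendsto_pow_atTop_nhds_zero_of_lt_one (r := (1 / 2 : ℝ)) (by norm_num)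
      (by norm_num)).const_mul (4 ^ c)
  refine squeeze_zero' (Eventually.of_forall fun _ => dist_nonneg) ?_ h0
  filter_upwards [eventually_ge_atTop c] with k hk
  have h := abs_whitneyDist_smul_sub_le hk hc (b := 0) (by simp [supNorm])
  have hp : (0 : ℝ) < (1 / 2) ^ k := by positivity
  rw [smul_zero, sub_zero] at h
  rw [Real.dist_eq, div_sub' hp.ne', abs_div, abs_of_pos hp, div_le_iff₀ hp]
  exact h

/-- The rescaled integrand of `f` over the ball of radius `R 2^{-k}`. -/
noncomputable def blowUpIntegrand (k : ℕ) (R : ℝ) (f : Plane → ℝ) : Plane → ℝ :=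
  indicator {z | whitneyDist ((1 / 2 : ℝ) ^ k • z) 0 < R * (1 / 2 : ℝ) ^ k}
    fun z => whitneyWeight₀ ((1 / 2 : ℝ) ^ k • z) ^ 2 * f z

/-- The density `ρ²` passes into the integrand, and the dilation by `2^k` contributes the Jacobian
`4^{-k}`. -/
theorem setIntegral_ball_blowUp (k : ℕ) (R : ℝ) (f : Plane → ℝ) :
    ∫ x in ball ((toPlane whitneyWeight₀).symm 0) (R * (1 / 2 : ℝ) ^ k),
      f ((2 : ℝ) ^ k • toPlane whitneyWeight₀ x) ∂(μHE[2]) =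
      (1 / 4 : ℝ) ^ k * ∫ z, blowUpIntegrand k R f z := by
  have hm := AdmissibleWeight.measurable whitneyWeight₀
  have hmeas : MeasurableSet {z : Plane | whitneyDist z 0 < R * (1 / 2 : ℝ) ^ k} :=
    (isOpen_lt (continuous_whitneyDist_right 0) continuous_const).measurableSet
  have hscale : ∀ z : Plane, (1 / 2 : ℝ) ^ k • (2 : ℝ) ^ k • z = z := fun z => by
    rw [smul_smul, mul_comm, two_pow_mul_half_pow, one_smul]
  have hpre : (toPlane whitneyWeight₀).symm ⁻¹'
      ball ((toPlane whitneyWeight₀).symm 0) (R * (1 / 2 : ℝ) ^ k) =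
      {z : Plane | whitneyDist z 0 < R * (1 / 2 : ℝ) ^ k} := rfl
  rw [← (measurePreserving_toPlane_symm (ρ := whitneyWeight₀)).setIntegral_preimage_emb
    (toPlane whitneyWeight₀).symm.measurableEmbedding, hpre, density,
    setIntegral_withDensity_eq_setIntegral_toReal_smul (by fun_prop)
      (Eventually.of_forall fun _ => ENNReal.ofReal_lt_top) _ hmeas,
    ← integral_indicator hmeas]
  have hH : (indicator {z : Plane | whitneyDist z 0 < R * (1 / 2 : ℝ) ^ k} fun z =>
      (ENNReal.ofReal (whitneyWeight₀ z ^ 2)).toReal •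
        f ((2 : ℝ) ^ k • toPlane whitneyWeight₀ ((toPlane whitneyWeight₀).symm z))) =
      fun z => blowUpIntegrand k R f ((2 : ℝ) ^ k • z) := by
    ext z
    rw [blowUpIntegrand]
    simp only [indicator_apply, mem_ofPred_eq, hscale, Homeomorph.apply_symm_apply, smul_eq_mul,
      ENNReal.toReal_ofReal (sq_nonneg _)]
  rw [hH, Measure.integral_comp_smul, finrank_euclideanSpace_fin, smul_eq_mul,
    abs_of_pos (by positivity), ← pow_mul, mul_comm k 2, pow_mul, ← inv_pow]
  norm_num

/-- Dominated convergence: `d_ρ` dominates the Euclidean distance, so the integrands live on a fixed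
Euclidean ball. Pointwise, `ρ²` tends to `4` almost everywhere and the indicators converge off the
null sphere `‖z‖₁ = R`. -/
theorem tendsto_integral_blowUpIntegrand (R : ℝ) {f : Plane → ℝ} (hf : Continuous f) {C : ℝ}
    (hC : ∀ z, |f z| ≤ C) :
    Tendsto (fun k => ∫ z, blowUpIntegrand k R f z) atTop
      (𝓝 (4 * ∫ z in {z : Plane | l1Norm z < R}, f z)) := by
  have hm := AdmissibleWeight.measurable whitneyWeight₀
  rw [← integral_const_mul, ← integral_indicator (measurableSet_l1Norm_lt R)]
  refine tendsto_integral_of_dominated_convergence ((ball (0 : Plane) R).indicator fun _ => 4 * C)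
    (fun k => ?_) ?_ (fun k => Eventually.of_forall fun z => ?_) ?_
  · refine Measurable.aestronglyMeasurable (Measurable.indicator ?_ ?_)
    · have := hf.measurable
      fun_prop
    · exact (isOpen_lt ((continuous_whitneyDist_right 0).comp (continuous_const_smul _))
        continuous_const).measurableSet
  · exact (integrable_indicator_iff measurableSet_ball).2
      (integrableOn_const measure_ball_lt_top.ne)
  · have hC0 : 0 ≤ C := (abs_nonneg _).trans (hC 0)
    rw [blowUpIntegrand, indicator_apply]
    split_ifs with h
    · have hz : z ∈ ball (0 : Plane) R := by
        have h1 := dist_toPlane_le ((toPlane whitneyWeight₀).symm ((1 / 2 : ℝ) ^ k • z))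
          ((toPlane whitneyWeight₀).symm 0)
        rw [Homeomorph.apply_symm_apply, Homeomorph.apply_symm_apply, dist_zero_right, norm_smul,
          Real.norm_of_nonneg (by positivity)] at h1
        have h2 : (1 / 2 : ℝ) ^ k * ‖z‖ < (1 / 2 : ℝ) ^ k * R := by
          rw [mul_comm _ R]; exact h1.trans_lt h
        rw [mem_ball_zero_iff]
        exact lt_of_mul_lt_mul_left h2 (by positivity)
      rw [indicator_of_mem hz, Real.norm_eq_abs, abs_mul, abs_of_nonneg (sq_nonneg _)]
      have h1 := AdmissibleWeight.pos whitneyWeight₀ ((1 / 2 : ℝ) ^ k • z)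
      have h2 := AdmissibleWeight.le_two whitneyWeight₀ ((1 / 2 : ℝ) ^ k • z)
      exact mul_le_mul (by nlinarith) (hC z) (abs_nonneg _) (by norm_num)
    · rw [norm_zero]
      exact indicator_nonneg (fun _ _ => by positivity) _
  · filter_upwards [ae_l1Norm_ne R, ae_eventually_whitneyWeight₀_smul_eq_two] with z hz hw
    refine tendsto_const_nhds.congr' ?_
    have hp : ∀ k : ℕ, (0 : ℝ) < (1 / 2) ^ k := fun k => by positivity
    rcases hz.lt_or_gt with h | h
    · filter_upwards [hw, (tendsto_whitneyDist_smul z).eventually_lt_const h] with k h1 h2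
      rw [div_lt_iff₀ (hp k)] at h2
      rw [blowUpIntegrand, indicator_of_mem (show z ∈ {z : Plane | l1Norm z < R} from h),
        indicator_of_mem (by exact h2), h1]
      norm_num
    · filter_upwards [(tendsto_whitneyDist_smul z).eventually_const_lt h] with k h2
      rw [lt_div_iff₀ (hp k)] at h2
      rw [blowUpIntegrand,
        indicator_of_notMem (show z ∉ {z : Plane | l1Norm z < R} from not_lt.2 h.le),
        indicator_of_notMem (by exact not_lt.2 h2.le)]

/-- The blow-up maps at the origin. -/
noncomputable def blowUp (k : ℕ) (x : WeightedPlane whitneyWeight₀) : PlaneL1 :=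
  toL1 ((2 : ℝ) ^ k • toPlane whitneyWeight₀ x)

theorem continuous_blowUp (k : ℕ) : Continuous (blowUp k) :=
  toL1.continuous.comp ((continuous_const_smul ((2 : ℝ) ^ k)).comp
    (toPlane whitneyWeight₀).continuous)

end WeightedPlane

/-- The area of the unit ball of the `ℓ¹`-plane. -/
noncomputable def unitAreaL1 : ℝ := volume.real {z : Plane | l1Norm z < 1}

theorem unitAreaL1_pos : 0 < unitAreaL1 := by
  have hv : volume {z : Plane | l1Norm z < 1} = volumeL1 (ball 0 1) := by
    rw [volumeL1, toL1_measurableEmbedding.map_apply, preimage_toL1_ball]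
  rw [unitAreaL1, measureReal_def, hv]
  exact ENNReal.toReal_pos (measure_ball_pos _ _ one_pos).ne' measure_ball_lt_top.ne

/-- Lebesgue measure on the `ℓ¹`-plane, normalized so that the unit ball has measure `1`. -/
noncomputable def tangentMeasure : Measure PlaneL1 := ENNReal.ofReal unitAreaL1⁻¹ • volumeL1

instance : tangentMeasure.IsAddHaarMeasure :=
  Measure.IsAddHaarMeasure.smul volumeL1
    (ENNReal.ofReal_pos.2 (inv_pos.2 unitAreaL1_pos)).ne' ENNReal.ofReal_ne_top

theorem setIntegral_tangentMeasure (R : ℝ) (f : PlaneL1 → ℝ) :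
    ∫ y in ball 0 R, f y ∂tangentMeasure =
      unitAreaL1⁻¹ * ∫ z in {z : Plane | l1Norm z < R}, f (toL1 z) := by
  rw [tangentMeasure, Measure.restrict_smul, integral_smul_measure, volumeL1,
    toL1_measurableEmbedding.setIntegral_map, preimage_toL1_ball,
    ENNReal.toReal_ofReal (inv_pos.2 unitAreaL1_pos).le, smul_eq_mul]

theorem isPointedMetricMeasureSpace_tangentMeasure :
    IsPointedMetricMeasureSpace tangentMeasure (0 : PlaneL1) where
  complete := inferInstance
  separable := inferInstance
  boundedly_finite _ hs := hs.measure_lt_top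
  mem_support := by rw [Measure.support_eq_univ]; exact mem_univ _

namespace WeightedPlane

theorem isPmGHTangent_tangentMeasure :
    IsPmGHTangent (μHE[2] : Measure (WeightedPlane whitneyWeight₀))
      ((toPlane whitneyWeight₀).symm 0) tangentMeasure (0 : PlaneL1) where
  source := isPointedMetricMeasureSpace _ _
  target := isPointedMetricMeasureSpace_tangentMeasure
  blowUp := by
    have hp : ∀ k : ℕ, (0 : ℝ) < (1 / 2) ^ k := fun k => by positivity
    refine ⟨fun k => (1 / 2 : ℝ) ^ k, pow_right_strictAnti₀ (by norm_num) (by norm_num), hp,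
      tendsto_pow_atTop_nhds_zero_of_lt_one (by norm_num) (by norm_num), fun ε hε =>
      Eventually.of_forall fun R hR => ?_⟩
    obtain ⟨c, hc⟩ := pow_unbounded_of_one_lt R one_lt_two
    have h0 : Tendsto (fun k : ℕ => 4 ^ c * (1 / 2 : ℝ) ^ k) atTop (𝓝 0) := by
      simpa using (tendsto_pow_atTop_nhds_zero_of_lt_one (r := (1 / 2 : ℝ)) (by norm_num)
        (by norm_num)).const_mul (4 ^ c)
    obtain ⟨k₀, hk₀⟩ := eventually_atTop.1
      ((eventually_ge_atTop c).and (h0.eventually_lt_const hε.1))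
    have hscale : ∀ (k : ℕ) (z : Plane), (1 / 2 : ℝ) ^ k • (2 : ℝ) ^ k • z = z := fun k z => by
      rw [smul_smul, mul_comm, two_pow_mul_half_pow, one_smul]
    have hscale' : ∀ (k : ℕ) (z : Plane), (2 : ℝ) ^ k • (1 / 2 : ℝ) ^ k • z = z := fun k z => by
      rw [smul_smul, two_pow_mul_half_pow, one_smul]
    have hdist : ∀ k ≥ k₀, ∀ a b : Plane, supNorm a ≤ 2 ^ c → supNorm b ≤ 2 ^ c →
        |whitneyDist ((1 / 2 : ℝ) ^ k • a) ((1 / 2 : ℝ) ^ k • b) -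
          (1 / 2 : ℝ) ^ k * l1Norm (a - b)| ≤ ε * (1 / 2 : ℝ) ^ k := fun k hk a b ha hb =>
      (abs_whitneyDist_smul_sub_le (hk₀ k hk).1 ha hb).trans
        (mul_le_mul_of_nonneg_right (hk₀ k hk).2.le (hp k).le)
    refine ⟨k₀, blowUp, fun k hk => ⟨(continuous_blowUp k).measurable, ?_, ?_, ?_⟩, fun f _ => ?_⟩
    · simp [blowUp]
    · have hmem : ∀ x ∈ ball ((toPlane whitneyWeight₀).symm 0) (R * (1 / 2 : ℝ) ^ k),
          supNorm ((2 : ℝ) ^ k • toPlane whitneyWeight₀ x) ≤ 2 ^ c := by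
        intro x hx
        refine (supNorm_le_norm _).trans (le_trans ?_ hc.le)
        have h1 := (dist_toPlane_le _ _).trans (mem_ball.1 hx).le
        rw [Homeomorph.apply_symm_apply, dist_zero_right] at h1
        rw [norm_smul, Real.norm_of_nonneg (by positivity)]
        refine (mul_le_mul_of_nonneg_left h1 (by positivity)).trans_eq ?_
        rw [mul_left_comm, two_pow_mul_half_pow, mul_one]
      intro x hx y hy
      have h := hdist k hk _ _ (hmem x hx) (hmem y hy)
      rw [hscale, hscale, whitneyDist, Homeomorph.symm_apply_apply,
        Homeomorph.symm_apply_apply] at h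
      rwa [dist_eq_norm, blowUp, blowUp, ← map_sub, norm_toL1]
    -- The blow-up maps are bijections, so the ball is contained in the image itself; the margin `ε`
    -- in the radius absorbs the distortion of distances.
    · refine Subset.trans (fun y hy => ?_) (self_subset_thickening hε.1 _)
      obtain ⟨z, rfl⟩ := toL1.surjective y
      rw [mem_ball_zero_iff, norm_toL1] at hy
      refine ⟨(toPlane whitneyWeight₀).symm ((1 / 2 : ℝ) ^ k • z), ?_, ?_⟩
      · have h := hdist k hk z 0 ((supNorm_le_l1Norm z).trans (by linarith [hε.1]))
          (by simp [supNorm])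
        rw [smul_zero, sub_zero] at h
        have h2 := (abs_le.1 h).2
        rw [mem_ball]
        change whitneyDist _ _ < _
        nlinarith [hp k]
      · rw [blowUp, Homeomorph.apply_symm_apply, hscale']
    -- The Jacobian `4^{-k}` appears in the integral and in the normalizing volume, and cancels.
    · have hint : ∀ k : ℕ, ((μHE[2] : Measure (WeightedPlane whitneyWeight₀))
          (ball ((toPlane whitneyWeight₀).symm 0) ((1 / 2 : ℝ) ^ k))).toReal⁻¹ *
          ∫ y, f y ∂(((μHE[2] : Measure (WeightedPlane whitneyWeight₀)).restrict
            (ball ((toPlane whitneyWeight₀).symm 0) (R * (1 / 2 : ℝ) ^ k))).map (blowUp k)) =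
          (∫ z, blowUpIntegrand k 1 (fun _ => 1) z)⁻¹ *
            ∫ z, blowUpIntegrand k R (fun z => f (toL1 z)) z := by
        intro k
        have h1 := setIntegral_ball_blowUp k 1 fun _ => 1
        have h2 := setIntegral_ball_blowUp k R fun z => f (toL1 z)
        rw [setIntegral_const, one_mul, smul_eq_mul, mul_one] at h1
        rw [integral_map (continuous_blowUp k).aemeasurable
          f.continuous.aestronglyMeasurable]
        simp only [blowUp]
        rw [h2, ← measureReal_def, h1, mul_inv]
        field_simp
      simp_rw [hint]
      have t1 := tendsto_integral_blowUpIntegrand 1 (f := fun _ => 1) continuous_const (C := 1)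
        (fun _ => by simp)
      have t2 := tendsto_integral_blowUpIntegrand R (f := fun z => f (toL1 z))
        (f.continuous.comp toL1.continuous) (C := ‖f‖) (fun z => f.norm_coe_le_norm _)
      rw [setIntegral_const, smul_eq_mul, mul_one] at t1
      have h4 : (4 : ℝ) * unitAreaL1 ≠ 0 := (mul_pos four_pos unitAreaL1_pos).ne'
      have t3 := (t1.inv₀ h4).mul t2
      rw [setIntegral_tangentMeasure]
      convert! t3 using 2
      rw [← unitAreaL1]
      field_simp

end WeightedPlane

/-! ### Lower bounds for the relaxed energy in normed spaces -/

section lowerSemicontinuity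

theorem IsBddSuppLipschitz.slopeEnergy_lt_top {X : Type*} [MetricSpace X] [MeasurableSpace X]
    [BorelSpace X] {m : Measure X} (hm : ∀ s : Set X, Bornology.IsBounded s → m s < ⊤)
    {u : X → ℝ} (hu : IsBddSuppLipschitz u) : slopeEnergy m u < ⊤ := by
  obtain ⟨⟨K, hK⟩, hs⟩ := hu
  have hle : slopeEnergy m u ≤ ∫⁻ _ in tsupport u, (K : ℝ≥0∞) ^ 2 ∂m := by
    rw [← lintegral_indicator (isClosed_tsupport u).measurableSet]
    refine lintegral_mono fun x => ?_
    by_cases hx : x ∈ tsupport u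
    · rw [indicator_of_mem hx]
      exact pow_le_pow_left' (lipSlope_le_of_lipschitzWith hK x) 2
    · have h0 := notMem_tsupport_iff_eventuallyEq.1 hx
      have hslope : HasSlopeLE u x 0 := HasSlopeLE.of_eventually <| by
        filter_upwards [h0] with y hy
        rw [hy, h0.self_of_nhds]; simp
      have := lipSlope_le_of_hasSlopeLE hslope le_rfl
      rw [ENNReal.ofReal_zero, nonpos_iff_eq_zero] at this
      rw [this, zero_pow two_ne_zero]
      exact zero_le
  refine hle.trans_lt ?_
  rw [setLIntegral_const]
  exact ENNReal.mul_lt_top (by finiteness) (hm _ hs.closure)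

theorem IsBddSuppLipschitz.hasCompactSupport {X : Type*} [MetricSpace X] [ProperSpace X]
    {u : X → ℝ} (hu : IsBddSuppLipschitz u) : HasCompactSupport u :=
  hu.2.isCompact_closure

theorem IsBddSuppLipschitz.memLp {X : Type*} [MetricSpace X] [ProperSpace X] [MeasurableSpace X]
    [BorelSpace X] {m : Measure X} [IsFiniteMeasureOnCompacts m] {u : X → ℝ}
    (hu : IsBddSuppLipschitz u) (p : ℝ≥0∞) : MemLp u p m :=
  hu.continuous.memLp_of_hasCompactSupport hu.hasCompactSupport

theorem isLipApprox_const {X : Type*} [MetricSpace X] [MeasurableSpace X] {m : Measure X}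
    {u : X → ℝ} (hu : IsBddSuppLipschitz u) (h : MemLp u 2 m) :
    IsLipApprox m (fun _ => u) h.toLp := by
  refine ⟨fun _ => hu, tendsto_const_nhds.congr fun _ => ?_⟩
  rw [eq_comm, ← eLpNorm_zero (p := 2) (μ := m) (ε := ℝ)]
  refine eLpNorm_congr_ae ?_
  filter_upwards [h.coeFn_toLp] with x hx
  rw [hx, sub_self]; rfl

theorem relaxedEnergy_toLp_le {X : Type*} [MetricSpace X] [MeasurableSpace X] {m : Measure X}
    {u : X → ℝ} (hu : IsBddSuppLipschitz u) (h : MemLp u 2 m) :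
    relaxedEnergy m h.toLp ≤ slopeEnergy m u :=
  (iInf₂_le (fun _ => u) (isLipApprox_const hu h)).trans_eq (liminf_const _)

variable {E : Type*} [NormedAddCommGroup E] [NormedSpace ℝ E] [FiniteDimensional ℝ E]
  [MeasurableSpace E] [BorelSpace E] {μ : Measure E} [μ.IsAddHaarMeasure]

theorem IsBddSuppLipschitz.memLp_lineDeriv {w : E → ℝ} (hw : IsBddSuppLipschitz w) (v : E)
    (p : ℝ≥0∞) : MemLp (fun x => lineDeriv ℝ w x v) p μ := by
  have := FiniteDimensional.proper_real E
  obtain ⟨K, hK⟩ := hw.1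
  refine (hK.memLp_lineDeriv v).mono_exponent_of_measure_support_ne_top (s := tsupport w)
    (fun x hx => ?_) hw.hasCompactSupport.isCompact.measure_lt_top.ne le_top
  rw [(notMem_tsupport_iff_eventuallyEq.1 hx).lineDeriv_eq]
  simp [lineDeriv]

/-- Duality: `2ab - b² ≤ a²` bounds the energy of any competitor from below by the integral with a
fixed test function `w`. Integrating by parts moves the derivative onto `w`, so this integral passes
to the `L²`-limit of the competitors. -/
theorem ofReal_integral_le_relaxedEnergy {u w : E → ℝ} (hu : IsBddSuppLipschitz u)
    (hw : IsBddSuppLipschitz w) (h : MemLp u 2 μ) {v : E} (hv : ‖v‖ = 1) :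
    ENNReal.ofReal (∫ x, (2 * (lineDeriv ℝ u x v * w x) - w x ^ 2) ∂μ) ≤
      relaxedEnergy μ h.toLp := by
  have := FiniteDimensional.proper_real E
  have hmul : ∀ {φ ψ : E → ℝ}, MemLp φ 2 μ → MemLp ψ 2 μ → Integrable (fun x => φ x * ψ x) μ :=
    fun h1 h2 => h1.integrable_mul h2
  have hsplit : ∀ {φ : E → ℝ}, IsBddSuppLipschitz φ →
      ∫ x, (2 * (lineDeriv ℝ φ x v * w x) - w x ^ 2) ∂μ =
        2 * (∫ x, lineDeriv ℝ w x (-v) * φ x ∂μ) - ∫ x, w x ^ 2 ∂μ := by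
    intro φ hφ
    obtain ⟨K, hK⟩ := hφ.1
    obtain ⟨L, hL⟩ := hw.1
    rw [← hK.integral_lineDeriv_mul_eq hL hw.hasCompactSupport, integral_sub, integral_const_mul]
    · exact (hmul (hφ.memLp_lineDeriv v 2) (hw.memLp 2)).const_mul 2
    · simp_rw [sq]; exact hmul (hw.memLp 2) (hw.memLp 2)
  refine le_iInf₂ fun φ hφ => ?_
  have hD := hw.memLp_lineDeriv (μ := μ) (-v) 2
  have hlim : Tendsto (fun n => ∫ x, lineDeriv ℝ w x (-v) * φ n x ∂μ) atTop
      (𝓝 (∫ x, lineDeriv ℝ w x (-v) * u x ∂μ)) := by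
    refine tendsto_integral_of_L1' _ (hmul hD h).aestronglyMeasurable
      (Eventually.of_forall fun n => hmul hD ((hφ.1 n).memLp 2)) ?_
    have h0 := ENNReal.Tendsto.const_mul (a := eLpNorm (fun x => lineDeriv ℝ w x (-v)) 2 μ)
      hφ.2 (Or.inr hD.eLpNorm_ne_top)
    rw [mul_zero] at h0
    refine tendsto_of_tendsto_of_tendsto_of_le_of_le tendsto_const_nhds h0 (fun _ => zero_le)
      fun n => ?_
    have hle := eLpNorm_smul_le_mul_eLpNorm (p := 2) (q := 2) (r := 1)
      (((hφ.1 n).memLp 2).aestronglyMeasurable.sub (Lp.aestronglyMeasurable h.toLp))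
      hD.aestronglyMeasurable
    refine le_trans (le_of_eq (eLpNorm_congr_ae ?_)) hle
    filter_upwards [h.coeFn_toLp] with x hx
    simp only [Pi.sub_apply, Pi.smul_apply', smul_eq_mul, hx]
    ring
  have hlim' : Tendsto (fun n => ENNReal.ofReal
      (∫ x, (2 * (lineDeriv ℝ (φ n) x v * w x) - w x ^ 2) ∂μ)) atTop
      (𝓝 (ENNReal.ofReal (∫ x, (2 * (lineDeriv ℝ u x v * w x) - w x ^ 2) ∂μ))) := by
    refine ENNReal.tendsto_ofReal ?_
    rw [hsplit hu]
    simp_rw [fun n => hsplit (hφ.1 n)]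
    exact (hlim.const_mul 2).sub_const _
  rw [← hlim'.liminf_eq]
  refine liminf_le_liminf (Eventually.of_forall fun n => ?_)
  have hint : Integrable (fun x => 2 * (lineDeriv ℝ (φ n) x v * w x) - w x ^ 2) μ := by
    refine ((hmul ((hφ.1 n).memLp_lineDeriv v 2) (hw.memLp 2)).const_mul 2).sub ?_
    simp_rw [sq]
    exact hmul (hw.memLp 2) (hw.memLp 2)
  rw [integral_eq_lintegral_pos_part_sub_lintegral_neg_part hint]
  refine (ENNReal.ofReal_le_ofReal (sub_le_self _ ENNReal.toReal_nonneg)).trans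
    (ENNReal.ofReal_toReal_le.trans (lintegral_mono fun x => ?_))
  refine le_trans ?_ (pow_le_pow_left' (ofReal_abs_lineDeriv_le_lipSlope (φ n) x hv) 2)
  rw [← ENNReal.ofReal_pow (abs_nonneg _), sq_abs]
  refine ENNReal.ofReal_le_ofReal ?_
  nlinarith [sq_nonneg (lineDeriv ℝ (φ n) x v - w x)]

end lowerSemicontinuity

/-- The `L²` part of the norm always satisfies the parallelogram law, so the energy part inherits
it. -/
theorem InfinitesimallyHilbertian.relaxedEnergy_add_sub {X : Type*} [MetricSpace X]
    [MeasurableSpace X] [BorelSpace X] {m : Measure X} (h : InfinitesimallyHilbertian m)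
    {f g : Lp ℝ 2 m} (hf : relaxedEnergy m f < ⊤) (hg : relaxedEnergy m g < ⊤)
    (hadd : relaxedEnergy m (f + g) < ⊤) (hsub : relaxedEnergy m (f - g) < ⊤) :
    (relaxedEnergy m (f + g)).toReal + (relaxedEnergy m (f - g)).toReal =
      2 * (relaxedEnergy m f).toReal + 2 * (relaxedEnergy m g).toReal := by
  obtain ⟨B, hsymm, hBadd, hsmul, hB⟩ := h
  rw [← mem_sobolevSpace_iff] at hf hg hadd hsub
  have hg' : (-1 : ℝ) • g ∈ sobolevSpace m := by
    rw [mem_sobolevSpace_iff] at hg ⊢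
    rw [relaxedEnergy_smul hg]
    exact ENNReal.mul_lt_top ENNReal.ofReal_lt_top hg
  have e : f - g = f + (-1 : ℝ) • g := by module
  have key : ∀ g ∈ sobolevSpace m, f + g ∈ sobolevSpace m →
      B (f + g) (f + g) = B f f + 2 * B f g + B g g := by
    intro g hg hfg
    rw [hBadd f hf g hg _ hfg, hsymm f hf _ hfg, hsymm g hg _ hfg, hBadd f hf g hg f hf,
      hBadd f hf g hg g hg, hsymm g hg f hf]
    ring
  have h1 := key g hg hadd
  have h2 := key _ hg' (e ▸ hsub)
  rw [← e, hsymm f hf _ hg', hsmul _ g hg f hf, hsmul _ g hg _ hg', hsymm g hg _ hg',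
    hsmul _ g hg g hg, hsymm g hg f hf] at h2
  have h3 := parallelogram_law_with_norm ℝ f g
  rw [hB _ hadd, hB f hf, hB g hg, sobolevNorm_sq, sobolevNorm_sq, sobolevNorm_sq] at h1
  rw [hB _ hsub, hB f hf, hB g hg, sobolevNorm_sq, sobolevNorm_sq, sobolevNorm_sq] at h2
  linarith

/-! ### The ℓ¹-plane is not infinitesimally Hilbertian -/

section nonHilbertian

/-- The cone over the unit ball of the `ℓ¹`-plane. -/
noncomputable def coneL1 (x : PlaneL1) : ℝ := max 0 (1 - ‖x‖)

theorem coneL1_mem_Icc (x : PlaneL1) : coneL1 x ∈ Icc (0 : ℝ) 1 :=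
  ⟨le_max_left _ _, max_le zero_le_one (by linarith [norm_nonneg x])⟩

theorem lipschitzWith_coneL1 : LipschitzWith 1 coneL1 := by
  have h : LipschitzWith 1 fun x : PlaneL1 => 1 - ‖x‖ := LipschitzWith.of_dist_le_mul fun x y => by
    rw [NNReal.coe_one, one_mul, Real.dist_eq, sub_sub_sub_cancel_left, dist_eq_norm, norm_sub_rev]
    exact abs_norm_sub_norm_le y x
  exact h.const_max 0

theorem coneL1_eq_zero {x : PlaneL1} (hx : x ∉ closedBall (0 : PlaneL1) 1) : coneL1 x = 0 := by
  rw [mem_closedBall_zero_iff, not_le] at hx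
  exact max_eq_left (by linarith)

theorem lipschitzWith_apply_PlaneL1 (i : Fin 2) : LipschitzWith 1 fun x : PlaneL1 => x i :=
  LipschitzWith.of_dist_le_mul fun x y => by
    rw [NNReal.coe_one, one_mul, dist_eq_norm, dist_eq_norm]
    exact PiLp.norm_apply_le (x - y) i

theorem isBddSuppLipschitz_mul_coneL1 {φ : ℝ → ℝ} {K : ℝ≥0} (hφ : LipschitzWith K φ) {A : ℝ}
    (hA : ∀ t, |φ t| ≤ A) (i : Fin 2) : IsBddSuppLipschitz fun x : PlaneL1 => φ (x i) * coneL1 x := by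
  have hA0 : 0 ≤ A := (abs_nonneg _).trans (hA 0)
  refine ⟨⟨K + A.toNNReal, LipschitzWith.of_dist_le_mul fun x y => ?_⟩,
    (isBounded_closedBall (x := (0 : PlaneL1)) (r := 1)).subset fun x hx => ?_⟩
  · have h1 := (hφ.comp (lipschitzWith_apply_PlaneL1 i)).dist_le_mul x y
    have h2 := lipschitzWith_coneL1.dist_le_mul x y
    rw [mul_one] at h1
    rw [NNReal.coe_one, one_mul] at h2
    rw [Function.comp_apply, Function.comp_apply] at h1
    rw [Real.dist_eq] at h1 h2 ⊢
    have e : φ (x i) * coneL1 x - φ (y i) * coneL1 y =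
      (φ (x i) - φ (y i)) * coneL1 x + φ (y i) * (coneL1 x - coneL1 y) := by ring
    rw [e, NNReal.coe_add, Real.coe_toNNReal A hA0, add_mul]
    refine (abs_add_le _ _).trans ?_
    rw [abs_mul, abs_mul, abs_of_nonneg (coneL1_mem_Icc x).1]
    refine add_le_add ?_ (mul_le_mul (hA _) h2 (abs_nonneg _) hA0)
    exact (mul_le_of_le_one_right (abs_nonneg _) (coneL1_mem_Icc x).2).trans h1
  · by_contra h
    exact hx (by simp [coneL1_eq_zero h])

theorem continuous_apply_PlaneL1 (i : Fin 2) : Continuous fun x : PlaneL1 => x i :=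
  (lipschitzWith_apply_PlaneL1 i).continuous

/-- The coordinate functionals of the `ℓ¹`-plane. -/
noncomputable def coordL1 (i : Fin 2) : PlaneL1 →L[ℝ] ℝ := PiLp.proj 1 (fun _ : Fin 2 => ℝ) i

theorem coordL1_apply (i : Fin 2) (x : PlaneL1) : coordL1 i x = x i := rfl

theorem hasFDerivAt_mul_coneL1 {φ : ℝ → ℝ} {i : Fin 2} {x : PlaneL1} {k : ℝ}
    (hφ : HasDerivAt φ k (x i)) {c : PlaneL1 →L[ℝ] ℝ} (hc : HasFDerivAt coneL1 c x) :
    HasFDerivAt (fun y : PlaneL1 => φ (y i) * coneL1 y)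
      (φ (x i) • c + (coneL1 x * k) • coordL1 i) x := by
  have h1 : HasFDerivAt (fun y : PlaneL1 => y i) (coordL1 i) x :=
    (coordL1 i).hasFDerivAt
  have h2 := (hφ.comp_hasFDerivAt x h1).mul hc
  rw [smul_smul] at h2
  exact h2

/-- Covectors carry the norm dual to ℓ¹, the maximum norm; this is the source of non-Hilbertianity.
-/
theorem norm_proj_combination_le (a b : ℝ) :
    ‖a • coordL1 0 + b • coordL1 1‖ ≤
      max |a| |b| := by
  refine ContinuousLinearMap.opNorm_le_bound _ (le_max_of_le_left (abs_nonneg a)) fun v => ?_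
  rw [PiLp.norm_eq_of_L1, Fin.sum_univ_two, mul_add]
  refine (norm_add_le _ _).trans (add_le_add ?_ ?_)
  · change ‖a * v 0‖ ≤ _
    rw [norm_mul]
    exact mul_le_mul_of_nonneg_right (le_max_left _ _) (norm_nonneg _)
  · change ‖b * v 1‖ ≤ _
    rw [norm_mul]
    exact mul_le_mul_of_nonneg_right (le_max_right _ _) (norm_nonneg _)

/-- The gap is `(1 - max(a², b²)) min(a², b²) ≥ 0`. The polynomial on the right isolates the defect
`a²b²` from the sum `a² + b²` that the parallelogram law would require. -/
theorem max_abs_sq_le {a b : ℝ} (ha : |a| ≤ 1) (hb : |b| ≤ 1) :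
    max |a| |b| ^ 2 ≤ a ^ 2 + b ^ 2 - a ^ 2 * b ^ 2 := by
  have ha' : a ^ 2 ≤ 1 := (sq_le_one_iff_abs_le_one a).2 ha
  have hb' : b ^ 2 ≤ 1 := (sq_le_one_iff_abs_le_one b).2 hb
  rcases max_choice |a| |b| with h | h <;> rw [h, sq_abs]
  · nlinarith [mul_nonneg (sq_nonneg b) (sub_nonneg.2 ha')]
  · nlinarith [mul_nonneg (sq_nonneg a) (sub_nonneg.2 hb')]

variable {μ : Measure PlaneL1} [μ.IsAddHaarMeasure] {φ₀ φ₁ k₀ k₁ : ℝ → ℝ} {δ : ℝ}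

/-- Up to terms of size `δ` coming from the cone, the differential of the sum or difference has
coordinates `k₀ · cone` and `± k₁ · cone`, whose maximum norm is insensitive to the sign. -/
theorem slopeEnergy_wave_add_le (hδ : δ ≤ 1)
    (hφ₀ : ∀ t, HasDerivAt φ₀ (k₀ t) t) (hφ₁ : ∀ t, HasDerivAt φ₁ (k₁ t) t)
    (hk₀ : ∀ t, |k₀ t| ≤ 1) (hk₁ : ∀ t, |k₁ t| ≤ 1) (hc₀ : Continuous k₀) (hc₁ : Continuous k₁)
    (hb₀ : ∀ t, |φ₀ t| ≤ δ) (hb₁ : ∀ t, |φ₁ t| ≤ δ) {σ : ℝ} (hσ : |σ| = 1) :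
    slopeEnergy μ (fun x : PlaneL1 => φ₀ (x 0) * coneL1 x + σ * (φ₁ (x 1) * coneL1 x)) ≤
      ENNReal.ofReal (∫ x in closedBall (0 : PlaneL1) 1,
        ((k₀ (x 0) ^ 2 + k₁ (x 1) ^ 2 - k₀ (x 0) ^ 2 * k₁ (x 1) ^ 2) * coneL1 x ^ 2 + 8 * δ) ∂μ) := by
  have hδ0 : 0 ≤ δ := (abs_nonneg _).trans (hb₀ 0)
  have hcone := lipschitzWith_coneL1.continuous
  have hap := continuous_apply_PlaneL1
  have hmax : ∀ x : PlaneL1, max |k₀ (x 0)| |k₁ (x 1)| ^ 2 * coneL1 x ^ 2 ≤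
      (k₀ (x 0) ^ 2 + k₁ (x 1) ^ 2 - k₀ (x 0) ^ 2 * k₁ (x 1) ^ 2) * coneL1 x ^ 2 := fun x =>
    mul_le_mul_of_nonneg_right (max_abs_sq_le (hk₀ _) (hk₁ _)) (sq_nonneg _)
  have hnonneg : ∀ x : PlaneL1, 0 ≤
      (k₀ (x 0) ^ 2 + k₁ (x 1) ^ 2 - k₀ (x 0) ^ 2 * k₁ (x 1) ^ 2) * coneL1 x ^ 2 + 8 * δ := fun x =>
    add_nonneg (le_trans (by positivity) (hmax x)) (by positivity)
  rw [ofReal_integral_eq_lintegral_ofReal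
    (ContinuousOn.integrableOn_compact (isCompact_closedBall _ _)
      (Continuous.continuousOn (by have := hap 0; have := hap 1; fun_prop)))
    (Eventually.of_forall hnonneg), ← lintegral_indicator measurableSet_closedBall]
  refine lintegral_mono_ae ?_
  filter_upwards [lipschitzWith_coneL1.ae_differentiableAt (μ := μ)] with x hx
  by_cases hxB : x ∈ closedBall (0 : PlaneL1) 1
  · rw [indicator_of_mem hxB]
    obtain ⟨c, hc⟩ := hx
    have hcn : ‖c‖ ≤ 1 := hc.le_of_lipschitz lipschitzWith_coneL1
    have hd := (hasFDerivAt_mul_coneL1 (hφ₀ (x 0)) hc).add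
      ((hasFDerivAt_mul_coneL1 (hφ₁ (x 1)) hc).const_mul σ)
    have hle := lipSlope_le_of_hasSlopeLE hd.hasSlopeLE (norm_nonneg _)
    refine (pow_le_pow_left' hle 2).trans ?_
    rw [← ENNReal.ofReal_pow (norm_nonneg _)]
    refine ENNReal.ofReal_le_ofReal ?_
    have e : φ₀ (x 0) • c + (coneL1 x * k₀ (x 0)) • coordL1 0 +
        σ • (φ₁ (x 1) • c + (coneL1 x * k₁ (x 1)) • coordL1 1) =
        (φ₀ (x 0) + σ * φ₁ (x 1)) • c +
        ((coneL1 x * k₀ (x 0)) • coordL1 0 +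
          (σ * (coneL1 x * k₁ (x 1))) • coordL1 1) := by module
    have hM : ‖φ₀ (x 0) • c + (coneL1 x * k₀ (x 0)) • coordL1 0 +
        σ • (φ₁ (x 1) • c + (coneL1 x * k₁ (x 1)) • coordL1 1)‖ ≤
        2 * δ + coneL1 x * max |k₀ (x 0)| |k₁ (x 1)| := by
      rw [e]
      refine (norm_add_le _ _).trans (add_le_add ?_ ((norm_proj_combination_le _ _).trans_eq ?_))
      · rw [norm_smul, Real.norm_eq_abs]
        have h1 : |φ₀ (x 0) + σ * φ₁ (x 1)| ≤ 2 * δ := by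
          refine (abs_add_le _ _).trans ?_
          rw [abs_mul, hσ, one_mul]
          linarith [hb₀ (x 0), hb₁ (x 1)]
        exact (mul_le_mul h1 hcn (norm_nonneg _) (by positivity)).trans_eq (mul_one _)
      · rw [abs_mul, abs_mul, abs_mul, hσ, one_mul, abs_of_nonneg (coneL1_mem_Icc x).1,
          mul_max_of_nonneg _ _ (coneL1_mem_Icc x).1]
    refine (pow_le_pow_left₀ (norm_nonneg _) hM 2).trans ?_
    have hm := hmax x
    have hm1 : max |k₀ (x 0)| |k₁ (x 1)| ≤ 1 := max_le (hk₀ _) (hk₁ _)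
    have hm0 : 0 ≤ max |k₀ (x 0)| |k₁ (x 1)| := le_max_of_le_left (abs_nonneg _)
    have hp : coneL1 x * max |k₀ (x 0)| |k₁ (x 1)| ≤ 1 :=
      mul_le_one₀ (coneL1_mem_Icc x).2 hm0 hm1
    -- `(2δ + p)² ≤ p² + 8δ` for `p ≤ 1` and `δ ≤ 1`.
    nlinarith [mul_le_mul_of_nonneg_left hp hδ0, mul_le_mul_of_nonneg_left hδ hδ0]
  · rw [indicator_of_notMem hxB]
    have h0 : ∀ᶠ y in 𝓝 x, coneL1 y = 0 := by
      filter_upwards [isClosed_closedBall.isOpen_compl.mem_nhds hxB] with y hy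
      exact coneL1_eq_zero hy
    have hs : HasSlopeLE (fun x : PlaneL1 => φ₀ (x 0) * coneL1 x + σ * (φ₁ (x 1) * coneL1 x))
        x 0 := by
      refine HasSlopeLE.of_eventually ?_
      filter_upwards [h0] with y hy
      simp [hy, coneL1_eq_zero hxB]
    have := lipSlope_le_of_hasSlopeLE hs le_rfl
    rw [ENNReal.ofReal_zero, nonpos_iff_eq_zero] at this
    rw [this, zero_pow two_ne_zero]

/-- The test function `w = k · cone` is the leading part of `∂ᵢu`. The remainder `φ ∂ᵢcone` is at
most `δ` in absolute value, which costs `2δ` in the integrand `2 ∂ᵢu · w - w²`. -/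
theorem le_relaxedEnergy_wave {φ k : ℝ → ℝ} {K : ℝ≥0} (hK : LipschitzWith K k)
    (hφ : ∀ t, HasDerivAt φ (k t) t) (hk : ∀ t, |k t| ≤ 1) (hb : ∀ t, |φ t| ≤ δ) (i : Fin 2)
    (hu : IsBddSuppLipschitz fun x : PlaneL1 => φ (x i) * coneL1 x)
    (h : MemLp (fun x : PlaneL1 => φ (x i) * coneL1 x) 2 μ) :
    ENNReal.ofReal (∫ x in closedBall (0 : PlaneL1) 1,
      (k (x i) ^ 2 * coneL1 x ^ 2 - 2 * δ) ∂μ) ≤ relaxedEnergy μ h.toLp := by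
  have hw := isBddSuppLipschitz_mul_coneL1 hK hk i
  have hcone := lipschitzWith_coneL1.continuous
  have hkc := hK.continuous
  have hap := continuous_apply_PlaneL1 i
  have hv : ‖(PiLp.single 1 i 1 : PlaneL1)‖ = 1 := by rw [PiLp.norm_single, norm_one]
  refine le_trans (ENNReal.ofReal_le_ofReal ?_) (ofReal_integral_le_relaxedEnergy hu hw h hv)
  rw [← integral_indicator measurableSet_closedBall]
  refine integral_mono_ae ?_ ?_ ?_
  · refine (integrable_indicator_iff measurableSet_closedBall).2
      (ContinuousOn.integrableOn_compact (isCompact_closedBall _ _)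
        (Continuous.continuousOn (by fun_prop)))
  · refine (((hu.memLp_lineDeriv _ 2).integrable_mul (hw.memLp 2)).const_mul 2).sub ?_
    simp_rw [sq]
    exact (hw.memLp 2).integrable_mul (hw.memLp 2)
  · filter_upwards [lipschitzWith_coneL1.ae_differentiableAt (μ := μ)] with x hx
    by_cases hxB : x ∈ closedBall (0 : PlaneL1) 1
    · rw [indicator_of_mem hxB]
      obtain ⟨c, hc⟩ := hx
      have hcn : ‖c‖ ≤ 1 := hc.le_of_lipschitz lipschitzWith_coneL1
      have hd := ((hasFDerivAt_mul_coneL1 (hφ (x i)) hc).hasLineDerivAt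
        (PiLp.single 1 i 1 : PlaneL1)).lineDeriv
      have e : (φ (x i) • c + (coneL1 x * k (x i)) • coordL1 i)
          (PiLp.single 1 i 1 : PlaneL1) =
          φ (x i) * c (PiLp.single 1 i 1) + coneL1 x * k (x i) := by
        simp [coordL1_apply]
      rw [e] at hd
      rw [hd]
      have hce : |φ (x i) * c (PiLp.single 1 i 1) * (k (x i) * coneL1 x)| ≤ δ := by
        rw [abs_mul, abs_mul]
        have h1 : |c (PiLp.single 1 i 1)| ≤ 1 := by
          have := c.le_opNorm (PiLp.single 1 i 1)
          rw [hv, mul_one] at this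
          exact this.trans hcn
        have h2 : |k (x i) * coneL1 x| ≤ 1 := by
          rw [abs_mul, abs_of_nonneg (coneL1_mem_Icc x).1]
          exact mul_le_one₀ (hk _) (coneL1_mem_Icc x).1 (coneL1_mem_Icc x).2
        have hδ0 : 0 ≤ δ := (abs_nonneg _).trans (hb 0)
        calc |φ (x i)| * |c (PiLp.single 1 i 1)| * |k (x i) * coneL1 x| ≤ δ * 1 * 1 :=
              mul_le_mul (mul_le_mul (hb _) h1 (abs_nonneg _) hδ0) h2 (abs_nonneg _)
                (by positivity)
          _ = δ := by ring
      nlinarith [(abs_le.1 hce).1]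
    · rw [indicator_of_notMem hxB, coneL1_eq_zero hxB]
      simp

/-- With `V` the measure of the ball, the parallelogram law yields `2(P - 2δV) + 2(Q - 2δV) ≤ 2(P +
Q - T + 8δV)`, that is `T ≤ 12δV`. -/
theorem InfinitesimallyHilbertian.integral_wave_le (hH : InfinitesimallyHilbertian μ) (hδ : δ ≤ 1)
    (hφ₀ : ∀ t, HasDerivAt φ₀ (k₀ t) t) (hφ₁ : ∀ t, HasDerivAt φ₁ (k₁ t) t)
    (hk₀ : ∀ t, |k₀ t| ≤ 1) (hk₁ : ∀ t, |k₁ t| ≤ 1) {K₀ K₁ : ℝ≥0} (hK₀ : LipschitzWith K₀ k₀)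
    (hK₁ : LipschitzWith K₁ k₁) (hb₀ : ∀ t, |φ₀ t| ≤ δ) (hb₁ : ∀ t, |φ₁ t| ≤ δ) :
    ∫ x in closedBall (0 : PlaneL1) 1, k₀ (x 0) ^ 2 * k₁ (x 1) ^ 2 * coneL1 x ^ 2 ∂μ ≤
      12 * δ * μ.real (closedBall 0 1) := by
  have hlip : ∀ {φ k : ℝ → ℝ}, (∀ t, HasDerivAt φ (k t) t) → (∀ t, |k t| ≤ 1) →
      LipschitzWith 1 φ := fun hφ hk =>
    lipschitzWith_of_nnnorm_deriv_le (fun t => (hφ t).differentiableAt) fun t => by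
      rw [(hφ t).deriv]; exact_mod_cast hk t
  have hu₀ := isBddSuppLipschitz_mul_coneL1 (hlip hφ₀ hk₀) hb₀ 0
  have hu₁ := isBddSuppLipschitz_mul_coneL1 (hlip hφ₁ hk₁) hb₁ 1
  have m₀ := hu₀.memLp (m := μ) 2
  have m₁ := hu₁.memLp (m := μ) 2
  have hcone := lipschitzWith_coneL1.continuous
  have hc₀ := hK₀.continuous
  have hc₁ := hK₁.continuous
  have hap0 := continuous_apply_PlaneL1 0
  have hap1 := continuous_apply_PlaneL1 1
  have hint : ∀ {F : PlaneL1 → ℝ}, Continuous F → IntegrableOn F (closedBall 0 1) μ := fun hF =>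
    hF.continuousOn.integrableOn_compact (isCompact_closedBall _ _)
  have hconst : ∀ c : ℝ, ∫ _ in closedBall (0 : PlaneL1) 1, c ∂μ = c * μ.real (closedBall 0 1) :=
    fun c => by rw [setIntegral_const, smul_eq_mul, mul_comm]
  set P := ∫ x in closedBall (0 : PlaneL1) 1, k₀ (x 0) ^ 2 * coneL1 x ^ 2 ∂μ
  set Q := ∫ x in closedBall (0 : PlaneL1) 1, k₁ (x 1) ^ 2 * coneL1 x ^ 2 ∂μ
  set T := ∫ x in closedBall (0 : PlaneL1) 1, k₀ (x 0) ^ 2 * k₁ (x 1) ^ 2 * coneL1 x ^ 2 ∂μ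
  have hPQT : ∫ x in closedBall (0 : PlaneL1) 1,
      ((k₀ (x 0) ^ 2 + k₁ (x 1) ^ 2 - k₀ (x 0) ^ 2 * k₁ (x 1) ^ 2) * coneL1 x ^ 2 + 8 * δ) ∂μ =
      P + Q - T + 8 * δ * μ.real (closedBall 0 1) := by
    rw [integral_add (hint (by fun_prop)) (hint (by fun_prop)), hconst,
      ← integral_add (hint (by fun_prop)) (hint (by fun_prop)),
      ← integral_sub (hint (by fun_prop)) (hint (by fun_prop))]
    congr 2
    ext x
    ring
  have hup : ∀ σ : ℝ, |σ| = 1 → ∀ g : Lp ℝ 2 μ, g = m₀.toLp + σ • m₁.toLp →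
      relaxedEnergy μ g ≤ ENNReal.ofReal (P + Q - T + 8 * δ * μ.real (closedBall 0 1)) := by
    rintro σ hσ _ rfl
    have hs : IsBddSuppLipschitz
        fun x : PlaneL1 => φ₀ (x 0) * coneL1 x + σ * (φ₁ (x 1) * coneL1 x) :=
      hu₀.add (hu₁.const_mul σ)
    have e : m₀.toLp + σ • m₁.toLp = (m₀.add (m₁.const_smul σ)).toLp := by
      rw [MemLp.toLp_add m₀ (m₁.const_smul σ), MemLp.toLp_const_smul]
    rw [e, ← hPQT]
    exact (relaxedEnergy_toLp_le hs _).trans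
      (slopeEnergy_wave_add_le hδ hφ₀ hφ₁ hk₀ hk₁ hc₀ hc₁ hb₀ hb₁ hσ)
  have hadd := hup 1 abs_one (m₀.toLp + m₁.toLp) (by rw [one_smul])
  have hsub := hup (-1) (by simp) (m₀.toLp - m₁.toLp) (by module)
  have hlow₀ := le_relaxedEnergy_wave hK₀ hφ₀ hk₀ hb₀ 0 hu₀ m₀
  have hlow₁ := le_relaxedEnergy_wave hK₁ hφ₁ hk₁ hb₁ 1 hu₁ m₁
  have hfin : ∀ {u : PlaneL1 → ℝ} (hu : IsBddSuppLipschitz u) (h : MemLp u 2 μ),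
      relaxedEnergy μ h.toLp < ⊤ := fun hu h =>
    (relaxedEnergy_toLp_le hu h).trans_lt (hu.slopeEnergy_lt_top fun _ hs => hs.measure_lt_top)
  have key := hH.relaxedEnergy_add_sub (hfin hu₀ m₀) (hfin hu₁ m₁)
    (hadd.trans_lt ENNReal.ofReal_lt_top) (hsub.trans_lt ENNReal.ofReal_lt_top)
  have htop : 0 ≤ P + Q - T + 8 * δ * μ.real (closedBall 0 1) := by
    rw [← hPQT]
    refine integral_nonneg fun x => ?_
    have h0 : 0 ≤ δ := (abs_nonneg _).trans (hb₀ 0)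
    have h1 := (sq_nonneg _).trans (max_abs_sq_le (hk₀ (x 0)) (hk₁ (x 1)))
    have h2 := mul_nonneg h1 (sq_nonneg (coneL1 x))
    simp only [Pi.zero_apply]
    linarith
  have hPint : ∫ x in closedBall (0 : PlaneL1) 1, (k₀ (x 0) ^ 2 * coneL1 x ^ 2 - 2 * δ) ∂μ =
      P - 2 * δ * μ.real (closedBall 0 1) := by
    rw [integral_sub (hint (by fun_prop)) (hint (by fun_prop)), hconst]
  have hQint : ∫ x in closedBall (0 : PlaneL1) 1, (k₁ (x 1) ^ 2 * coneL1 x ^ 2 - 2 * δ) ∂μ =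
      Q - 2 * δ * μ.real (closedBall 0 1) := by
    rw [integral_sub (hint (by fun_prop)) (hint (by fun_prop)), hconst]
  rw [hPint, ENNReal.ofReal_le_iff_le_toReal (hfin hu₀ m₀).ne] at hlow₀
  rw [hQint, ENNReal.ofReal_le_iff_le_toReal (hfin hu₁ m₁).ne] at hlow₁
  have hadd' := ENNReal.toReal_le_of_le_ofReal htop hadd
  have hsub' := ENNReal.toReal_le_of_le_ofReal htop hsub
  linarith

/-- The waves `δ sin(t/δ + α)` have amplitude `δ` but derivatives of order one. Letting `δ → 0`
would force the integral of `coneL1 ^ 2` to vanish. -/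
theorem not_infinitesimallyHilbertian_PlaneL1 (μ : Measure PlaneL1) [μ.IsAddHaarMeasure] :
    ¬ InfinitesimallyHilbertian μ := by
  intro hH
  have hcone := lipschitzWith_coneL1.continuous
  have hap0 := continuous_apply_PlaneL1 0
  have hap1 := continuous_apply_PlaneL1 1
  have hint : ∀ {F : PlaneL1 → ℝ}, Continuous F → IntegrableOn F (closedBall 0 1) μ := fun hF =>
    hF.continuousOn.integrableOn_compact (isCompact_closedBall _ _)
  have hwave : ∀ δ : ℝ, 0 < δ → δ ≤ 1 → ∀ α β : ℝ,
      ∫ x in closedBall (0 : PlaneL1) 1, Real.cos (x 0 / δ + α) ^ 2 *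
        Real.cos (x 1 / δ + β) ^ 2 * coneL1 x ^ 2 ∂μ ≤ 12 * δ * μ.real (closedBall 0 1) := by
    intro δ hδ hδ1 α β
    have hd : ∀ α t, HasDerivAt (fun t => δ * Real.sin (t / δ + α)) (Real.cos (t / δ + α)) t := by
      intro α t
      have h := ((((hasDerivAt_id t).div_const δ).add_const α).sin).const_mul δ
      convert! h using 1
      simp only [id]
      field_simp
    have hl : ∀ α, LipschitzWith (Real.toNNReal δ⁻¹) fun t => Real.cos (t / δ + α) := fun α =>
      LipschitzWith.of_dist_le_mul fun s t => by
        rw [Real.dist_eq, Real.dist_eq, Real.coe_toNNReal _ (inv_pos.2 hδ).le]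
        refine (Real.abs_cos_sub_cos_le _ _).trans_eq ?_
        rw [add_sub_add_right_eq_sub, ← sub_div, abs_div, abs_of_pos hδ, div_eq_inv_mul]
    have hb : ∀ α t, |δ * Real.sin (t / δ + α)| ≤ δ := fun α t => by
      rw [abs_mul, abs_of_pos hδ]
      exact mul_le_of_le_one_right hδ.le (Real.abs_sin_le_one _)
    exact hH.integral_wave_le hδ1 (hd α) (hd β) (fun t => Real.abs_cos_le_one _)
      (fun t => Real.abs_cos_le_one _) (hl α) (hl β) (hb α) (hb β)
  have hle : ∀ δ : ℝ, 0 < δ → δ ≤ 1 →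
      ∫ x in closedBall (0 : PlaneL1) 1, coneL1 x ^ 2 ∂μ ≤ 48 * δ * μ.real (closedBall 0 1) := by
    intro δ hδ hδ1
    -- The four choices of phases `0` and `π/2` add up to `(cos² + sin²)(cos² + sin²) = 1`, which
    -- removes the oscillation without any averaging limit; hence `48 = 4 · 12`.
    have h00 := hwave δ hδ hδ1 0 0
    have h01 := hwave δ hδ hδ1 0 (Real.pi / 2)
    have h10 := hwave δ hδ hδ1 (Real.pi / 2) 0
    have h11 := hwave δ hδ hδ1 (Real.pi / 2) (Real.pi / 2)
    simp only [add_zero, Real.cos_add_pi_div_two, neg_sq] at h00 h01 h10 h11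
    have hsum : ∫ x in closedBall (0 : PlaneL1) 1, coneL1 x ^ 2 ∂μ =
        (∫ x in closedBall (0 : PlaneL1) 1, Real.cos (x 0 / δ) ^ 2 * Real.cos (x 1 / δ) ^ 2 *
          coneL1 x ^ 2 ∂μ) +
        (∫ x in closedBall (0 : PlaneL1) 1, Real.cos (x 0 / δ) ^ 2 * Real.sin (x 1 / δ) ^ 2 *
          coneL1 x ^ 2 ∂μ) +
        (∫ x in closedBall (0 : PlaneL1) 1, Real.sin (x 0 / δ) ^ 2 * Real.cos (x 1 / δ) ^ 2 *
          coneL1 x ^ 2 ∂μ) +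
        ∫ x in closedBall (0 : PlaneL1) 1, Real.sin (x 0 / δ) ^ 2 * Real.sin (x 1 / δ) ^ 2 *
          coneL1 x ^ 2 ∂μ := by
      rw [← integral_add (hint (by fun_prop)) (hint (by fun_prop)),
        ← integral_add (hint (by fun_prop)) (hint (by fun_prop)),
        ← integral_add (hint (by fun_prop)) (hint (by fun_prop))]
      congr 1
      ext x
      have e0 := Real.sin_sq_add_cos_sq (x 0 / δ)
      have e1 := Real.sin_sq_add_cos_sq (x 1 / δ)
      calc coneL1 x ^ 2 = (Real.sin (x 0 / δ) ^ 2 + Real.cos (x 0 / δ) ^ 2) *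
            (Real.sin (x 1 / δ) ^ 2 + Real.cos (x 1 / δ) ^ 2) * coneL1 x ^ 2 := by
            rw [e0, e1]; ring
        _ = _ := by ring
    linarith
  have hzero : ∫ x in closedBall (0 : PlaneL1) 1, coneL1 x ^ 2 ∂μ ≤ 0 := by
    have hlim : Tendsto (fun n : ℕ => 48 * (1 / ((n : ℝ) + 1)) * μ.real (closedBall (0 : PlaneL1) 1))
        atTop (𝓝 0) := by
      simpa using ((tendsto_one_div_add_atTop_nhds_zero_nat (𝕜 := ℝ)).const_mul 48).mul_const
        (μ.real (closedBall (0 : PlaneL1) 1))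
    refine ge_of_tendsto' hlim fun n => hle _ (by positivity) ?_
    rw [div_le_one (by positivity)]
    linarith [n.cast_nonneg (α := ℝ)]
  have hpos : 0 < ∫ x in closedBall (0 : PlaneL1) 1, coneL1 x ^ 2 ∂μ := by
    rw [setIntegral_pos_iff_support_of_nonneg_ae (Eventually.of_forall fun x => sq_nonneg _)
      (hint (by fun_prop))]
    refine (measure_ball_pos μ (0 : PlaneL1) one_pos).trans_le (measure_mono fun x hx => ?_)
    refine ⟨?_, ball_subset_closedBall hx⟩
    rw [mem_ball_zero_iff] at hx
    have : 0 < coneL1 x := lt_max_of_lt_right (by linarith)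
    exact (pow_pos this 2).ne'
  exact absurd hpos (not_lt.2 hzero)

end nonHilbertian

/-! ### Conclusion -/

theorem theorem1p2 :
    ∃ (ψ : ℕ → Plane → ℝ) (n : ℕ → ℕ) (ρ : Plane → ℝ),
      -- the weight, built on the Whitney decomposition
      IsProfileSequence ψ ∧ StrictMono n ∧ IsWhitneyWeight ψ n ρ ∧
      (∀ x, ρ x ∈ Icc (1 : ℝ) 2) ∧ ContDiffOn ℝ ∞ ρ {0}ᶜ ∧
      -- the metric measure space `(ℝ², d_ρ, m)`, with `m` its Hausdorff measure
      ∃ (X : Type) (_ : MetricSpace X) (_ : MeasurableSpace X) (_ : BorelSpace X)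
        (e : X ≃ₜ Plane) (m : Measure X),
        (∀ x y : X, edist x y = weightedEDist ρ (e x) (e y)) ∧
        m = μHE[2] ∧
        IsMetricMeasureSpace m ∧
        InfinitesimallyHilbertian m ∧
        IsMRectifiable m ∧
        IsAhlforsRegular 2 m ∧
        IsPISpace m ∧
        -- away from the origin it is a smooth Riemannian manifold
        (∃ g : PuncturedPlaneMetric,
          (∀ (x : puncturedPlane) (v w : Plane), g.form x v w = ρ x ^ 2 * inner ℝ v w) ∧
          (∀ x y : puncturedPlane, edist (e.symm x) (e.symm y) = g.riemEDist x y) ∧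
          ∀ s : Set puncturedPlane, MeasurableSet s →
            m ((fun x : puncturedPlane => e.symm x) '' s) = g.riemVolume s) ∧
        -- near the origin, `d_ρ` is close to the `ℓ¹`-distance
        (∀ k : ℕ, 2 ≤ k → ∀ a ∈ centralSquare k, ∀ b ∈ centralSquare k,
          |dist (e.symm a) (e.symm b) - l1Norm (a - b)| ≤ 1 / 4 ^ k) ∧
        -- the tangent cone at the origin has an infinitesimally non-Hilbertian element
        ∃ μ : Measure PlaneL1,
          IsPmGHTangent m (e.symm 0) μ (0 : PlaneL1) ∧ ¬ InfinitesimallyHilbertian μ := by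
  have hρ : ContDiffOn ℝ ∞ whitneyWeight₀ {0}ᶜ := whitneyWeight_contDiffOn _
  refine ⟨profile, fun j => j + 5, whitneyWeight₀, isProfileSequence_profile,
    fun i j hij => Nat.add_lt_add_right hij 5, isWhitneyWeight_whitneyWeight _,
    whitneyWeight_mem_Icc _, hρ, WeightedPlane whitneyWeight₀, inferInstance, inferInstance,
    inferInstance, WeightedPlane.toPlane whitneyWeight₀, μHE[2],
    WeightedPlane.edist_eq, rfl, WeightedPlane.isMetricMeasureSpace _,
    WeightedPlane.infinitesimallyHilbertian _, WeightedPlane.isMRectifiable _,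
    WeightedPlane.isAhlforsRegular _, WeightedPlane.isPISpace _,
    ⟨conformalMetric whitneyWeight₀ (AdmissibleWeight.one_le whitneyWeight₀) hρ,
      conformalMetric_form _ _, fun x y => ?_,
      fun s hs => WeightedPlane.measure_image_puncturedPlane _ hρ hs⟩,
    fun k _ a ha b hb => ?_,
    tangentMeasure, WeightedPlane.isPmGHTangent_tangentMeasure,
    not_infinitesimallyHilbertian_PlaneL1 _⟩
  · rw [WeightedPlane.edist_eq, Homeomorph.apply_symm_apply, Homeomorph.apply_symm_apply]
    exact edist_toPlane_symm_eq_riemEDist _ hρ x y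
  · rw [← one_div_pow]
    exact WeightedPlane.abs_whitneyDist_sub_l1Norm_le ha hb
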